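/- Let $(M,g)$ be a smooth pseudo-Riemannian manifold of dimension $m$ and signature $(p,q)$. On $\mathbb{T}M=TM\oplus T^{*}M$ consider the form $b(u+\sigma,v+\tau)=\tau(u)+\sigma(v)$, the Courant bracket $$[u+\sigma,v+\tau]=[u,v]+\mathcal{L}_u\tau-\mathcal{L}_v\sigma-\tfrac12 d(\tau(u)-\sigma(v)),$$ and, for $k=\pm1$, the endomorphism $I_k(u+\sigma)=k(g^\flat)^{-1}\sigma+g^\flat u$. For $\lambda,\ell\in\{1,-1\}$ and $x\in M$ let $\sigma_x(\lambda,\ell)$ be the set of all $S\in\mathrm{End}_{\mathbb R}(\mathbb{T}_xM)$ such that $S^2=\lambda\,\mathrm{id}$, $\mathrm{tr}\,S=0$, $S$ is skew-symmetric for $b$, and $SI_k=-I_kS$ with $k=-\lambda\ell$. An integrable $(\lambda,\ell)$-structure on $(M,g)$ is a smooth section $S$ of $\mathrm{End}(\mathbb{T}M)$ with $S_x\in\sigma_x(\lambda,\ell)$ for all $x$ such that the smooth sections of each of the $\pm\sqrt\lambda$-eigendistributions of $S$ (in the complexification of $\mathbb{T}M$ if $\lambda=-1$) are closed under the (complexified)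 Courant bracket. For $S\in\sigma_x(1,1)$ write $\mathrm{sig}(S)=n$ if the symmetric form $b(SI_{-1}\cdot,\cdot)$ has signature $(2n,2m-2n)$; let $\sigma_x(1,1;n)$ be the set of these $S$. Every $S\in\sigma_x(1,1)$ has $\mathrm{sig}(S)=n$ for some $0\le n\le m$, and an integrable $(1,1;n)$-structure is an integrable $(1,1)$-structure with $\mathrm{sig}=n$ at every point. Then, in each of the following cases, the union over $x\in M$ of the indicated sets is an embedded submanifold of the total space of $\mathrm{End}(\mathbb{T}M)$ and a smooth fiber bundle over $M$ whose typical fiber is the homogeneous space $G/H$ with its standard smooth structure, and the corresponding integrable structures are exactly the smooth sections of this bundle that satisfy the closedness condition under the Courant bracket: 1. $\sigma_x(1,1;n)$, for each $0\le n\le m$: $G=O(m,\mathbb{C})$, $H=O(n,m-n)$ (acting on a real form of $\mathbb{C}^m$ on which the complex symmetric form is real of signature $(n,m-n)$). 2. $\sigma_x(1,-1)$: $G=O(p,q)\times O(p,q)$, $H=O(p,q)$ (the diagonal). 3. $\sigma_x(-1,1)$, for $p=q$: $G=O(p,p)\times O(p,p)$, $H=O(p,p)$ (the diagonal). If some $\sigma_x(-1,1)$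 is nonempty, in particular if $M\neq\emptyset$ and $(M,g)$ admits an integrable $(-1,1)$-structure, then $p=q$. 4. $\sigma_x(-1,-1)$, for $m$ even: $G=O(m,\mathbb{C})$, $H=SO^{*}(m)$, the group of automorphisms of a nondegenerate skew-Hermitian form on $\mathbb{H}^{m/2}$, embedded in $O(m,\mathbb{C})$ via $\mathbb{H}^{m/2}=\mathbb{C}^{m}$. If some $\sigma_x(-1,-1)$ is nonempty, then $m$ is even. -/

import Mathlib

open Bundle Manifold
open scoped ContDiff Manifold Topology MatrixGroups Matrix Quaternion

noncomputable section

/-! ### Linear algebra: signatures -/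

/-- The real symmetric bilinear form `B` has signature `(p, q)`. -/
def HasSignature {V : Type*} [AddCommGroup V] [Module ℝ V] (B : LinearMap.BilinForm ℝ V)
    (p q : ℕ) : Prop :=
  sigPos B.toQuadraticMap = p ∧ sigNeg B.toQuadraticMap = q

/-! ### The extended tangent bundle and its endomorphism bundle -/

/-- The fiber `T_x M ⊕ T_x^* M` of the extended tangent bundle. -/
abbrev ExtTangent (m : ℕ) {M : Type*} [TopologicalSpace M]
    [ChartedSpace (EuclideanSpace ℝ (Fin m)) M] (x : M) : Type :=
  TangentSpace (𝓡 m) x × (TangentSpace (𝓡 m) x →L[ℝ] Trivial M ℝ x)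

/-- The model fiber `ℝ^m ⊕ (ℝ^m)^*` of the extended tangent bundle. -/
abbrev ExtModel (m : ℕ) : Type :=
  EuclideanSpace ℝ (Fin m) × (EuclideanSpace ℝ (Fin m) →L[ℝ] ℝ)

/-- The fiber `End (T_x M ⊕ T_x^* M)`. -/
abbrev EndExt (m : ℕ) {M : Type*} [TopologicalSpace M]
    [ChartedSpace (EuclideanSpace ℝ (Fin m)) M] (x : M) : Type :=
  ExtTangent m x →L[ℝ] ExtTangent m x

/-- The model fiber of the endomorphism bundle. -/
abbrev EndModel (m : ℕ) : Type := ExtModel m →L[ℝ] ExtModel m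

/-- The total space of the vector bundle `End (TM ⊕ T^*M)`; it is a manifold modelled on
`(𝓡 m).prod 𝓘(ℝ, EndModel m)`. -/
abbrev EndTotal (m : ℕ) (M : Type*) [TopologicalSpace M]
    [ChartedSpace (EuclideanSpace ℝ (Fin m)) M] : Type _ :=
  TotalSpace (EndModel m) (fun x : M => EndExt m x)

section Manifold

variable {m : ℕ} {M : Type*} [TopologicalSpace M] [ChartedSpace (EuclideanSpace ℝ (Fin m)) M]

/-- The canonical split form `b (u + σ, v + τ) = τ u + σ v`. -/
def canonicalForm (x : M) : LinearMap.BilinForm ℝ (ExtTangent m x) :=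
  LinearMap.mk₂ ℝ (fun X Y => (Y.2 X.1 + X.2 Y.1 : ℝ))
    (fun X X' Y => by
      simp only [Prod.fst_add, Prod.snd_add, map_add, add_apply]
      exact add_add_add_comm (G := ℝ) _ _ _ _)
    (fun c X Y => by
      simp only [Prod.smul_fst, Prod.smul_snd, map_smul, smul_apply]
      exact (smul_add (A := ℝ) c _ _).symm)
    (fun X Y Y' => by
      simp only [Prod.fst_add, Prod.snd_add, map_add, add_apply]
      exact add_add_add_comm (G := ℝ) _ _ _ _)
    (fun c X Y => by
      simp only [Prod.smul_fst, Prod.smul_snd, map_smul, smul_apply]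
      exact (smul_add (A := ℝ) c _ _).symm)

variable [IsManifold (𝓡 m) ∞ M]

/-- A smooth section of `TM ⊕ T^*M`. -/
def IsSmoothExtSection (X : ∀ x : M, ExtTangent m x) : Prop :=
  ContMDiff (𝓡 m) ((𝓡 m).prod 𝓘(ℝ, ExtModel m)) ∞ (fun x => TotalSpace.mk' (ExtModel m) x (X x))

/-- A smooth section of `End (TM ⊕ T^*M)`. -/
def IsSmoothEndSection (S : ∀ x : M, EndExt m x) : Prop :=
  ContMDiff (𝓡 m) ((𝓡 m).prod 𝓘(ℝ, EndModel m)) ∞ (fun x => TotalSpace.mk' (EndModel m) x (S x))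

end Manifold

/-! ### Pseudo-Riemannian metrics -/

/-- A smooth pseudo-Riemannian metric on `M`; `flat x` is the map `g^♭ : T_x M → T_x^* M`,
`g^♭ u v = g (u, v)`. -/
structure PseudoRiemannianMetric (m : ℕ) (M : Type*) [TopologicalSpace M]
    [ChartedSpace (EuclideanSpace ℝ (Fin m)) M] [IsManifold (𝓡 m) ∞ M] where
  flat (x : M) : TangentSpace (𝓡 m) x →L[ℝ] (TangentSpace (𝓡 m) x →L[ℝ] Trivial M ℝ x)
  symm (x : M) (v w : TangentSpace (𝓡 m) x) : flat x v w = flat x w v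
  nondegenerate (x : M) (v : TangentSpace (𝓡 m) x) : (∀ w, flat x v w = 0) → v = 0
  contMDiff : ContMDiff (𝓡 m)
    ((𝓡 m).prod 𝓘(ℝ, EuclideanSpace ℝ (Fin m) →L[ℝ] EuclideanSpace ℝ (Fin m) →L[ℝ] ℝ)) ∞
    (fun x => TotalSpace.mk' (EuclideanSpace ℝ (Fin m) →L[ℝ] EuclideanSpace ℝ (Fin m) →L[ℝ] ℝ) x
      (flat x))

section Structures

variable {m : ℕ} {M : Type*} [TopologicalSpace M] [ChartedSpace (EuclideanSpace ℝ (Fin m)) M]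
  [IsManifold (𝓡 m) ∞ M]

/-- The metric at `x` as a bilinear form on the tangent space. -/
def PseudoRiemannianMetric.form (g : PseudoRiemannianMetric m M) (x : M) :
    LinearMap.BilinForm ℝ (TangentSpace (𝓡 m) x) :=
  LinearMap.mk₂ ℝ (fun v w => (g.flat x v w : ℝ))
    (fun v v' w => by rw [map_add]; rfl)
    (fun c v w => by rw [map_smul]; rfl)
    (fun v w w' => map_add (g.flat x v) w w')
    (fun c v w => map_smul (g.flat x v) c w)

/-- `g` has signature `(p, q)` at every point. -/
def PseudoRiemannianMetric.HasSignature (g : PseudoRiemannianMetric m M) (p q : ℕ) : Prop :=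
  ∀ x, _root_.HasSignature (g.form x) p q

/-- The endomorphism `I_k (u + σ) = k (g^♭)⁻¹ σ + g^♭ u` of `T_x M ⊕ T_x^* M`. Since `g^♭` is
invertible, `ContinuousLinearMap.inverse` is its inverse. -/
def structureI (g : PseudoRiemannianMetric m M) (k : ℝ) (x : M) : EndExt m x :=
  ((k • (g.flat x).inverse).comp (ContinuousLinearMap.snd ℝ _ _)).prod
    ((g.flat x).comp (ContinuousLinearMap.fst ℝ _ _))

/-! ### The Courant bracket -/

/-- The Lie derivative of the one-form `τ` along the vector field `u`, computed in the chart around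
`x`: if `u'`, `τ'` are the coordinate expressions of `u`, `τ`, then
`(L_u τ)(w) = (D τ' (u')) (w) + τ' (D u' (w))`. -/
def lieDerivForm (u : ∀ x : M, TangentSpace (𝓡 m) x)
    (τ : ∀ x : M, TangentSpace (𝓡 m) x →L[ℝ] Trivial M ℝ x) (x : M) :
    TangentSpace (𝓡 m) x →L[ℝ] Trivial M ℝ x :=
  let φ := extChartAt (𝓡 m) x
  let u' : EuclideanSpace ℝ (Fin m) → EuclideanSpace ℝ (Fin m) :=
    VectorField.mpullback 𝓘(ℝ, EuclideanSpace ℝ (Fin m)) (𝓡 m) φ.symm u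
  let τ' : EuclideanSpace ℝ (Fin m) → (EuclideanSpace ℝ (Fin m) →L[ℝ] ℝ) := fun y =>
    (τ (φ.symm y)).comp (mfderiv 𝓘(ℝ, EuclideanSpace ℝ (Fin m)) (𝓡 m) φ.symm y)
  (fderiv ℝ τ' (φ x) (u' (φ x)) + (τ' (φ x)).comp (fderiv ℝ u' (φ x))).comp
    (mfderiv (𝓡 m) 𝓘(ℝ, EuclideanSpace ℝ (Fin m)) φ x)

/-- The differential of a real function, as a one-form. -/
def differential (f : M → ℝ) (x : M) : TangentSpace (𝓡 m) x →L[ℝ] Trivial M ℝ x :=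
  mfderiv (𝓡 m) 𝓘(ℝ, ℝ) f x

/-- The Courant bracket
`[u + σ, v + τ] = [u, v] + L_u τ - L_v σ - (1/2) d (τ u - σ v)`. -/
def courantBracket (X Y : ∀ x : M, ExtTangent m x) (x : M) : ExtTangent m x :=
  (VectorField.mlieBracket (𝓡 m) (fun y => (X y).1) (fun y => (Y y).1) x,
    lieDerivForm (fun y => (X y).1) (fun y => (Y y).2) x
      - lieDerivForm (fun y => (Y y).1) (fun y => (X y).2) x
      - (1 / 2 : ℝ) • differential (fun y => ((Y y).2 (X y).1 - (X y).2 (Y y).1 : ℝ)) x)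

/-- For `S² = id`: the smooth sections of each of the `±1`-eigendistributions of `S` are closed
under the Courant bracket. -/
def IsRealInvolutive (S : ∀ x : M, EndExt m x) : Prop :=
  ∀ δ : ℝ, (δ = 1 ∨ δ = -1) → ∀ X Y : ∀ x : M, ExtTangent m x,
    IsSmoothExtSection X → IsSmoothExtSection Y →
    (∀ x, S x (X x) = δ • X x) → (∀ x, S x (Y x) = δ • Y x) →
    ∀ x, S x (courantBracket X Y x) = δ • courantBracket X Y x

/-- For `S² = -id`: the smooth sections of each of the `±i`-eigendistributions of `S` in the
complexification of `TM ⊕ T^*M` are closed under the complex bilinear extension of the Courant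
bracket. A complex section is written `X + i X'`, and `S (X + i X') = δ i (X + i X')` means
`S X = - δ X'` and `S X' = δ X`; the bracket of `X + i X'` and `Y + i Y'` is
`([X, Y] - [X', Y']) + i ([X, Y'] + [X', Y])`. -/
def IsComplexInvolutive (S : ∀ x : M, EndExt m x) : Prop :=
  ∀ δ : ℝ, (δ = 1 ∨ δ = -1) → ∀ X X' Y Y' : ∀ x : M, ExtTangent m x,
    IsSmoothExtSection X → IsSmoothExtSection X' → IsSmoothExtSection Y → IsSmoothExtSection Y' →
    (∀ x, S x (X x) = -(δ • X' x)) → (∀ x, S x (X' x) = δ • X x) →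
    (∀ x, S x (Y x) = -(δ • Y' x)) → (∀ x, S x (Y' x) = δ • Y x) →
    ∀ x,
      S x (courantBracket X Y x - courantBracket X' Y' x)
          = -(δ • (courantBracket X Y' x + courantBracket X' Y x)) ∧
      S x (courantBracket X Y' x + courantBracket X' Y x)
          = δ • (courantBracket X Y x - courantBracket X' Y' x)

/-- Closedness under the Courant bracket of the sections of the `±√lam`-eigendistributions,
`lam = ±1`. -/
def IsCourantInvolutive (lam : ℝ) (S : ∀ x : M, EndExt m x) : Prop :=
  (lam = 1 → IsRealInvolutive S) ∧ (lam = -1 → IsComplexInvolutive S)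

/-! ### Integrable `(lam, ell)`-structures -/

/-- The algebraic conditions at a point `x` for a generalized complex (`lam = -1`) or paracomplex
(`lam = 1`) structure: `S² = lam id`, `S` is split and skew-symmetric for `b`. -/
structure IsGeneralizedAt (lam : ℝ) (x : M) (S : EndExt m x) : Prop where
  sq : S.comp S = lam • ContinuousLinearMap.id ℝ (ExtTangent m x)
  split : LinearMap.trace ℝ (ExtTangent m x) S.toLinearMap = 0
  skew : ∀ X Y, canonicalForm x (S X) Y = -canonicalForm x X (S Y)

/-- Generalized complex (`lam = -1`) and generalized paracomplex (`lam = 1`) structures. -/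
structure IsGeneralizedStructure (lam : ℝ) (S : ∀ x : M, EndExt m x) : Prop where
  smooth : IsSmoothEndSection S
  generalized : ∀ x, IsGeneralizedAt lam x (S x)
  involutive : IsCourantInvolutive lam S

/-- `S` anti-commutes with `I_k` at `x`, where `k = - lam ell`. -/
def IsCompatibleAt (g : PseudoRiemannianMetric m M) (lam ell : ℝ) (x : M) (S : EndExt m x) : Prop :=
  S.comp (structureI g (-(lam * ell)) x) = -(structureI g (-(lam * ell)) x).comp S

/-- Integrable `(lam, ell)`-structures on `(M, g)`, `lam, ell = ±1`. -/
structure IsIntegrableStructure (g : PseudoRiemannianMetric m M) (lam ell : ℝ)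
    (S : ∀ x : M, EndExt m x) : Prop where
  generalized : IsGeneralizedStructure lam S
  compatible : ∀ x, IsCompatibleAt g lam ell x (S x)

/-- The form `β_S (X, Y) = b (S I_{-1} X, Y)` at `x`. -/
def signatureForm (g : PseudoRiemannianMetric m M) (x : M) (S : EndExt m x) :
    LinearMap.BilinForm ℝ (ExtTangent m x) :=
  (canonicalForm x).compLeft (S.comp (structureI g (-1) x)).toLinearMap

/-- `sig S = n` at `x`: the form `β_S` has signature `(2 n, 2 m - 2 n)`. -/
def HasSigAt (g : PseudoRiemannianMetric m M) (n : ℕ) (x : M) (S : EndExt m x) : Prop :=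
  HasSignature (signatureForm g x S) (2 * n) (2 * m - 2 * n)

/-- Integrable `(1, 1; n)`-structures on `(M, g)`. -/
structure IsIntegrableStructureSig (g : PseudoRiemannianMetric m M) (n : ℕ)
    (S : ∀ x : M, EndExt m x) : Prop where
  integrable : IsIntegrableStructure g 1 1 S
  sig : ∀ x, HasSigAt g n x (S x)

/-- The total space of the `(lam, ell)`-twistor bundle, as a subset of `End (TM ⊕ T^*M)`. -/
def twistorSpace (g : PseudoRiemannianMetric m M) (lam ell : ℝ) : Set (EndTotal m M) :=
  {z | IsGeneralizedAt lam z.proj z.snd ∧ IsCompatibleAt g lam ell z.proj z.snd}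

/-- The total space of the `(1, 1; n)`-twistor bundle. -/
def twistorSpaceSig (g : PseudoRiemannianMetric m M) (n : ℕ) : Set (EndTotal m M) :=
  {z | z ∈ twistorSpace g 1 1 ∧ HasSigAt g n z.proj z.snd}

end Structures

/-! ### Homogeneous spaces and fiber bundles -/

/-- The given atlas on `Γ ⧸ H` is the smooth structure of the homogeneous space, where `Γ` is a
closed linear group embedded in the vector space `V` by `emb`: the projection `Γ → Γ ⧸ H` is smooth
and has smooth local sections around every point. (This determines the smooth structure.) -/
structure IsHomogeneousManifold {Γ V : Type*} [Group Γ] [TopologicalSpace Γ]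
    [NormedAddCommGroup V] [NormedSpace ℝ V] (emb : Γ → V) (H : Subgroup Γ) (d : ℕ)
    [ChartedSpace (EuclideanSpace ℝ (Fin d)) (Γ ⧸ H)] : Prop where
  isManifold : IsManifold (𝓡 d) ∞ (Γ ⧸ H)
  smooth_proj : ∃ F : V → Γ ⧸ H, (∀ a : Γ, F (emb a) = (a : Γ ⧸ H)) ∧
    ContMDiffOn 𝓘(ℝ, V) (𝓡 d) ∞ F (Set.range emb)
  smooth_section : ∀ y : Γ ⧸ H, ∃ U ∈ 𝓝 y, ∃ s : Γ ⧸ H → Γ, (∀ z ∈ U, (s z : Γ ⧸ H) = z) ∧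
    ContMDiffOn (𝓡 d) 𝓘(ℝ, V) ∞ (fun z => emb (s z)) U

/-- The subset `Z` of `End (TM ⊕ T^*M)` (with the induced topology) is an embedded submanifold of
the total space `End (TM ⊕ T^*M)` and, with the restriction of the projection to `M`, a smooth fiber
bundle over `M` with typical fiber the homogeneous space `Γ ⧸ H`; moreover a field `S` of
endomorphisms of `TM ⊕ T^*M` has the property `P` if and only if it is a smooth section of that
bundle which is Courant involutive. -/
def IsTwistorBundle {m : ℕ} {M : Type*} [TopologicalSpace M]
    [ChartedSpace (EuclideanSpace ℝ (Fin m)) M] [IsManifold (𝓡 m) ∞ M]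
    {Γ V : Type*} [Group Γ] [TopologicalSpace Γ] [NormedAddCommGroup V] [NormedSpace ℝ V]
    (Z : Set (EndTotal m M)) (emb : Γ → V) (H : Subgroup Γ) (lam : ℝ)
    (P : (∀ x : M, EndExt m x) → Prop) : Prop :=
  ∃ (d : ℕ) (_ : ChartedSpace (EuclideanSpace ℝ (Fin d)) (Γ ⧸ H))
    (_ : ChartedSpace (ModelProd (EuclideanSpace ℝ (Fin m)) (EuclideanSpace ℝ (Fin d))) Z),
    IsHomogeneousManifold emb H d ∧
    IsManifold ((𝓡 m).prod (𝓡 d)) ∞ Z ∧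
    ContMDiff ((𝓡 m).prod (𝓡 d)) ((𝓡 m).prod 𝓘(ℝ, EndModel m)) ∞ (fun z : Z => (z : EndTotal m M)) ∧
    (∀ z : Z, Function.Injective (mfderiv ((𝓡 m).prod (𝓡 d)) ((𝓡 m).prod 𝓘(ℝ, EndModel m))
      (fun z : Z => (z : EndTotal m M)) z)) ∧
    (∀ x : M, ∃ e : Trivialization (Γ ⧸ H) (fun z : Z => (z : EndTotal m M).proj),
      x ∈ e.baseSet ∧
      ContMDiffOn ((𝓡 m).prod (𝓡 d)) ((𝓡 m).prod (𝓡 d)) ∞ e e.source ∧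
      ContMDiffOn ((𝓡 m).prod (𝓡 d)) ((𝓡 m).prod (𝓡 d)) ∞ e.toOpenPartialHomeomorph.symm
        e.target) ∧
    ∀ S : ∀ x : M, EndExt m x, P S ↔
      (∃ s : M → Z, ContMDiff (𝓡 m) ((𝓡 m).prod (𝓡 d)) ∞ s ∧
        ∀ x, (s x : EndTotal m M) = TotalSpace.mk' (EndModel m) x (S x)) ∧
      IsCourantInvolutive lam S

/-! ### The classical groups -/

section Groups

/-- The group of invertible matrices `A` with `Aᵀ B A = B`. -/
def formGroup {ι K : Type*} [Fintype ι] [DecidableEq ι] [CommRing K] (B : Matrix ι ι K) :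
    Subgroup (GL ι K) where
  carrier := {A | (A : Matrix ι ι K)ᵀ * B * (A : Matrix ι ι K) = B}
  one_mem' := by simp
  mul_mem' {A C} hA hC := by
    simp only [Set.mem_ofPred_eq, Units.val_mul, Matrix.transpose_mul] at *
    calc _ = (C : Matrix ι ι K)ᵀ * ((A : Matrix ι ι K)ᵀ * B * (A : Matrix ι ι K)) * C := by
          simp only [mul_assoc]
      _ = B := by rw [hA, hC]
  inv_mem' {A} hA := by
    simp only [Set.mem_ofPred_eq] at *
    have h1 : (A : Matrix ι ι K) * ((A⁻¹ : GL ι K) : Matrix ι ι K) = 1 := by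
      rw [← Units.val_mul]; simp
    have h2 : ((A⁻¹ : GL ι K) : Matrix ι ι K)ᵀ * (A : Matrix ι ι K)ᵀ = 1 := by
      rw [← Matrix.transpose_mul, h1, Matrix.transpose_one]
    calc _ = ((A⁻¹ : GL ι K) : Matrix ι ι K)ᵀ * ((A : Matrix ι ι K)ᵀ * B * (A : Matrix ι ι K)) *
          ((A⁻¹ : GL ι K) : Matrix ι ι K) := by rw [hA]
      _ = (((A⁻¹ : GL ι K) : Matrix ι ι K)ᵀ * (A : Matrix ι ι K)ᵀ) * B *
          ((A : Matrix ι ι K) * ((A⁻¹ : GL ι K) : Matrix ι ι K)) := by simp only [mul_assoc]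
      _ = B := by rw [h1, h2]; simp

/-- The complex orthogonal group `O(m, ℂ)`, with `m` the number of elements of `ι`. -/
abbrev complexOrthogonal (ι : Type*) [Fintype ι] [DecidableEq ι] : Subgroup (GL ι ℂ) :=
  formGroup (1 : Matrix ι ι ℂ)

/-- The orthogonal group `O(p, q)` of the form `diag (1_p, -1_q)`. -/
abbrev pseudoOrthogonal (p q : ℕ) : Subgroup (GL (Fin p ⊕ Fin q) ℝ) :=
  formGroup (LieAlgebra.Orthogonal.indefiniteDiagonal (Fin p) (Fin q) ℝ)

/-- The entries of a matrix in a linear group. -/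
def entries {ι K : Type*} [Fintype ι] [DecidableEq ι] [CommRing K] {G : Subgroup (GL ι K)}
    (A : G) : ι → ι → K :=
  fun i j => ((A : GL ι K) : Matrix ι ι K) i j

/-- The entries of a pair of matrices in a linear group. -/
def entriesPair {ι K : Type*} [Fintype ι] [DecidableEq ι] [CommRing K] {G : Subgroup (GL ι K)}
    (A : G × G) : (ι → ι → K) × (ι → ι → K) :=
  (entries A.1, entries A.2)

/-- The matrix `diag (1_n, i 1_n')`. -/
def unitDiag (n n' : ℕ) : GL (Fin n ⊕ Fin n') ℂ where
  val := LieAlgebra.Orthogonal.Pso (Fin n) (Fin n') ℂ Complex.I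
  inv := LieAlgebra.Orthogonal.Pso (Fin n) (Fin n') ℂ (-Complex.I)
  val_inv := LieAlgebra.Orthogonal.pso_inv _ _ _ Complex.I_mul_I
  inv_val := by
    simpa using LieAlgebra.Orthogonal.pso_inv (Fin n) (Fin n') ℂ (i := -Complex.I) (by simp)

/-- `O(n, n')` inside `O(n + n', ℂ)`: the complexification of the form `diag (1_n, -1_n')` is
carried to the standard one by `P = diag (1_n, i 1_n')`, so that `A ↦ P⁻¹ A P` maps `O(n, n')` to
`O(n + n', ℂ)`. -/
def pseudoToComplex (n n' : ℕ) :
    pseudoOrthogonal n n' →* complexOrthogonal (Fin n ⊕ Fin n') :=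
  (((MulAut.conj (unitDiag n n')⁻¹).toMonoidHom.comp
    (Matrix.GeneralLinearGroup.map (algebraMap ℝ ℂ))).comp
      (pseudoOrthogonal n n').subtype).codRestrict _ (by
    rintro ⟨A, hA⟩
    have hA' : (A : Matrix (Fin n ⊕ Fin n') (Fin n ⊕ Fin n') ℝ)ᵀ *
      LieAlgebra.Orthogonal.indefiniteDiagonal (Fin n) (Fin n') ℝ * A.val =
      LieAlgebra.Orthogonal.indefiniteDiagonal (Fin n) (Fin n') ℝ := hA
    set A' : Matrix (Fin n ⊕ Fin n') (Fin n ⊕ Fin n') ℂ := A.val.map (algebraMap ℝ ℂ) with hA'_def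
    set P := LieAlgebra.Orthogonal.Pso (Fin n) (Fin n') ℂ Complex.I with hP
    set Q := LieAlgebra.Orthogonal.Pso (Fin n) (Fin n') ℂ (-Complex.I) with hQ
    set η := LieAlgebra.Orthogonal.indefiniteDiagonal (Fin n) (Fin n') ℂ with hη
    have h1 : A'ᵀ * η * A' = η := by
      have h := congrArg (fun X => X.map (algebraMap ℝ ℂ)) hA'
      have he : (LieAlgebra.Orthogonal.indefiniteDiagonal (Fin n) (Fin n') ℝ).map
          (algebraMap ℝ ℂ) = η := by
        ext i j
        rcases i with i | i <;> rcases j with j | j <;>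
          simp [hη, LieAlgebra.Orthogonal.indefiniteDiagonal, Matrix.diagonal_apply, apply_ite]
      simp only [Matrix.map_mul, he, Matrix.transpose_map] at h
      exact h
    have hQη : Qᵀ * Q = η := by
      ext i j
      rcases i with i | i <;> rcases j with j | j <;>
        simp [hQ, hη, LieAlgebra.Orthogonal.Pso, LieAlgebra.Orthogonal.indefiniteDiagonal,
          Matrix.diagonal_apply, neg_ite]
    have hPη : Pᵀ * η * P = 1 :=
      LieAlgebra.Orthogonal.indefiniteDiagonal_transform _ _ _ Complex.I_mul_I
    change (Q * A' * P)ᵀ * 1 * (Q * A' * P) = 1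
    calc (Q * A' * P)ᵀ * 1 * (Q * A' * P) = Pᵀ * (A'ᵀ * (Qᵀ * Q) * A') * P := by
          simp only [Matrix.transpose_mul, mul_assoc, one_mul]
      _ = 1 := by rw [hQη, h1, hPη])

/-- The diagonal `O(p, q)` inside `O(p, q) × O(p, q)`. -/
def diagonalHom (p q : ℕ) :
    pseudoOrthogonal p q →* pseudoOrthogonal p q × pseudoOrthogonal p q :=
  (MonoidHom.id _).prod (MonoidHom.id _)

/-- The skew-Hermitian form `(v, w) ↦ v* j w` on `ℍ^r`. -/
def skewForm (r : ℕ) : Matrix (Fin r) (Fin r) ℍ[ℝ] :=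
  Matrix.diagonal (fun _ => (⟨0, 0, 1, 0⟩ : ℍ[ℝ]))

/-- The group `SO*(2r)` of automorphisms of a nondegenerate skew-Hermitian form on the right
quaternionic vector space `ℍ^r`. -/
def soStar (r : ℕ) : Subgroup (Matrix (Fin r) (Fin r) ℍ[ℝ])ˣ where
  carrier := {A | (A : Matrix (Fin r) (Fin r) ℍ[ℝ])ᴴ * skewForm r * A = skewForm r}
  one_mem' := by simp
  mul_mem' {A C} hA hC := by
    simp only [Set.mem_ofPred_eq, Units.val_mul, Matrix.conjTranspose_mul] at *
    calc _ = (C : Matrix (Fin r) (Fin r) ℍ[ℝ])ᴴ * ((A : Matrix (Fin r) (Fin r) ℍ[ℝ])ᴴ *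
          skewForm r * (A : Matrix (Fin r) (Fin r) ℍ[ℝ])) * C := by simp only [mul_assoc]
      _ = skewForm r := by rw [hA, hC]
  inv_mem' {A} hA := by
    simp only [Set.mem_ofPred_eq] at *
    have h1 : (A : Matrix (Fin r) (Fin r) ℍ[ℝ]) * (A⁻¹).val = 1 := by
      rw [← Units.val_mul]; simp
    have h2 : ((A⁻¹).val)ᴴ * (A : Matrix (Fin r) (Fin r) ℍ[ℝ])ᴴ = 1 := by
      rw [← Matrix.conjTranspose_mul, h1, Matrix.conjTranspose_one]
    calc _ = ((A⁻¹).val)ᴴ * ((A : Matrix (Fin r) (Fin r) ℍ[ℝ])ᴴ * skewForm r * A.val) *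
          (A⁻¹).val := by rw [hA]
      _ = (((A⁻¹).val)ᴴ * (A : Matrix (Fin r) (Fin r) ℍ[ℝ])ᴴ) * skewForm r *
          (A.val * (A⁻¹).val) := by simp only [mul_assoc]
      _ = skewForm r := by rw [h1, h2]; simp

/-- The complex matrix of a quaternionic matrix `A = A₁ + j A₂` acting on `ℍ^r = ℂ^r ⊕ j ℂ^r`,
namely `(A₁, -conj A₂; A₂, conj A₁)`. -/
def quatToComplex {r : ℕ} (A : Matrix (Fin r) (Fin r) ℍ[ℝ]) :
    Matrix (Fin r ⊕ Fin r) (Fin r ⊕ Fin r) ℂ :=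
  Matrix.fromBlocks
    (A.map fun a => (⟨a.re, a.imI⟩ : ℂ)) (A.map fun a => (⟨-a.imJ, -a.imK⟩ : ℂ))
    (A.map fun a => (⟨a.imJ, -a.imK⟩ : ℂ)) (A.map fun a => (⟨a.re, -a.imI⟩ : ℂ))

theorem quatToComplex_one {r : ℕ} :
    quatToComplex (1 : Matrix (Fin r) (Fin r) ℍ[ℝ]) = 1 := by
  ext i j
  rcases i with i | i <;> rcases j with j | j <;> by_cases h : i = j <;>
    simp [quatToComplex, Matrix.one_apply, h, Complex.ext_iff]

theorem quatToComplex_mul {r : ℕ} (A B : Matrix (Fin r) (Fin r) ℍ[ℝ]) :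
    quatToComplex (A * B) = quatToComplex A * quatToComplex B := by
  have hre : ∀ f : Fin r → ℍ[ℝ], (∑ k, f k).re = ∑ k, (f k).re := fun f =>
    map_sum (QuaternionAlgebra.reₗ (-1 : ℝ) 0 (-1)) f _
  have hi : ∀ f : Fin r → ℍ[ℝ], (∑ k, f k).imI = ∑ k, (f k).imI := fun f =>
    map_sum (QuaternionAlgebra.imIₗ (-1 : ℝ) 0 (-1)) f _
  have hj : ∀ f : Fin r → ℍ[ℝ], (∑ k, f k).imJ = ∑ k, (f k).imJ := fun f =>
    map_sum (QuaternionAlgebra.imJₗ (-1 : ℝ) 0 (-1)) f _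
  have hk : ∀ f : Fin r → ℍ[ℝ], (∑ k, f k).imK = ∑ k, (f k).imK := fun f =>
    map_sum (QuaternionAlgebra.imKₗ (-1 : ℝ) 0 (-1)) f _
  ext i j
  rcases i with i | i <;> rcases j with j | j <;> apply Complex.ext <;>
    simp only [quatToComplex, Matrix.fromBlocks_apply₁₁, Matrix.fromBlocks_apply₁₂,
      Matrix.fromBlocks_apply₂₁, Matrix.fromBlocks_apply₂₂, Matrix.map_apply, Matrix.mul_apply,
      Fintype.sum_sum_type, hre, hi, hj, hk, Complex.add_re, Complex.add_im, Complex.re_sum,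
      Complex.im_sum, Complex.mul_re, Complex.mul_im, Quaternion.re_mul, Quaternion.imI_mul,
      Quaternion.imJ_mul, Quaternion.imK_mul, ← Finset.sum_add_distrib, ← Finset.sum_neg_distrib] <;>
    refine Finset.sum_congr rfl fun k _ => ?_ <;> ring

theorem quatToComplex_transpose_mul {r : ℕ} (A : Matrix (Fin r) (Fin r) ℍ[ℝ])
    (hA : Aᴴ * skewForm r * A = skewForm r) : (quatToComplex A)ᵀ * quatToComplex A = 1 := by
  have h := congrArg quatToComplex hA
  have hS : quatToComplex (skewForm r) = Matrix.fromBlocks 0 (-1) 1 0 := by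
    have hs : ∀ i j : Fin r, skewForm r i j = if i = j then (⟨0, 0, 1, 0⟩ : ℍ[ℝ]) else 0 :=
      fun i j => Matrix.diagonal_apply ..
    ext i j
    rcases i with i | i <;> rcases j with j | j <;> by_cases hij : i = j <;>
      simp [quatToComplex, hs, hij, Complex.ext_iff]
  have hT : quatToComplex Aᴴ * Matrix.fromBlocks 0 (-1) 1 0 =
      Matrix.fromBlocks 0 (-1) 1 0 * (quatToComplex A)ᵀ := by
    simp only [quatToComplex, Matrix.fromBlocks_transpose, Matrix.fromBlocks_multiply,
      Matrix.fromBlocks_inj, Matrix.mul_zero, Matrix.zero_mul, Matrix.mul_one, Matrix.one_mul,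
      Matrix.mul_neg, Matrix.neg_mul, zero_add, add_zero]
    refine ⟨?_, ?_, ?_, ?_⟩ <;> ext i j <;> simp [Complex.ext_iff]
  have hJ : (Matrix.fromBlocks 0 1 (-1) 0 : Matrix (Fin r ⊕ Fin r) (Fin r ⊕ Fin r) ℂ) *
      Matrix.fromBlocks 0 (-1) 1 0 = 1 := by
    simp [Matrix.fromBlocks_multiply]
  rw [quatToComplex_mul, quatToComplex_mul, hS, hT, mul_assoc] at h
  have h3 := congrArg (fun X => Matrix.fromBlocks 0 1 (-1) 0 * X) h
  simpa only [← mul_assoc, hJ, one_mul] using h3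

/-- `SO*(2r)` inside `O(2r, ℂ)`: with `ℍ^r = ℂ^r ⊕ j ℂ^r`, the `j`-component of the form
`v* j w` is the standard complex symmetric form on `ℂ^(2r)`. -/
def soStarToComplex (r : ℕ) : soStar r →* complexOrthogonal (Fin r ⊕ Fin r) :=
  ((Units.map (⟨⟨quatToComplex, quatToComplex_one⟩, quatToComplex_mul⟩ :
    Matrix (Fin r) (Fin r) ℍ[ℝ] →* Matrix (Fin r ⊕ Fin r) (Fin r ⊕ Fin r) ℂ)).comp
      (soStar r).subtype).codRestrict _ (by
    rintro ⟨A, hA⟩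
    change (quatToComplex A.val)ᵀ * 1 * quatToComplex A.val = 1
    rw [mul_one]
    exact quatToComplex_transpose_mul A.val hA)

end Groups

end

/-! The Courant bracket plays no part in the geometry: an integrable structure is a smooth field of
endomorphisms with values in the twistor set that is also involutive. What needs proof is that the
twistor set is an embedded smooth bundle with homogeneous fibre. This splits into linear algebra in
one fibre, a smooth model of `G/H` as an orbit of matrices, and local triviality.

Linear algebra, for a fixed nondegenerate symmetric form `f` on `ℝ^m`. If `lam * ell = -1`, then `S`
anticommutes with `I_1`, whose `±1`-eigenspaces are the graphs of `±f`. Hence `S` interchanges them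
and amounts to an endomorphism `A` with `f`-adjoint `B` and `A B = B A = lam`. For `lam = 1` this is
an isometry of `f`. For `lam = -1` it is an anti-isometry, which forces `p = q`, and composing with
a fixed anti-isometry gives an isometry again. So the fibre is `O(p,q)`, the quotient of `O(p,q) ×
O(p,q)` by the diagonal (`IsModelTwistor.exists_eigenSwap`, `exists_splitCoordinates`). If `lam *
ell = 1`, then `I_{-1}` is a complex structure, `b` is minus the imaginary part of a complex
symmetric form, and `S` is antilinear: `S z = M z̄` with `M` Hermitian and `Mᵀ M = lam`
(`exists_complexCoordinates`). The group `O(m,ℂ)` acts by `M ↦ A M Aᴴ`. For `lam = 1` the fixed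
vectors of `S` form a real form on which the symmetric form is real; an orthonormal basis of it
shows that its signature `(n, m - n)` determines the orbit, and this `n` is `sig S`
(`hermitianTwistors.exists_real_frame`, `hasSignature_of_complex_frame`). For `lam = -1`, `S` is a
quaternionic structure; the spectral theorem for `M` gives that `m` is even and that there is one
orbit, that of `i J` (`hermitianTwistors.exists_quaternionic_frame`). The stabilizers are `O(n, m -
n)` and `SO*(m)`.

Orbits. All these quotients are symmetric spaces: `G` is the set of `a` in a matrix algebra with
`θ(a) a = 1`, acting by `w ↦ a w σ(a)`, with `θ` and `σ` commuting anti-involutions. Near `1` the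
Cayley transform carries the orbit of `1` into a linear space, and a square root inside `G` gives a
smooth local section of the orbit map (`nonempty_orbitData_symmetricSpace`). Translation gives the
atlas.

Local triviality. Near a point the metric in coordinates is `f = f₀(h·, h·)`, where `h` is the
square root near `1` of the `f₀`-self-adjoint map `f₀⁻¹ f`. Conjugation by `h` makes the twistor
condition constant (`IsNaturalFamily.exists_localProduct`). All charts are restrictions of smooth
maps of the ambient manifold, so smoothness of maps into the subset can be tested in the ambient
space (`EmbeddedAtlas`). -/

noncomputable section

/-! ### Atlases on subsets and quotients induced by an embedding into a manifold -/

/-- Charts on `Z` which make the map `j : Z → N` into a manifold a smooth embedding: the inverse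
charts are smooth as maps to `N`, and the charts are restrictions of smooth maps defined on `N`. -/
structure EmbeddedAtlas {E H E' H' Z N : Type*} [NormedAddCommGroup E] [NormedSpace ℝ E]
    [TopologicalSpace H] (I : ModelWithCorners ℝ E H) [NormedAddCommGroup E'] [NormedSpace ℝ E']
    [TopologicalSpace H'] (J : ModelWithCorners ℝ E' H') [TopologicalSpace Z] [TopologicalSpace N]
    [ChartedSpace H' N] (j : Z → N) where
  isInducing : Topology.IsInducing j
  chart : Z → OpenPartialHomeomorph Z H
  mem_source : ∀ z, z ∈ (chart z).source
  ext : Z → N → H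
  ext_eq : ∀ z, ∀ z' ∈ (chart z).source, ext z (j z') = chart z z'
  contMDiffAt_ext : ∀ z, ∀ z' ∈ (chart z).source, ContMDiffAt J I ∞ (ext z) (j z')
  contMDiffOn_symm : ∀ z, ContMDiffOn I J ∞ (j ∘ (chart z).symm) (chart z).target

namespace EmbeddedAtlas

variable {E H E' H' Z N : Type*} [NormedAddCommGroup E] [NormedSpace ℝ E]
  [TopologicalSpace H] {I : ModelWithCorners ℝ E H} [NormedAddCommGroup E'] [NormedSpace ℝ E']
  [TopologicalSpace H'] {J : ModelWithCorners ℝ E' H'} [TopologicalSpace Z] [TopologicalSpace N]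
  [ChartedSpace H' N] {j : Z → N} (A : EmbeddedAtlas I J j)

/-- The charted space structure given by the charts of an embedded atlas. -/
@[reducible] def chartedSpace : ChartedSpace H Z where
  atlas := Set.range A.chart
  chartAt := A.chart
  mem_chart_source := A.mem_source
  chart_mem_atlas z := ⟨z, rfl⟩

/-- A change of charts factors through `N`: it is an inverse chart followed by `j`, which is smooth,
and then by the smooth ambient extension of the second chart. -/
theorem isManifold : letI := A.chartedSpace; IsManifold I ∞ Z := by
  let _ := A.chartedSpace
  refine isManifold_of_contDiffOn I ∞ Z ?_
  rintro _ _ ⟨z, rfl⟩ ⟨z', rfl⟩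
  have h : ContMDiffOn I I ∞ ((A.chart z).symm ≫ₕ A.chart z')
      ((A.chart z).symm ≫ₕ A.chart z').source := by
    intro a ha
    have ha1 : a ∈ (A.chart z).target := by
      simpa using ((OpenPartialHomeomorph.trans_source _ _).subset ha).1
    have ha2 : (A.chart z).symm a ∈ (A.chart z').source :=
      ((OpenPartialHomeomorph.trans_source _ _).subset ha).2
    have h1 := (A.contMDiffAt_ext z' _ ha2).comp_contMDiffWithinAt a
      (((A.contMDiffOn_symm z) a ha1).mono (t := (A.chart z).target ∩
        (A.chart z).symm ⁻¹' (A.chart z').source) Set.inter_subset_left)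
    have hset : ((A.chart z).symm ≫ₕ A.chart z').source = (A.chart z).target ∩
        (A.chart z).symm ⁻¹' (A.chart z').source := by
      simp
    rw [hset]
    refine h1.congr (fun b hb => ?_) ?_
    · exact (A.ext_eq z' _ hb.2).symm
    · exact (A.ext_eq z' _ ha2).symm
  have h2 := (contMDiffOn_iff.1 h).2
  intro y hy
  have h3 := h2 (I.symm y) (I.symm y)
  simp only [mfld_simps, chartAt_self_eq] at h3
  refine (h3 y ?_).mono ?_
  · refine ⟨hy.2, hy.1.1, hy.1.2⟩
  · rintro w ⟨hw1, hw2⟩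
    exact ⟨hw2, hw1.1, hw1.2⟩

/-- A map into `Z` is smooth as soon as its composition with the embedding is smooth. -/
theorem contMDiffWithinAt_of_comp {E₁ H₁ X : Type*} [NormedAddCommGroup E₁] [NormedSpace ℝ E₁]
    [TopologicalSpace H₁] {I₁ : ModelWithCorners ℝ E₁ H₁} [TopologicalSpace X]
    [ChartedSpace H₁ X] {f : X → Z} {s : Set X} {x : X}
    (hf : ContMDiffWithinAt I₁ J ∞ (j ∘ f) s x) :
    letI := A.chartedSpace
    ContMDiffWithinAt I₁ I ∞ f s x := by
  let _ := A.chartedSpace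
  have := A.isManifold
  have hc : ContinuousWithinAt f s x :=
    A.isInducing.continuousWithinAt_iff.2 hf.continuousWithinAt
  have h1 := (A.contMDiffAt_ext (f x) _ (A.mem_source _)).comp_contMDiffWithinAt x hf
  have h2 : ContMDiffAt I I ∞ (A.chart (f x)).symm ((A.ext (f x) ∘ (j ∘ f)) x) := by
    have h := contMDiffOn_chart_symm (I := I) (n := ∞) (x := f x)
    have he : (A.ext (f x) ∘ (j ∘ f)) x = A.chart (f x) (f x) :=
      A.ext_eq _ _ (A.mem_source _)
    rw [he]
    exact h.contMDiffAt ((A.chart (f x)).open_target.mem_nhds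
      ((A.chart (f x)).map_source (A.mem_source _)))
  -- Locally `f` is recovered from `j ∘ f` by the ambient extension of the chart followed by the
  -- inverse chart, both smooth.
  have hev : ∀ y, f y ∈ (A.chart (f x)).source →
      f y = ((A.chart (f x)).symm ∘ (A.ext (f x) ∘ (j ∘ f))) y := by
    intro y hy
    have : (A.ext (f x) ∘ (j ∘ f)) y = A.chart (f x) (f y) := A.ext_eq _ _ hy
    rw [Function.comp_apply, this, (A.chart (f x)).left_inv hy]
  refine (h2.comp_contMDiffWithinAt x h1).congr_of_eventuallyEq ?_ (hev x (A.mem_source _))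
  filter_upwards [hc ((A.chart (f x)).open_source.mem_nhds (A.mem_source _))] with y hy
  exact hev y hy

theorem contMDiff_embedding : letI := A.chartedSpace; ContMDiff I J ∞ j := by
  let _ := A.chartedSpace
  have := A.isManifold
  intro z
  have h1 : ContMDiffAt I I ∞ (A.chart z) z :=
    (contMDiffOn_chart (I := I) (n := ∞) (x := z)).contMDiffAt
      ((A.chart z).open_source.mem_nhds (A.mem_source z))
  have h2 := ((A.contMDiffOn_symm z).contMDiffAt ((A.chart z).open_target.mem_nhds
      ((A.chart z).map_source (A.mem_source z)))).comp z h1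
  refine h2.congr_of_eventuallyEq ?_
  filter_upwards [(A.chart z).open_source.mem_nhds (A.mem_source z)] with y hy
  simp [(A.chart z).left_inv hy]

/-- The ambient extension of a chart followed by the inverse chart is a differentiable local left
inverse of `j`, so the chain rule gives a left inverse of the differential. -/
theorem mfderiv_injective (z : Z) :
    letI := A.chartedSpace; Function.Injective (mfderiv I J j z) := by
  let _ := A.chartedSpace
  have := A.isManifold
  have hone : (∞ : WithTop ℕ∞) ≠ 0 := by simp
  have hj : MDifferentiableAt I J j z := (A.contMDiff_embedding z).mdifferentiableAt hone
  have he : MDifferentiableAt J I (A.ext z) (j z) :=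
    (A.contMDiffAt_ext z z (A.mem_source z)).mdifferentiableAt hone
  have hs : MDifferentiableAt I I (A.chart z).symm (A.ext z (j z)) := by
    have h := contMDiffOn_chart_symm (I := I) (n := ∞) (x := z)
    rw [A.ext_eq _ _ (A.mem_source _)]
    exact (h.contMDiffAt ((A.chart z).open_target.mem_nhds
      ((A.chart z).map_source (A.mem_source _)))).mdifferentiableAt hone
  have hid : ((A.chart z).symm ∘ A.ext z) ∘ j =ᶠ[𝓝 z] id := by
    filter_upwards [(A.chart z).open_source.mem_nhds (A.mem_source z)] with y hy
    simp [A.ext_eq _ _ hy, (A.chart z).left_inv hy]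
  have h1 := mfderiv_comp z (hs.comp _ he) hj
  rw [hid.mfderiv_eq, mfderiv_id] at h1
  refine Function.LeftInverse.injective (g := mfderiv J I ((A.chart z).symm ∘ A.ext z) (j z)) ?_
  intro v
  exact (DFunLike.congr_fun h1 v).symm

end EmbeddedAtlas

end

noncomputable section

/-! ### Homogeneous spaces as embedded orbits -/

/-- A closed linear group `Γ`, embedded by `emb` in the vector space `V`, acts on the vector space
`W`; `orb` is the orbit map of a point with stabilizer `H`. The map `param` is a local section of
the orbit map in the coordinates given by `coord`. -/
structure OrbitData {Γ V W : Type*} [Group Γ] [TopologicalSpace Γ]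
    [NormedAddCommGroup V] [NormedSpace ℝ V] [NormedAddCommGroup W] [NormedSpace ℝ W]
    (emb : Γ → V) (H : Subgroup Γ) (orb : Γ → W) (D : Type*) [NormedAddCommGroup D]
    [NormedSpace ℝ D] where
  isInducing_emb : Topology.IsInducing emb
  translate : Γ → V → V
  contDiff_translate : ∀ a, ContDiff ℝ ∞ (translate a)
  translate_emb : ∀ a b, translate a (emb b) = emb (a * b)
  orbExt : V → W
  contDiff_orbExt : ContDiff ℝ ∞ orbExt
  orbExt_emb : ∀ a, orbExt (emb a) = orb a
  act : Γ → W → W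
  contDiff_act : ∀ a, ContDiff ℝ ∞ (act a)
  act_orb : ∀ a b, act a (orb b) = orb (a * b)
  orb_eq_iff : ∀ a b, orb a = orb b ↔ a⁻¹ * b ∈ H
  param : D → Γ
  coord : W → D
  coord_orb_one : coord (orb 1) = 0
  orb_param_zero : orb (param 0) = orb 1
  contDiffAt_param : ∀ᶠ v in 𝓝 0, ContDiffAt ℝ ∞ (fun v => emb (param v)) v
  coord_orb_param : ∀ᶠ v in 𝓝 0, coord (orb (param v)) = v
  contDiffAt_coord : ∀ᶠ w in 𝓝 (orb 1), ContDiffAt ℝ ∞ coord w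
  orb_param_coord : ∀ᶠ w in 𝓝 (orb 1), w ∈ Set.range orb → orb (param (coord w)) = w

namespace OrbitData

variable {Γ V W D : Type*} [Group Γ] [TopologicalSpace Γ]
  [NormedAddCommGroup V] [NormedSpace ℝ V] [NormedAddCommGroup W] [NormedSpace ℝ W]
  {emb : Γ → V} {H : Subgroup Γ} {orb : Γ → W} [NormedAddCommGroup D] [NormedSpace ℝ D]

section

variable (A : OrbitData emb H orb D)

/-- Change of the coordinate space by a linear isomorphism. -/
def congr {D' : Type*} [NormedAddCommGroup D'] [NormedSpace ℝ D'] (e : D ≃L[ℝ] D') :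
    OrbitData emb H orb D' where
  __ := A
  param := A.param ∘ e.symm
  coord := e ∘ A.coord
  coord_orb_one := by simp [A.coord_orb_one]
  orb_param_zero := by simp [A.orb_param_zero]
  contDiffAt_param := by
    have h : Filter.Tendsto e.symm (𝓝 0) (𝓝 0) := by simpa using e.symm.continuous.tendsto 0
    filter_upwards [h.eventually A.contDiffAt_param] with v hv
    exact hv.comp v e.symm.contDiff.contDiffAt
  coord_orb_param := by
    have h : Filter.Tendsto e.symm (𝓝 0) (𝓝 0) := by simpa using e.symm.continuous.tendsto 0
    filter_upwards [h.eventually A.coord_orb_param] with v hv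
    simp [hv]
  contDiffAt_coord := by
    filter_upwards [A.contDiffAt_coord] with v hv
    exact e.contDiff.contDiffAt.comp v hv
  orb_param_coord := by
    filter_upwards [A.orb_param_coord] with v hv h
    simpa using hv h

theorem continuous_orb (A : OrbitData emb H orb D) : Continuous orb := by
  have : orb = A.orbExt ∘ emb := funext fun a => (A.orbExt_emb a).symm
  rw [this]
  exact A.contDiff_orbExt.continuous.comp A.isInducing_emb.continuous

/-- The embedding of the homogeneous space `Γ ⧸ H` induced by the orbit map. -/
def quot (y : Γ ⧸ H) : W :=
  Quotient.liftOn' y orb fun a b h => (A.orb_eq_iff a b).2 (QuotientGroup.leftRel_apply.1 h)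

@[simp] theorem quot_mk (a : Γ) : A.quot (a : Γ ⧸ H) = orb a := rfl

theorem continuous_quot : Continuous A.quot :=
  A.continuous_orb.quotient_lift _

theorem quot_injective : Function.Injective A.quot := by
  intro x y
  induction x using QuotientGroup.induction_on with | H a => ?_
  induction y using QuotientGroup.induction_on with | H b => ?_
  intro h
  exact QuotientGroup.eq.2 ((A.orb_eq_iff a b).1 h)

theorem quot_mem_range (y : Γ ⧸ H) : A.quot y ∈ Set.range orb := by
  induction y using QuotientGroup.induction_on with | H a => exact ⟨a, rfl⟩

theorem quot_smul (a : Γ) (y : Γ ⧸ H) : A.quot (a • y) = A.act a (A.quot y) := by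
  induction y using QuotientGroup.induction_on with | H b => exact (A.act_orb a b).symm

/-- Neighbourhoods on which `param` and `coord` are inverse to each other. -/
theorem exists_nhds : ∃ (P : Set D) (N : Set W), IsOpen P ∧ IsOpen N ∧ 0 ∈ P ∧ orb 1 ∈ N ∧
    (∀ v ∈ P, ContDiffAt ℝ ∞ (fun v => emb (A.param v)) v ∧ A.coord (orb (A.param v)) = v) ∧
    (∀ w ∈ N, ContDiffAt ℝ ∞ A.coord w ∧ (w ∈ Set.range orb → orb (A.param (A.coord w)) = w)) := by
  obtain ⟨P, hP, hPo, hP0⟩ :=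
    eventually_nhds_iff.1 (A.contDiffAt_param.and A.coord_orb_param)
  obtain ⟨N, hN, hNo, hN0⟩ :=
    eventually_nhds_iff.1 (A.contDiffAt_coord.and A.orb_param_coord)
  exact ⟨P, N, hPo, hNo, hP0, hN0, hP, hN⟩

/-- The source is the preimage of an open subset of `W`, which is more than openness in the quotient
topology. This is what later shows that the quotient topology is induced from `W`. -/
theorem exists_baseChart : ∃ e : OpenPartialHomeomorph (Γ ⧸ H) D,
    ((1 : Γ) : Γ ⧸ H) ∈ e.source ∧
    (∀ y, e y = A.coord (A.quot y)) ∧ (∀ v, e.symm v = (A.param v : Γ ⧸ H)) ∧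
    (∃ O : Set W, IsOpen O ∧ e.source = A.quot ⁻¹' O) ∧
    (∀ v ∈ e.target, ContDiffAt ℝ ∞ (fun v => emb (A.param v)) v) ∧
    (∀ y ∈ e.source, ContDiffAt ℝ ∞ A.coord (A.quot y)) := by
  obtain ⟨P, N, hPo, hNo, hP0, hN0, hP, hN⟩ := A.exists_nhds
  have hr : ContinuousOn A.coord N := fun w hw => (hN w hw).1.continuousAt.continuousWithinAt
  have hp : ContinuousOn A.param P := by
    rw [A.isInducing_emb.continuousOn_iff]
    exact fun v hv => (hP v hv).1.continuousAt.continuousWithinAt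
  have hO : IsOpen (N ∩ A.coord ⁻¹' P) := hr.isOpen_inter_preimage hNo hPo
  refine ⟨{ toFun := fun y => A.coord (A.quot y)
            invFun := fun v => (A.param v : Γ ⧸ H)
            source := A.quot ⁻¹' (N ∩ A.coord ⁻¹' P)
            target := P ∩ (fun v => orb (A.param v)) ⁻¹' N
            map_source' := ?_
            map_target' := ?_
            left_inv' := ?_
            right_inv' := ?_
            open_source := hO.preimage A.continuous_quot
            open_target := (A.continuous_orb.comp_continuousOn hp).isOpen_inter_preimage hPo hNo
            continuousOn_toFun := ?_
            continuousOn_invFun := ?_ }, ?_, fun _ => rfl, fun _ => rfl, ⟨_, hO, rfl⟩, ?_, ?_⟩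
  · intro y hy
    refine ⟨hy.2, ?_⟩
    change orb (A.param (A.coord (A.quot y))) ∈ N
    rw [(hN _ hy.1).2 (A.quot_mem_range y)]
    exact hy.1
  · intro v hv
    refine ⟨hv.2, ?_⟩
    change A.coord (orb (A.param v)) ∈ P
    rw [(hP v hv.1).2]
    exact hv.1
  · intro y hy
    exact A.quot_injective ((hN _ hy.1).2 (A.quot_mem_range y))
  · intro v hv
    exact (hP v hv.1).2
  · exact hr.comp A.continuous_quot.continuousOn fun y hy => hy.1
  · exact QuotientGroup.continuous_mk.comp_continuousOn (hp.mono Set.inter_subset_left)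
  · exact ⟨hN0, by change A.coord (orb 1) ∈ P; rw [A.coord_orb_one]; exact hP0⟩
  · exact fun v hv => (hP v hv.1).1
  · exact fun y hy => (hN _ hy.1).1

/-- The chart of `Γ ⧸ H` around the base point. -/
def baseChart : OpenPartialHomeomorph (Γ ⧸ H) D := A.exists_baseChart.choose

theorem baseChart_spec :
    ((1 : Γ) : Γ ⧸ H) ∈ A.baseChart.source ∧
    (∀ y, A.baseChart y = A.coord (A.quot y)) ∧
    (∀ v, A.baseChart.symm v = (A.param v : Γ ⧸ H)) ∧
    (∃ O : Set W, IsOpen O ∧ A.baseChart.source = A.quot ⁻¹' O) ∧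
    (∀ v ∈ A.baseChart.target, ContDiffAt ℝ ∞ (fun v => emb (A.param v)) v) ∧
    (∀ y ∈ A.baseChart.source, ContDiffAt ℝ ∞ A.coord (A.quot y)) :=
  A.exists_baseChart.choose_spec

theorem contDiffAt_quot_baseChart_symm {v : D} (hv : v ∈ A.baseChart.target) :
    ContDiffAt ℝ ∞ (A.quot ∘ A.baseChart.symm) v := by
  obtain ⟨-, -, h3, -, h5, -⟩ := A.baseChart_spec
  have : A.quot ∘ A.baseChart.symm = fun v => A.orbExt (emb (A.param v)) := by
    funext v
    rw [A.orbExt_emb, Function.comp_apply, h3, quot_mk]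
  rw [this]
  exact A.contDiff_orbExt.contDiffAt.comp v (h5 v hv)

variable [IsTopologicalGroup Γ]

/-- Near the base point a coset is a continuous function of its image in `W`, through the base
chart. Equivariance of the embedding spreads this over the whole quotient. -/
theorem isInducing_quot : Topology.IsInducing A.quot := by
  obtain ⟨h1, h2, h3, ⟨O, hO, hsO⟩, h5, h6⟩ := A.baseChart_spec
  rw [Topology.isInducing_iff_nhds]
  -- On the base chart the identity equals `baseChart.symm ∘ coord ∘ quot`, and the last two factors
  -- depend only on the image in `W`.
  have key : ∀ y ∈ A.baseChart.source, Filter.comap A.quot (𝓝 (A.quot y)) ≤ 𝓝 y := by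
    intro y hy
    have hc : ContinuousAt A.coord (A.quot y) := (h6 y hy).continuousAt
    have ht : Filter.Tendsto (fun z => A.baseChart.symm (A.coord (A.quot z)))
        (Filter.comap A.quot (𝓝 (A.quot y))) (𝓝 y) := by
      have hs := A.baseChart.continuousAt_symm (A.baseChart.map_source hy)
      rw [ContinuousAt, A.baseChart.left_inv hy, show A.baseChart y = A.coord (A.quot y) from
        h2 y] at hs
      exact hs.comp (hc.tendsto.comp Filter.tendsto_comap)
    have hev : (fun z => A.baseChart.symm (A.coord (A.quot z)))
        =ᶠ[Filter.comap A.quot (𝓝 (A.quot y))] id := by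
      have hm : A.quot ⁻¹' O ∈ Filter.comap A.quot (𝓝 (A.quot y)) :=
        Filter.preimage_mem_comap (hO.mem_nhds (hsO.subset hy))
      filter_upwards [hm] with z hz
      rw [← show A.baseChart z = A.coord (A.quot z) from h2 z]
      exact A.baseChart.left_inv (hsO.symm.subset hz)
    exact (ht.congr' hev)
  intro y
  refine le_antisymm (Filter.map_le_iff_le_comap.1 A.continuous_quot.continuousAt) ?_
  -- Translation by `a⁻¹` moves `y` to the base point; on `W` it is the continuous map `act a⁻¹`.
  obtain ⟨a, ha⟩ : ∃ a : Γ, a • ((1 : Γ) : Γ ⧸ H) = y := by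
    induction y using QuotientGroup.induction_on with
    | H a => exact ⟨a, by rw [MulAction.Quotient.smul_coe, smul_eq_mul, mul_one]⟩
  have hy : a⁻¹ • y = ((1 : Γ) : Γ ⧸ H) := by rw [← ha, inv_smul_smul]
  have h7 := key (a⁻¹ • y) (by rw [hy]; exact h1)
  have h8 : Filter.Tendsto (fun z => a⁻¹ • z) (Filter.comap A.quot (𝓝 (A.quot y)))
      (𝓝 (a⁻¹ • y)) := by
    refine Filter.Tendsto.mono_right ?_ h7
    rw [Filter.tendsto_comap_iff]
    have : A.quot ∘ (fun z => a⁻¹ • z) = A.act a⁻¹ ∘ A.quot := funext fun z => A.quot_smul _ _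
    rw [this, A.quot_smul]
    exact (A.contDiff_act a⁻¹).continuous.continuousAt.tendsto.comp Filter.tendsto_comap
  have h9 := ((continuous_const_smul a).tendsto (a⁻¹ • y)).comp h8
  simpa [Function.comp_def, Filter.Tendsto] using h9

/-- The charts of `Γ ⧸ H` obtained by translation of the chart around the base point. -/
def atlas : EmbeddedAtlas 𝓘(ℝ, D) 𝓘(ℝ, W) A.quot where
  isInducing := A.isInducing_quot
  chart y := (Homeomorph.smul (Quotient.out y)⁻¹).toOpenPartialHomeomorph.trans A.baseChart
  mem_source y := by
    obtain ⟨h1, -⟩ := A.baseChart_spec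
    have h : (Quotient.out y)⁻¹ • y = ((1 : Γ) : Γ ⧸ H) := by
      conv_lhs => rw [← QuotientGroup.out_eq' y]
      rw [MulAction.Quotient.smul_coe, smul_eq_mul, QuotientGroup.out_eq' y, inv_mul_cancel]
    simpa [h] using h1
  ext y w := A.coord (A.act (Quotient.out y)⁻¹ w)
  ext_eq y z _ := by
    obtain ⟨-, h2, -⟩ := A.baseChart_spec
    rw [← A.quot_smul]
    exact (h2 _).symm
  contMDiffAt_ext y z hz := by
    obtain ⟨-, -, -, -, -, h6⟩ := A.baseChart_spec
    rw [contMDiffAt_iff_contDiffAt]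
    refine ContDiffAt.comp (g := A.coord) _ ?_ (A.contDiff_act _).contDiffAt
    rw [← A.quot_smul]
    exact h6 _ (by simpa using hz)
  contMDiffOn_symm y := by
    rw [contMDiffOn_iff_contDiffOn]
    intro v hv
    have hv' : v ∈ A.baseChart.target := by simpa using hv
    refine ContDiffAt.contDiffWithinAt ?_
    have h : (A.quot ∘ ((Homeomorph.smul (Quotient.out y)⁻¹).toOpenPartialHomeomorph.trans
        A.baseChart).symm) = A.act (Quotient.out y) ∘ (A.quot ∘ A.baseChart.symm) := by
      funext v
      simp [A.quot_smul]
    rw [h]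
    exact (A.contDiff_act _).contDiffAt.comp v (A.contDiffAt_quot_baseChart_symm hv')

end

variable [IsTopologicalGroup Γ]

/-- The projection becomes `orbExt` after embedding the quotient in `W`, hence is smooth. Near a
point with representative `b`, the local section is `b` times `param` of the chart. -/
theorem isHomogeneousManifold {d : ℕ} (A : OrbitData emb H orb (EuclideanSpace ℝ (Fin d))) :
    letI := A.atlas.chartedSpace
    IsHomogeneousManifold emb H d := by
  let _ := A.atlas.chartedSpace
  obtain ⟨h1, h2, h3, -, h5, h6⟩ := A.baseChart_spec
  classical
  refine ⟨A.atlas.isManifold, ?_, fun y => ?_⟩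
  -- The extension of the projection to `V` chooses a preimage under `emb`. The choice is harmless
  -- since the orbit map depends only on `emb a`, and the value off the range of `emb` is never
  -- used.
  · have hF : ∀ a : Γ, (if h : emb a ∈ Set.range emb then ((h.choose : Γ) : Γ ⧸ H)
        else ((1 : Γ) : Γ ⧸ H)) = a := by
      intro a
      rw [dif_pos ⟨a, rfl⟩]
      apply A.quot_injective
      rw [quot_mk, quot_mk, ← A.orbExt_emb, (Set.mem_range_self (f := emb) a).choose_spec,
        A.orbExt_emb]
    refine ⟨fun v => if h : v ∈ Set.range emb then ((h.choose : Γ) : Γ ⧸ H)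
      else ((1 : Γ) : Γ ⧸ H), hF, ?_⟩
    intro v hv
    refine A.atlas.contMDiffWithinAt_of_comp ?_
    have hO : ContMDiffWithinAt 𝓘(ℝ, V) 𝓘(ℝ, W) ∞ A.orbExt (Set.range emb) v :=
      A.contDiff_orbExt.contMDiff.contMDiffAt.contMDiffWithinAt
    have he : ∀ u ∈ Set.range emb, A.quot (if h : u ∈ Set.range emb then
        ((h.choose : Γ) : Γ ⧸ H) else ((1 : Γ) : Γ ⧸ H)) = A.orbExt u := by
      rintro _ ⟨a, rfl⟩
      rw [hF, quot_mk, A.orbExt_emb]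
    exact hO.congr he (he v hv)
  · set b : Γ := Quotient.out y with hb
    let e := A.atlas.chart y
    refine ⟨e.source, e.open_source.mem_nhds (A.atlas.mem_source y),
      fun z => b * A.param (e z), fun z hz => ?_, ?_⟩
    · have h7 : e.symm (e z) = z := e.left_inv hz
      refine Eq.trans ?_ h7
      have h8 : e.symm (e z) = b • A.baseChart.symm (e z) := by
        simp [e, atlas, hb]
      rw [h8]
      exact congrArg (b • ·) (h3 (e z)).symm
    · have := A.atlas.isManifold
      intro z hz
      have hc : ContMDiffWithinAt (𝓡 d) (𝓡 d) ∞ e e.source z :=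
        (contMDiffOn_chart (I := 𝓡 d) (n := ∞) (x := y)) z hz
      have hg : ContDiffAt ℝ ∞ (fun v => A.translate b (emb (A.param v))) (e z) := by
        refine (A.contDiff_translate b).contDiffAt.comp _ (h5 _ ?_)
        have : e z ∈ e.target := e.map_source hz
        simpa [e, atlas] using this
      have hgm : ContMDiffAt (𝓡 d) 𝓘(ℝ, V) ∞ (fun v => A.translate b (emb (A.param v))) (e z) :=
        hg.contMDiffAt
      have h9 := hgm.comp_contMDiffWithinAt z hc
      exact h9.congr (fun u _ => (A.translate_emb _ _).symm) (A.translate_emb _ _).symm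

end OrbitData

end

noncomputable section

/-! ### From local parametrizations to twistor bundles -/

section ModelProd

variable {m d : ℕ}

/-- On a product of model spaces the product atlas and the model atlas agree by
`chartedSpaceSelf_prod`; the next lemmas move smoothness statements across this identification. -/
theorem contMDiff_modelProd_fst : ContMDiff ((𝓡 m).prod (𝓡 d)) (𝓡 m) ∞
    (fun a : ModelProd (EuclideanSpace ℝ (Fin m)) (EuclideanSpace ℝ (Fin d)) => a.1) := by
  have h := contMDiff_fst (I := 𝓡 m) (J := 𝓡 d) (n := ∞) (M := EuclideanSpace ℝ (Fin m))
    (N := EuclideanSpace ℝ (Fin d))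
  rw [chartedSpaceSelf_prod] at h
  exact h

theorem contMDiff_modelProd_snd : ContMDiff ((𝓡 m).prod (𝓡 d)) (𝓡 d) ∞
    (fun a : ModelProd (EuclideanSpace ℝ (Fin m)) (EuclideanSpace ℝ (Fin d)) => a.2) := by
  have h := contMDiff_snd (I := 𝓡 m) (J := 𝓡 d) (n := ∞) (M := EuclideanSpace ℝ (Fin m))
    (N := EuclideanSpace ℝ (Fin d))
  rw [chartedSpaceSelf_prod] at h
  exact h

theorem ContMDiffAt.modelProd_mk {E H X : Type*} [NormedAddCommGroup E] [NormedSpace ℝ E]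
    [TopologicalSpace H] {I : ModelWithCorners ℝ E H} [TopologicalSpace X] [ChartedSpace H X]
    {f : X → EuclideanSpace ℝ (Fin m)} {g : X → EuclideanSpace ℝ (Fin d)} {x : X}
    (hf : ContMDiffAt I (𝓡 m) ∞ f x) (hg : ContMDiffAt I (𝓡 d) ∞ g x) :
    ContMDiffAt (M' := ModelProd (EuclideanSpace ℝ (Fin m)) (EuclideanSpace ℝ (Fin d)))
      I ((𝓡 m).prod (𝓡 d)) ∞ (fun x => (f x, g x)) x := by
  have h := hf.prodMk hg
  rw [chartedSpaceSelf_prod] at h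
  exact h

end ModelProd

/-! ### Gluing local products into an embedded bundle with homogeneous fibre -/

section LocalData

variable {m : ℕ} {M : Type*} [TopologicalSpace M] [ChartedSpace (EuclideanSpace ℝ (Fin m)) M]
  {E' H' N : Type*} [NormedAddCommGroup E'] [NormedSpace ℝ E'] [TopologicalSpace H']
  [TopologicalSpace N] [ChartedSpace H' N]

/-- Smooth maps `fwd`, `bwd` which identify the part of `Z` over the open set `base` with the
product of `base` and the subset `Q` of the vector space `W`; here `pr` is the projection to `M`. -/
structure LocalProduct (m : ℕ) {M E' H' N : Type*} [TopologicalSpace M]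
    [ChartedSpace (EuclideanSpace ℝ (Fin m)) M] [NormedAddCommGroup E'] [NormedSpace ℝ E']
    [TopologicalSpace H'] [TopologicalSpace N] [ChartedSpace H' N] {W : Type*} [NormedAddCommGroup W] [NormedSpace ℝ W]
    (J : ModelWithCorners ℝ E' H') (pr : N → M) (Z : Set N) (Q : Set W) where
  base : Set M
  isOpen_base : IsOpen base
  fwd : N → W
  bwd : M × W → N
  contMDiffOn_fwd : ContMDiffOn J 𝓘(ℝ, W) ∞ fwd
    (pr ⁻¹' base)
  contMDiffOn_bwd : ContMDiffOn ((𝓡 m).prod 𝓘(ℝ, W)) J ∞ bwd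
    (base ×ˢ Set.univ)
  proj_bwd : ∀ x ∈ base, ∀ w, pr (bwd (x, w)) = x
  fwd_mem : ∀ z ∈ Z, pr z ∈ base → fwd z ∈ Q
  bwd_fwd : ∀ z ∈ Z, pr z ∈ base → bwd (pr z, fwd z) = z
  bwd_mem : ∀ x ∈ base, ∀ w ∈ Q, bwd (x, w) ∈ Z
  fwd_bwd : ∀ x ∈ base, ∀ w ∈ Q, fwd (bwd (x, w)) = w

variable {Γ V W : Type*} [Group Γ] [TopologicalSpace Γ] [IsTopologicalGroup Γ]
  [NormedAddCommGroup V] [NormedSpace ℝ V] [NormedAddCommGroup W] [NormedSpace ℝ W]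
  {emb : Γ → V} {H : Subgroup Γ} {orb : Γ → W} {d : ℕ}
  {J : ModelWithCorners ℝ E' H'} {pr : N → M} {Z : Set N}

section

variable (A : OrbitData emb H orb (EuclideanSpace ℝ (Fin d))) (hpr : ContMDiff J (𝓡 m) ∞ pr)
  (L : LocalProduct m J pr Z (Set.range orb))

/-- The inverse of the embedding of the homogeneous space. -/
def OrbitData.quotInv (w : W) : Γ ⧸ H :=
  haveI : Nonempty (Γ ⧸ H) := ⟨((1 : Γ) : Γ ⧸ H)⟩
  Function.invFun A.quot w

theorem OrbitData.quot_quotInv {w : W} (hw : w ∈ Set.range orb) : A.quot (A.quotInv w) = w := by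
  obtain ⟨a, rfl⟩ := hw
  exact Function.invFun_eq ⟨(a : Γ ⧸ H), rfl⟩

theorem OrbitData.quotInv_quot (y : Γ ⧸ H) : A.quotInv (A.quot y) = y :=
  A.quot_injective (A.quot_quotInv (A.quot_mem_range y))

open Classical in
/-- The local trivialization of `Z` over `L.base`. -/
def LocalProduct.trivialization (hne : L.base.Nonempty) :
    Trivialization (Γ ⧸ H) (fun z : Z => pr z) where
  toFun z := (pr z, A.quotInv (L.fwd z))
  -- A total function is required, so outside the base set the base point is replaced by some point
  -- of `L.base`; only the first branch matters.
  invFun y := if hx : y.1 ∈ L.base then ⟨L.bwd (y.1, A.quot y.2),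
      L.bwd_mem _ hx _ (A.quot_mem_range _)⟩ else
    ⟨L.bwd (hne.some, A.quot y.2), L.bwd_mem _ hne.some_mem _ (A.quot_mem_range _)⟩
  source := (fun z : Z => pr z) ⁻¹' L.base
  target := L.base ×ˢ Set.univ
  baseSet := L.base
  map_source' z hz := ⟨hz, Set.mem_univ _⟩
  map_target' y hy := by
    rw [dif_pos hy.1]
    change pr (L.bwd _) ∈ L.base
    rw [L.proj_bwd _ hy.1]
    exact hy.1
  left_inv' z hz := by
    rw [dif_pos (by exact hz)]
    apply Subtype.ext
    change L.bwd (_, A.quot (A.quotInv (L.fwd z))) = _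
    rw [A.quot_quotInv (L.fwd_mem _ z.2 hz)]
    exact L.bwd_fwd _ z.2 hz
  right_inv' y hy := by
    rw [dif_pos hy.1]
    refine Prod.ext (L.proj_bwd _ hy.1 _) ?_
    change A.quotInv (L.fwd (L.bwd (y.1, A.quot y.2))) = y.2
    rw [L.fwd_bwd _ hy.1 _ (A.quot_mem_range _), A.quotInv_quot]
  open_source := L.isOpen_base.preimage
    (hpr.continuous.comp continuous_subtype_val)
  open_target := L.isOpen_base.prod isOpen_univ
  open_baseSet := L.isOpen_base
  continuousOn_toFun := by
    refine ContinuousOn.prodMk (hpr.continuous.comp continuous_subtype_val).continuousOn ?_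
    rw [A.isInducing_quot.continuousOn_iff]
    refine (L.contMDiffOn_fwd.continuousOn.comp continuous_subtype_val.continuousOn
      (s := (fun z : Z => pr z) ⁻¹' L.base) fun z hz => hz).congr ?_
    intro z hz
    exact A.quot_quotInv (L.fwd_mem _ z.2 hz)
  continuousOn_invFun := by
    rw [Topology.IsInducing.subtypeVal.continuousOn_iff]
    refine (L.contMDiffOn_bwd.continuousOn.comp (f := fun y : M × (Γ ⧸ H) => (y.1, A.quot y.2))
      (continuous_fst.prodMk (A.continuous_quot.comp continuous_snd)).continuousOn
      (s := L.base ×ˢ Set.univ) fun y hy => ⟨hy.1, Set.mem_univ _⟩).congr ?_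
    intro y hy
    simp only [Function.comp_apply, dif_pos hy.1]
  source_eq := rfl
  target_eq := rfl
  proj_toFun z _ := rfl

variable {A hpr L} in
theorem LocalProduct.trivialization_symm_coe (hne : L.base.Nonempty) {y : M × (Γ ⧸ H)}
    (hy : y.1 ∈ L.base) :
    (((L.trivialization A hpr hne).toOpenPartialHomeomorph.symm y : Z) : N) =
      L.bwd (y.1, A.quot y.2) := by
  exact congrArg Subtype.val (dif_pos hy)

end

variable (A : OrbitData emb H orb (EuclideanSpace ℝ (Fin d)))
  (hpr : ContMDiff J (𝓡 m) ∞ pr) (L : ∀ _ : M, LocalProduct m J pr Z (Set.range orb)) (hL : ∀ x, x ∈ (L x).base)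

variable [IsManifold (𝓡 m) ∞ M]

/-- The charts of `Z` given by charts of `M` and of the homogeneous space. -/
def twistorAtlas : EmbeddedAtlas ((𝓡 m).prod (𝓡 d)) J
    (fun z : Z => (z : N)) where
  isInducing := Topology.IsInducing.subtypeVal
  chart z := ((L (pr z)).trivialization A hpr ⟨_, hL _⟩).toOpenPartialHomeomorph.trans
    ((chartAt (EuclideanSpace ℝ (Fin m)) (pr z)).prod
      (A.atlas.chart (A.quotInv ((L (pr z)).fwd z))))
  mem_source z := by
    rw [OpenPartialHomeomorph.trans_source]
    exact ⟨hL _, mem_chart_source _ _, A.atlas.mem_source _⟩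
  ext z w := (chartAt (EuclideanSpace ℝ (Fin m)) (pr z) (pr w),
    A.atlas.ext (A.quotInv ((L (pr z)).fwd z)) ((L (pr z)).fwd w))
  ext_eq z z' hz' := by
    rw [OpenPartialHomeomorph.trans_source] at hz'
    obtain ⟨h1, h2, h3⟩ := hz'
    refine Prod.ext rfl ?_
    have h := A.atlas.ext_eq _ _ h3
    have h4 : A.quot (A.quotInv ((L (pr z)).fwd z')) = (L (pr z)).fwd z' :=
      A.quot_quotInv ((L (pr z)).fwd_mem _ z'.2 h1)
    change A.atlas.ext _ (A.quot (A.quotInv ((L (pr z)).fwd z'))) = _ at h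
    rw [h4] at h
    exact h
  contMDiffAt_ext z z' hz' := by
    rw [OpenPartialHomeomorph.trans_source] at hz'
    obtain ⟨h1, h2, h3⟩ := hz'
    refine ContMDiffAt.modelProd_mk ?_ ?_
    · have h6 : ContMDiffAt J (𝓡 m) ∞
          pr z' := hpr.contMDiffAt
      exact ContMDiffAt.comp (z' : N) ((contMDiffOn_chart (I := 𝓡 m) (n := ∞)).contMDiffAt
        ((chartAt (EuclideanSpace ℝ (Fin m)) (pr z)).open_source.mem_nhds h2)) h6
    · have h4 : A.quot (A.quotInv ((L (pr z)).fwd z')) = (L (pr z)).fwd z' :=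
        A.quot_quotInv ((L (pr z)).fwd_mem _ z'.2 h1)
      have h5 := A.atlas.contMDiffAt_ext _ _ h3
      change ContMDiffAt _ _ _ _ (A.quot (A.quotInv ((L (pr z)).fwd z'))) at h5
      rw [h4] at h5
      refine ContMDiffAt.comp (z' : N) h5 ?_
      exact (L (pr z)).contMDiffOn_fwd.contMDiffAt (((L (pr z)).isOpen_base.preimage
        hpr.continuous).mem_nhds h1)
  contMDiffOn_symm z := by
    set C := A.atlas.chart (A.quotInv ((L (pr z)).fwd z)) with hC
    set φ := chartAt (EuclideanSpace ℝ (Fin m)) (pr z) with hφ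
    intro a ha
    rw [OpenPartialHomeomorph.trans_target] at ha
    obtain ⟨⟨h1, h2⟩, h3⟩ := ha
    have hb : φ.symm a.1 ∈ (L (pr z)).base := h3.1
    refine ContMDiffAt.contMDiffWithinAt ?_
    have hφs : ContMDiffAt ((𝓡 m).prod (𝓡 d)) (𝓡 m) ∞
        (fun a : ModelProd (EuclideanSpace ℝ (Fin m)) (EuclideanSpace ℝ (Fin d)) =>
          φ.symm a.1) a :=
      ContMDiffAt.comp (I' := 𝓡 m) a ((contMDiffOn_chart_symm (I := 𝓡 m) (n := ∞)).contMDiffAt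
        (φ.open_target.mem_nhds h1)) contMDiff_modelProd_fst.contMDiffAt
    have hCs : ContMDiffAt ((𝓡 m).prod (𝓡 d)) 𝓘(ℝ, W) ∞
        (fun a : ModelProd (EuclideanSpace ℝ (Fin m)) (EuclideanSpace ℝ (Fin d)) =>
          A.quot (C.symm a.2)) a :=
      ContMDiffAt.comp (I' := 𝓡 d) (g := A.quot ∘ C.symm) a
        ((A.atlas.contMDiffOn_symm _).contMDiffAt (C.open_target.mem_nhds h2))
        contMDiff_modelProd_snd.contMDiffAt
    -- As a map into `N`, the inverse chart is `bwd` applied to the inverse charts of the two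
    -- factors, as long as the first one stays in the base.
    have hbw := ((L (pr z)).contMDiffOn_bwd (φ.symm a.1, A.quot (C.symm a.2))
      ⟨hb, Set.mem_univ _⟩).contMDiffAt
        (((L (pr z)).isOpen_base.prod isOpen_univ).mem_nhds ⟨hb, Set.mem_univ _⟩)
    refine (ContMDiffAt.comp a hbw (hφs.prodMk hCs)).congr_of_eventuallyEq ?_
    have hn : ∀ᶠ b in 𝓝 a, φ.symm b.1 ∈ (L (pr z)).base :=
      hφs.continuousAt.preimage_mem_nhds ((L (pr z)).isOpen_base.mem_nhds hb)
    filter_upwards [hn] with b hb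
    exact LocalProduct.trivialization_symm_coe (A := A) (hpr := hpr) (L := L (pr z)) ⟨_, hL _⟩
      (y := (φ.symm b.1, C.symm b.2)) hb

/-- The fibre component is tested after embedding the homogeneous space in `W`, where it is the
restriction of the smooth map `fwd`. -/
theorem contMDiffOn_trivialization {L : LocalProduct m J pr Z (Set.range orb)}
    (B : EmbeddedAtlas ((𝓡 m).prod (𝓡 d)) J (fun z : Z => (z : N))) (hne : L.base.Nonempty) :
    letI := A.atlas.chartedSpace
    letI := B.chartedSpace
    ContMDiffOn ((𝓡 m).prod (𝓡 d)) ((𝓡 m).prod (𝓡 d)) ∞ (L.trivialization A hpr hne)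
      (L.trivialization A hpr hne).source := by
  let _ := A.atlas.chartedSpace
  let _ := B.chartedSpace
  intro z hz
  refine ContMDiffWithinAt.prodMk ?_ ?_
  · exact (hpr.comp B.contMDiff_embedding).contMDiffAt.contMDiffWithinAt
  · refine A.atlas.contMDiffWithinAt_of_comp ?_
    have h1 : ContMDiffAt ((𝓡 m).prod (𝓡 d)) 𝓘(ℝ, W) ∞ (fun z : Z => L.fwd z) z :=
      ContMDiffAt.comp z (L.contMDiffOn_fwd.contMDiffAt ((L.isOpen_base.preimage
        hpr.continuous).mem_nhds hz)) B.contMDiff_embedding.contMDiffAt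
    refine h1.contMDiffWithinAt.congr (fun y hy => ?_) ?_
    · exact A.quot_quotInv (L.fwd_mem _ y.2 hy)
    · exact A.quot_quotInv (L.fwd_mem _ z.2 hz)

theorem contMDiffOn_trivialization_symm {L : LocalProduct m J pr Z (Set.range orb)}
    (B : EmbeddedAtlas ((𝓡 m).prod (𝓡 d)) J (fun z : Z => (z : N))) (hne : L.base.Nonempty) :
    letI := A.atlas.chartedSpace
    letI := B.chartedSpace
    ContMDiffOn ((𝓡 m).prod (𝓡 d)) ((𝓡 m).prod (𝓡 d)) ∞
      (L.trivialization A hpr hne).toOpenPartialHomeomorph.symm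
      (L.trivialization A hpr hne).target := by
  let _ := A.atlas.chartedSpace
  let _ := B.chartedSpace
  intro y hy
  refine B.contMDiffWithinAt_of_comp ?_
  have hq : ContMDiffAt ((𝓡 m).prod (𝓡 d)) ((𝓡 m).prod 𝓘(ℝ, W)) ∞
      (fun y : M × (Γ ⧸ H) => (y.1, A.quot y.2)) y :=
    contMDiffAt_fst.prodMk (ContMDiffAt.comp (I' := 𝓡 d) y
      A.atlas.contMDiff_embedding.contMDiffAt contMDiffAt_snd)
  have h1 := ContMDiffAt.comp y ((L.contMDiffOn_bwd (y.1, A.quot y.2)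
    ⟨hy.1, Set.mem_univ _⟩).contMDiffAt
    ((L.isOpen_base.prod isOpen_univ).mem_nhds ⟨hy.1, Set.mem_univ _⟩)) hq
  refine h1.contMDiffWithinAt.congr (fun u hu => ?_) ?_
  · exact LocalProduct.trivialization_symm_coe hne hu.1
  · exact LocalProduct.trivialization_symm_coe hne hy.1

/-- Because smoothness into `Z` is detected in `N`, sections of the bundle are the same as smooth
ambient sections with values in `Z`. This gives the description of the integrable structures. -/
theorem EmbeddedAtlas.exists_section_iff
    (B : EmbeddedAtlas ((𝓡 m).prod (𝓡 d)) J (fun z : Z => (z : N))) (σ : M → N) :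
    letI := B.chartedSpace
    (∃ s : M → Z, ContMDiff (𝓡 m) ((𝓡 m).prod (𝓡 d)) ∞ s ∧ ∀ x, (s x : N) = σ x) ↔
      ContMDiff (𝓡 m) J ∞ σ ∧ ∀ x, σ x ∈ Z := by
  let _ := B.chartedSpace
  refine ⟨fun ⟨s, h1, h2⟩ => ?_, fun ⟨h1, h2⟩ => ?_⟩
  · obtain rfl : (fun z : Z => (z : N)) ∘ s = σ := funext h2
    exact ⟨B.contMDiff_embedding.comp h1, fun x => (s x).2⟩
  · exact ⟨fun x => ⟨_, h2 x⟩, fun x => B.contMDiffWithinAt_of_comp (h1 x), fun x => rfl⟩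

theorem isTwistorBundle_of_localProduct
    {Z : Set (EndTotal m M)} (A : OrbitData emb H orb (EuclideanSpace ℝ (Fin d)))
    (L : ∀ _ : M, LocalProduct m ((𝓡 m).prod 𝓘(ℝ, EndModel m)) TotalSpace.proj Z (Set.range orb))
    (hL : ∀ x, x ∈ (L x).base) {lam : ℝ} {P : (∀ x : M, EndExt m x) → Prop}
    (hP : ∀ S, P S ↔ (IsSmoothEndSection S ∧ ∀ x, TotalSpace.mk' (EndModel m) x (S x) ∈ Z) ∧
      IsCourantInvolutive lam S) :
    IsTwistorBundle Z emb H lam P := by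
  have hpr : ContMDiff ((𝓡 m).prod 𝓘(ℝ, EndModel m)) (𝓡 m) ∞
    (TotalSpace.proj : EndTotal m M → M) := contMDiff_proj _
  let B := twistorAtlas A hpr L hL
  refine ⟨d, A.atlas.chartedSpace, B.chartedSpace, A.isHomogeneousManifold, B.isManifold,
    B.contMDiff_embedding, B.mfderiv_injective, fun x => ?_, fun S => ?_⟩
  · exact ⟨(L x).trivialization A hpr ⟨x, hL x⟩, hL x, contMDiffOn_trivialization A hpr B _,
      contMDiffOn_trivialization_symm A hpr B _⟩
  · rw [hP]
    exact and_congr_left fun _ => (B.exists_section_iff _).symm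

end LocalData

end

noncomputable section

/-! ### Inverse functions and square roots -/

/-- Inverse function theorem when the derivative is a nonzero scalar. Analyticity is assumed because
it passes from a point to a neighbourhood, whereas `ContDiffAt` of order `∞` at one point need not.
-/
theorem ContDiffAt.exists_local_rightInverse {X : Type*} [NormedAddCommGroup X] [NormedSpace ℝ X]
    [CompleteSpace X] {F : X → X} {a : X} {c : ℝ} (hF : ContDiffAt ℝ ω F a)
    (hd : HasFDerivAt F (c • ContinuousLinearMap.id ℝ X) a) (hc : c ≠ 0) :
    ∃ G : X → X, G (F a) = a ∧ ∀ᶠ y in 𝓝 (F a), ContDiffAt ℝ ∞ G y ∧ F (G y) = y := by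
  let e : X ≃L[ℝ] X := ContinuousLinearEquiv.smulLeft (Units.mk0 c hc)
  have hd' : HasFDerivAt F (e : X →L[ℝ] X) a := hd
  have hω : (ω : WithTop ℕ∞) ≠ 0 := by simp
  have hG := hF.to_localInverse hd' hω
  refine ⟨hF.localInverse hd' hω, hF.localInverse_apply_image hd' hω, ?_⟩
  filter_upwards [hG.eventually (by simp),
    (hF.hasStrictFDerivAt' hd' hω).eventually_right_inverse] with y h1 h2
  exact ⟨h1.of_le le_top, h2⟩

section Algebra

variable {R : Type*} [NormedRing R] [NormedAlgebra ℝ R] [FiniteDimensional ℝ R]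
  (N : Submodule ℝ R)

/-- Squaring maps `N` to itself and has derivative `2` at `1`. Applying the inverse function theorem
inside `N` keeps the root in `N`. -/
theorem Submodule.exists_contDiffAt_sqrt (h1 : (1 : R) ∈ N) (hsq : ∀ a ∈ N, a * a ∈ N) :
    ∃ G : N → N, ∀ᶠ a in 𝓝 (⟨1, h1⟩ : N), ContDiffAt ℝ ∞ G a ∧ (G a : R) * G a = a := by
  have : CompleteSpace N := FiniteDimensional.complete ℝ N
  obtain ⟨pr, hpr⟩ := Submodule.ClosedComplemented.of_finiteDimensional N
  let F : N → N := fun a => pr (a * a)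
  have hFv : ∀ a : N, (F a : R) = a * a := fun a =>
    congrArg Subtype.val (hpr ⟨_, hsq a a.2⟩)
  have hF1 : F ⟨1, h1⟩ = ⟨1, h1⟩ := Subtype.ext ((hFv _).trans (mul_one _))
  have hF : ContDiff ℝ ω F :=
    pr.contDiff.comp (N.subtypeL.contDiff.mul N.subtypeL.contDiff)
  have hd : HasFDerivAt F ((2 : ℝ) • ContinuousLinearMap.id ℝ N) ⟨1, h1⟩ := by
    have h2 := (N.subtypeL.hasFDerivAt (x := ⟨1, h1⟩)).mul' (N.subtypeL.hasFDerivAt (x := ⟨1, h1⟩))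
    refine (pr.hasFDerivAt.comp (⟨1, h1⟩ : N) h2).congr_fderiv ?_
    ext v
    simp [two_smul, hpr]
  obtain ⟨G, -, hG⟩ := hF.contDiffAt.exists_local_rightInverse hd two_ne_zero
  rw [hF1] at hG
  refine ⟨G, hG.mono fun a ha => ⟨ha.1, ?_⟩⟩
  rw [← hFv, ha.2]

/-- The equation `2 g (1 + g²)⁻¹ = a` is the half-argument formula for the Cayley transform: its
solution gives a square root of `cayley a`. The left side has derivative `2` at `0`. -/
theorem Submodule.exists_contDiffAt_half
    (hN : ∀ a ∈ N, a * Ring.inverse (1 + a * a) ∈ N) :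
    ∃ G : N → N, G 0 = 0 ∧ ∀ᶠ a in 𝓝 (0 : N), ContDiffAt ℝ ∞ G a ∧
      2 * (G a : R) * Ring.inverse (1 + (G a : R) * G a) = a := by
  have : CompleteSpace N := FiniteDimensional.complete ℝ N
  have : CompleteSpace R := FiniteDimensional.complete ℝ R
  obtain ⟨pr, hpr⟩ := Submodule.ClosedComplemented.of_finiteDimensional N
  let q : N → R := fun a => a * Ring.inverse (1 + (a : R) * a)
  let F : N → N := fun a => (2 : ℝ) • pr (q a)
  have hFv : ∀ a : N, (F a : R) = 2 * (a : R) * Ring.inverse (1 + (a : R) * a) := fun a => by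
    have h : pr (q a) = ⟨q a, hN a a.2⟩ := hpr ⟨q a, hN a a.2⟩
    change (((2 : ℝ) • pr (q a) : N) : R) = _
    rw [h]
    simp [q, two_smul, two_mul, add_mul]
  have hF0 : F 0 = 0 := Subtype.ext (by rw [hFv]; simp)
  have hinv : ContDiffAt ℝ ω (fun a : N => Ring.inverse (1 + (a : R) * a)) 0 := by
    have h3 : ContDiffAt ℝ ω (Ring.inverse : R → R)
        (1 + ((0 : N) : R) * ((0 : N) : R)) := by
      simpa using contDiffAt_ringInverse ℝ (1 : Rˣ)
    exact ContDiffAt.comp (0 : N) h3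
      (contDiff_const.add (N.subtypeL.contDiff.mul N.subtypeL.contDiff)).contDiffAt
  have hF : ContDiffAt ℝ ω F 0 :=
    (pr.contDiff.contDiffAt.comp (0 : N) (N.subtypeL.contDiff.contDiffAt.mul hinv)).const_smul
      (2 : ℝ)
  have hd : HasFDerivAt F ((2 : ℝ) • ContinuousLinearMap.id ℝ N) 0 := by
    have h2 := (N.subtypeL.hasFDerivAt (x := 0)).mul'
      (hinv.differentiableAt (by simp)).hasFDerivAt
    refine ((pr.hasFDerivAt.comp (0 : N) h2).const_smul (2 : ℝ)).congr_fderiv ?_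
    ext v
    simp [hpr]
  obtain ⟨G, hG0, hG⟩ := hF.exists_local_rightInverse hd two_ne_zero
  rw [hF0] at hG hG0
  refine ⟨G, hG0, hG.mono fun a ha => ⟨ha.1, ?_⟩⟩
  rw [← hFv, ha.2]

theorem Submodule.exists_contDiffAt_sqrt_ambient (h1 : (1 : R) ∈ N)
    (hsq : ∀ a ∈ N, a * a ∈ N) :
    ∃ G : R → R, ∀ᶠ a in 𝓝 (1 : R), ContDiffAt ℝ ∞ G a ∧ (a ∈ N → G a ∈ N ∧ G a * G a = a) := by
  obtain ⟨G, hG⟩ := N.exists_contDiffAt_sqrt h1 hsq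
  obtain ⟨pr, hpr⟩ := Submodule.ClosedComplemented.of_finiteDimensional N
  have ht : Filter.Tendsto pr (𝓝 1) (𝓝 (⟨1, h1⟩ : N)) := by
    have := pr.continuous.tendsto 1
    rwa [hpr ⟨1, h1⟩] at this
  refine ⟨fun a => G (pr a), ?_⟩
  filter_upwards [ht.eventually hG] with a ha
  refine ⟨N.subtypeL.contDiff.contDiffAt.comp a (ha.1.comp a pr.contDiff.contDiffAt),
    fun hmem => ⟨(G (pr a)).2, ?_⟩⟩
  rw [ha.2]
  exact congrArg Subtype.val (hpr ⟨a, hmem⟩)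

end Algebra

/-! ### Local normal form of a family of symmetric bilinear forms -/

section Frame

variable {E : Type*} [NormedAddCommGroup E] [NormedSpace ℝ E] [FiniteDimensional ℝ E]

/-- A nondegenerate bilinear form as an isomorphism onto the dual space. -/
def flatEquiv (f : E →L[ℝ] E →L[ℝ] ℝ) (hf : ∀ v, (∀ w, f v w = 0) → v = 0) :
    E ≃L[ℝ] (E →L[ℝ] ℝ) :=
  (LinearEquiv.ofBijective f.toLinearMap (by
    have hinj : Function.Injective f.toLinearMap := by
      rw [injective_iff_map_eq_zero]
      exact fun v hv => hf v fun w => DFunLike.congr_fun hv w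
    refine ⟨hinj, (LinearMap.injective_iff_surjective_of_finrank_eq_finrank ?_).1 hinj⟩
    rw [← LinearMap.toContinuousLinearMap.finrank_eq, Subspace.dual_finrank_eq])).toContinuousLinearEquiv

/-- Put `α f = f₀⁻¹ f`, so that `f v w = f₀ (α f v) w`. Symmetry of `f` makes `α f` self-adjoint for
`f₀`, and so is its square root `h`; hence `f₀ (h v) (h w) = f₀ (h² v) w = f v w`. -/
theorem exists_contDiffAt_frame (f₀ : E →L[ℝ] E →L[ℝ] ℝ) (hs : ∀ v w, f₀ v w = f₀ w v)
    (hf₀ : ∀ v, (∀ w, f₀ v w = 0) → v = 0) :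
    ∃ h : (E →L[ℝ] E →L[ℝ] ℝ) → E →L[ℝ] E, ∀ᶠ f in 𝓝 f₀, ContDiffAt ℝ ∞ h f ∧
      ((∀ v w, f v w = f w v) → IsUnit (h f) ∧ ∀ v w, f₀ (h f v) (h f w) = f v w) := by
  have : CompleteSpace E := FiniteDimensional.complete ℝ E
  obtain ⟨N, hN⟩ : ∃ N : Submodule ℝ (E →L[ℝ] E), ∀ a, a ∈ N ↔ ∀ v w, f₀ (a v) w = f₀ v (a w) :=
    ⟨{ carrier := {a | ∀ v w, f₀ (a v) w = f₀ v (a w)}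
       add_mem' := fun {a b} ha hb v w => by
        have h1 := ha v w
        have h2 := hb v w
        simp [h1, h2]
       zero_mem' := fun v w => by simp
       smul_mem' := fun c a ha v w => by
        have h1 := ha v w
        simp [h1] }, fun a => Iff.rfl⟩
  have h1 : (1 : E →L[ℝ] E) ∈ N := (hN _).2 fun v w => rfl
  obtain ⟨G, hG⟩ := N.exists_contDiffAt_sqrt_ambient h1 fun a ha =>
    (hN _).2 fun v w => ((hN a).1 ha _ _).trans ((hN a).1 ha _ _)
  let e := flatEquiv f₀ hf₀
  obtain ⟨α, hαe⟩ : ∃ α : (E →L[ℝ] E →L[ℝ] ℝ) →L[ℝ] (E →L[ℝ] E), ∀ f v, α f v = e.symm (f v) :=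
    ⟨ContinuousLinearMap.compL ℝ E (E →L[ℝ] ℝ) E (e.symm : (E →L[ℝ] ℝ) →L[ℝ] E), fun _ _ => rfl⟩
  have hα : ∀ f v, f₀ (α f v) = f v := fun f v => by
    rw [hαe]
    exact e.apply_symm_apply (f v)
  have hα0 : α f₀ = 1 := by
    ext1 v
    rw [hαe]
    exact e.symm_apply_apply v
  have hαd : ContDiff ℝ ∞ α := by fun_prop
  have ht : Filter.Tendsto α (𝓝 f₀) (𝓝 1) := by
    rw [← hα0]
    exact α.continuous.continuousAt
  refine ⟨fun f => G (α f), ?_⟩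
  filter_upwards [ht.eventually hG, ht.eventually (Units.isOpen.mem_nhds isUnit_one)] with f hf hfu
  refine ⟨hf.1.comp f hαd.contDiffAt, fun hsym => ?_⟩
  obtain ⟨hm, hsq⟩ := hf.2 ((hN _).2 fun v w => by rw [hα, hs, hα, hsym])
  refine ⟨?_, fun v w => ?_⟩
  -- Near `f₀` the square `α f` is invertible, and a factor of it commuting with itself is then
  -- invertible too.
  · have hfu' : IsUnit (α f) := hfu
    rw [← hsq] at hfu'
    exact ((Commute.refl _).isUnit_mul_iff.1 hfu').1
  · rw [← (hN _).1 hm, ← hα f v]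
    conv_rhs => rw [← hsq]
    rfl

end Frame

end

noncomputable section

theorem hasSignature_congr {V V' : Type*} [AddCommGroup V] [Module ℝ V] [AddCommGroup V']
    [Module ℝ V'] {B : LinearMap.BilinForm ℝ V} {B' : LinearMap.BilinForm ℝ V'} (e : V ≃ₗ[ℝ] V')
    (he : ∀ v, B' (e v) (e v) = B v v) {p q : ℕ} (hB : HasSignature B p q) :
    HasSignature B' p q := by
  have h : QuadraticMap.Equivalent B.toQuadraticMap B'.toQuadraticMap := ⟨⟨e, fun v => he v⟩⟩
  exact ⟨h.sigPos_eq.symm.trans hB.1, h.sigNeg_eq.symm.trans hB.2⟩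

/-! ### Twistor fibres in a fixed vector space -/

section Model

variable {m : ℕ}

/-- Bilinear forms on `ℝ^m`. -/
abbrev ModelMetric (m : ℕ) : Type :=
  EuclideanSpace ℝ (Fin m) →L[ℝ] EuclideanSpace ℝ (Fin m) →L[ℝ] ℝ

/-- Nondegenerate symmetric bilinear forms. -/
structure ModelMetric.IsMetric (f : ModelMetric m) : Prop where
  symm : ∀ v w, f v w = f w v
  nondegenerate : ∀ v, (∀ w, f v w = 0) → v = 0

theorem ModelMetric.IsMetric.apply_inverse {f : ModelMetric m} (hf : f.IsMetric)
    (σ : EuclideanSpace ℝ (Fin m) →L[ℝ] ℝ) : f (f.inverse σ) = σ := by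
  have h : f = (flatEquiv f hf.nondegenerate : EuclideanSpace ℝ (Fin m) →L[ℝ] _) := rfl
  conv_lhs => rw [h, ContinuousLinearMap.inverse_equiv]
  exact (flatEquiv f hf.nondegenerate).apply_symm_apply σ

theorem ModelMetric.IsMetric.injective {f : ModelMetric m} (hf : f.IsMetric) :
    Function.Injective f :=
  (flatEquiv f hf.nondegenerate).injective

/-- The canonical pairing on `ℝ^m ⊕ (ℝ^m)^*`. -/
def modelPairing (X Y : ExtModel m) : ℝ := Y.2 X.1 + X.2 Y.1

/-- The endomorphism `I_k` of `ℝ^m ⊕ (ℝ^m)^*`. -/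
def modelI (f : ModelMetric m) (k : ℝ) : EndModel m :=
  ((k • f.inverse).comp (ContinuousLinearMap.snd ℝ _ _)).prod
    (f.comp (ContinuousLinearMap.fst ℝ _ _))

theorem modelI_apply (f : ModelMetric m) (k : ℝ) (X : ExtModel m) :
    modelI f k X = (k • f.inverse X.2, f X.1) := rfl

/-- The algebraic conditions defining the `(lam, ell)`-twistor fibre. -/
structure IsModelTwistor (lam ell : ℝ) (f : ModelMetric m) (S : EndModel m) : Prop where
  sq : S.comp S = lam • ContinuousLinearMap.id ℝ (ExtModel m)
  split : LinearMap.trace ℝ (ExtModel m) S.toLinearMap = 0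
  skew : ∀ X Y, modelPairing (S X) Y = -modelPairing X (S Y)
  compatible : S.comp (modelI f (-(lam * ell))) = -(modelI f (-(lam * ell))).comp S

/-- The form `b (S I_{-1} X, Y)`. -/
def modelSigForm (f : ModelMetric m) (S : EndModel m) : LinearMap.BilinForm ℝ (ExtModel m) :=
  LinearMap.mk₂ ℝ (fun X Y => modelPairing (S (modelI f (-1) X)) Y)
    (fun X X' Y => by simp [modelPairing]; ring)
    (fun c X Y => by simp [modelPairing]; ring)
    (fun X Y Y' => by simp [modelPairing]; ring)
    (fun c X Y => by simp [modelPairing]; ring)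

/-- The map of `ℝ^m ⊕ (ℝ^m)^*` induced by `k` and its inverse `h`. -/
def extMap (k h : EuclideanSpace ℝ (Fin m) →L[ℝ] EuclideanSpace ℝ (Fin m)) : EndModel m :=
  (k.comp (ContinuousLinearMap.fst ℝ _ _)).prod
    (((ContinuousLinearMap.compL ℝ _ _ ℝ).flip h).comp (ContinuousLinearMap.snd ℝ _ _))

theorem extMap_apply (k h : EuclideanSpace ℝ (Fin m) →L[ℝ] EuclideanSpace ℝ (Fin m))
    (X : ExtModel m) : extMap k h X = (k X.1, X.2.comp h) := rfl

theorem extMap_comp (k h k' h' : EuclideanSpace ℝ (Fin m) →L[ℝ] EuclideanSpace ℝ (Fin m)) :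
    (extMap k h).comp (extMap k' h') = extMap (k.comp k') (h'.comp h) := rfl

theorem extMap_id :
    extMap (ContinuousLinearMap.id ℝ (EuclideanSpace ℝ (Fin m)))
      (ContinuousLinearMap.id ℝ (EuclideanSpace ℝ (Fin m))) = ContinuousLinearMap.id ℝ _ := rfl

theorem contDiff_extMap : ContDiff ℝ ∞
    (fun a : (EuclideanSpace ℝ (Fin m) →L[ℝ] EuclideanSpace ℝ (Fin m)) ×
      (EuclideanSpace ℝ (Fin m) →L[ℝ] EuclideanSpace ℝ (Fin m)) => extMap a.1 a.2) := by
  have h : (fun a : (EuclideanSpace ℝ (Fin m) →L[ℝ] EuclideanSpace ℝ (Fin m)) ×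
      (EuclideanSpace ℝ (Fin m) →L[ℝ] EuclideanSpace ℝ (Fin m)) => extMap a.1 a.2) = fun a =>
      (ContinuousLinearMap.inl ℝ (EuclideanSpace ℝ (Fin m))
        (EuclideanSpace ℝ (Fin m) →L[ℝ] ℝ)).comp (a.1.comp (ContinuousLinearMap.fst ℝ _ _)) +
      (ContinuousLinearMap.inr ℝ (EuclideanSpace ℝ (Fin m)) (EuclideanSpace ℝ (Fin m) →L[ℝ] ℝ)).comp
        (((ContinuousLinearMap.compL ℝ (EuclideanSpace ℝ (Fin m)) (EuclideanSpace ℝ (Fin m))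
          ℝ).flip a.2).comp (ContinuousLinearMap.snd ℝ _ _)) := by
    funext a
    refine ContinuousLinearMap.ext fun X => Prod.ext ?_ ?_
    · exact (add_zero _).symm
    · exact (zero_add _).symm
  rw [h]
  fun_prop

/-- `H` is an isometry from `f₁` to `f₀` with inverse `H'`. -/
structure IsFrame (f₁ f₀ : ModelMetric m)
    (H H' : EuclideanSpace ℝ (Fin m) →L[ℝ] EuclideanSpace ℝ (Fin m)) : Prop where
  right_inv : H.comp H' = ContinuousLinearMap.id ℝ _
  left_inv : H'.comp H = ContinuousLinearMap.id ℝ _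
  isometry : ∀ v w, f₀ (H v) (H w) = f₁ v w

namespace IsFrame

variable {f₁ f₀ : ModelMetric m} {H H' : EuclideanSpace ℝ (Fin m) →L[ℝ] EuclideanSpace ℝ (Fin m)}
  (h : IsFrame f₁ f₀ H H')

include h

theorem apply_right (v : EuclideanSpace ℝ (Fin m)) : H (H' v) = v := DFunLike.congr_fun h.right_inv v

theorem apply_left (v : EuclideanSpace ℝ (Fin m)) : H' (H v) = v := DFunLike.congr_fun h.left_inv v

theorem symm : IsFrame f₀ f₁ H' H :=
  ⟨h.left_inv, h.right_inv, fun v w => by rw [← h.isometry, h.apply_right, h.apply_right]⟩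

theorem extMap_comp_symm :
    (extMap H H').comp (extMap H' H) = ContinuousLinearMap.id ℝ (ExtModel m) := by
  rw [extMap_comp, h.right_inv, extMap_id]

theorem extMap_apply_symm (X : ExtModel m) : extMap H H' (extMap H' H X) = X :=
  DFunLike.congr_fun h.extMap_comp_symm X

theorem isMetric (hf : f₀.IsMetric) : f₁.IsMetric := by
  refine ⟨fun v w => ?_, fun v hv => ?_⟩
  · rw [← h.isometry, ← h.isometry, hf.symm]
  · have h1 : H v = 0 := hf.nondegenerate _ fun w => by
      rw [← h.apply_right w, h.isometry, hv]
    rw [← h.apply_left v, h1, map_zero]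

theorem modelPairing_extMap (X Y : ExtModel m) :
    modelPairing (extMap H H' X) (extMap H H' Y) = modelPairing X Y := by
  simp [modelPairing, extMap_apply, h.apply_left]

theorem extMap_modelI (hf : f₀.IsMetric) (k : ℝ) (X : ExtModel m) :
    extMap H H' (modelI f₁ k X) = modelI f₀ k (extMap H H' X) := by
  rw [modelI_apply, modelI_apply, extMap_apply, extMap_apply]
  refine Prod.ext ?_ ?_
  · simp only [map_smul]
    congr 1
    apply hf.injective
    rw [hf.apply_inverse]
    ext w
    rw [← h.apply_right w, h.isometry, (h.isMetric hf).apply_inverse]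
    simp [h.apply_left]
  · ext w
    simp only [ContinuousLinearMap.comp_apply]
    rw [← h.isometry, h.apply_right]

theorem isModelTwistor (hf : f₀.IsMetric) {lam ell : ℝ} {S : EndModel m}
    (hS : IsModelTwistor lam ell f₁ S) :
    IsModelTwistor lam ell f₀ ((extMap H H').comp (S.comp (extMap H' H))) := by
  have hI := h.symm.extMap_modelI (h.isMetric hf)
  refine ⟨?_, ?_, fun X Y => ?_, ?_⟩
  · refine ContinuousLinearMap.ext fun X => ?_
    have h1 := DFunLike.congr_fun hS.sq (extMap H' H X)
    simp only [ContinuousLinearMap.comp_apply] at h1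
    simp only [ContinuousLinearMap.comp_apply, h.symm.extMap_apply_symm, h1]
    simp [h.extMap_apply_symm]
  · have h1 := hS.split
    have h2 : ((extMap H H').comp (S.comp (extMap H' H))).toLinearMap =
      (extMap H H').toLinearMap * (S.toLinearMap * (extMap H' H).toLinearMap) := rfl
    have h3 : (extMap H' H).toLinearMap * (extMap H H').toLinearMap = 1 := by
      refine LinearMap.ext fun X => ?_
      exact h.symm.extMap_apply_symm X
    rw [h2, LinearMap.trace_mul_comm, mul_assoc, h3, mul_one, h1]
  · have h1 := hS.skew (extMap H' H X) (extMap H' H Y)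
    rw [← h.modelPairing_extMap, ← h.modelPairing_extMap (extMap H' H X), h.extMap_apply_symm,
      h.extMap_apply_symm] at h1
    exact h1
  · refine ContinuousLinearMap.ext fun X => ?_
    have h1 := DFunLike.congr_fun hS.compatible (extMap H' H X)
    simp only [ContinuousLinearMap.comp_apply, neg_apply] at h1
    simp only [ContinuousLinearMap.comp_apply, neg_apply, hI _ _, h1, map_neg]
    rw [h.extMap_modelI hf]

theorem hasSignature_modelSigForm (hf : f₀.IsMetric) {S : EndModel m} {a b : ℕ}
    (hS : HasSignature (modelSigForm f₁ S) a b) :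
    HasSignature (modelSigForm f₀ ((extMap H H').comp (S.comp (extMap H' H)))) a b := by
  refine hasSignature_congr (LinearEquiv.ofLinearMap (extMap H H').toLinearMap
    (extMap H' H).toLinearMap ?_ ?_) (fun X => ?_) hS
  · refine LinearMap.ext fun X => ?_
    exact h.extMap_apply_symm X
  · refine LinearMap.ext fun X => ?_
    exact h.symm.extMap_apply_symm X
  · change modelPairing (extMap H H' (S (extMap H' H (modelI f₀ (-1) (extMap H H' X)))))
      (extMap H H' X) = modelPairing (S (modelI f₁ (-1) X)) X
    rw [h.modelPairing_extMap, h.symm.extMap_modelI (h.isMetric hf), h.symm.extMap_apply_symm]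

end IsFrame

end Model

end

noncomputable section

/-! ### Local frames -/

section Frames

variable {m : ℕ} {M : Type*} [TopologicalSpace M] [ChartedSpace (EuclideanSpace ℝ (Fin m)) M]
  [IsManifold (𝓡 m) ∞ M]

set_option synthInstance.maxHeartbeats 400000 in
instance ExtTangent.isTopologicalAddGroup (x : M) : IsTopologicalAddGroup (ExtTangent m x) :=
  inferInstance

set_option synthInstance.maxHeartbeats 400000 in
instance ExtTangent.continuousSMul (x : M) : ContinuousSMul ℝ (ExtTangent m x) := inferInstance

set_option synthInstance.maxHeartbeats 400000 in
instance ExtTangent.vectorBundle : VectorBundle ℝ (ExtModel m) (fun x : M => ExtTangent m x) :=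
  inferInstance

set_option synthInstance.maxHeartbeats 400000 in
instance ExtTangent.continuousAdd (x : M) : ContinuousAdd (ExtTangent m x) := inferInstance

instance EndExt.vectorBundle : VectorBundle ℝ (EndModel m) (fun x : M => EndExt m x) :=
  inferInstance

instance EndExt.contMDiffVectorBundle :
    ContMDiffVectorBundle ∞ (EndModel m) (fun x : M => EndExt m x) (𝓡 m) :=
  inferInstance

/-- The trivialization of the tangent bundle at `x₀`, in the fibre over `x`. -/
def tangentCoord (x₀ x : M) : EuclideanSpace ℝ (Fin m) →L[ℝ] EuclideanSpace ℝ (Fin m) :=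
  (trivializationAt (EuclideanSpace ℝ (Fin m)) (TangentSpace (𝓡 m)) x₀).continuousLinearMapAt ℝ x

/-- The inverse of `tangentCoord`. -/
def tangentCoordSymm (x₀ x : M) : EuclideanSpace ℝ (Fin m) →L[ℝ] EuclideanSpace ℝ (Fin m) :=
  (trivializationAt (EuclideanSpace ℝ (Fin m)) (TangentSpace (𝓡 m)) x₀).symmL ℝ x

/-- The domain of the trivializations at `x₀`. -/
def tangentBase (x₀ : M) : Set M :=
  (trivializationAt (EuclideanSpace ℝ (Fin m)) (TangentSpace (𝓡 m)) x₀).baseSet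

theorem isOpen_tangentBase (x₀ : M) : IsOpen (tangentBase (m := m) x₀) :=
  (trivializationAt (EuclideanSpace ℝ (Fin m)) (TangentSpace (𝓡 m)) x₀).open_baseSet

theorem mem_tangentBase (x₀ : M) : x₀ ∈ tangentBase (m := m) x₀ :=
  FiberBundle.mem_baseSet_trivializationAt' x₀

theorem tangentCoord_comp_symm {x₀ x : M} (hx : x ∈ tangentBase (m := m) x₀) :
    (tangentCoord x₀ x).comp (tangentCoordSymm (m := m) x₀ x) = ContinuousLinearMap.id ℝ _ :=
  ContinuousLinearMap.ext fun v => Trivialization.continuousLinearMapAt_symmL _ hx v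

theorem tangentCoordSymm_comp {x₀ x : M} (hx : x ∈ tangentBase (m := m) x₀) :
    (tangentCoordSymm x₀ x).comp (tangentCoord (m := m) x₀ x) = ContinuousLinearMap.id ℝ _ :=
  ContinuousLinearMap.ext fun v => Trivialization.symmL_continuousLinearMapAt _ hx v

/-- The metric at `x` as a bilinear form on `ℝ^m`, with `T_x M` identified with `ℝ^m`. -/
def PseudoRiemannianMetric.model (g : PseudoRiemannianMetric m M) (x : M) : ModelMetric m :=
  g.flat x

/-- The metric at `x` in the trivialization at `x₀`. -/
def PseudoRiemannianMetric.coord (g : PseudoRiemannianMetric m M) (x₀ x : M) : ModelMetric m :=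
  (trivializationAt (EuclideanSpace ℝ (Fin m) →L[ℝ] EuclideanSpace ℝ (Fin m) →L[ℝ] ℝ)
    (fun x : M => TangentSpace (𝓡 m) x →L[ℝ] (TangentSpace (𝓡 m) x →L[ℝ] Trivial M ℝ x)) x₀
    ⟨x, g.flat x⟩).2

theorem PseudoRiemannianMetric.isMetric_model (g : PseudoRiemannianMetric m M) (x : M) :
    (g.model x).IsMetric :=
  ⟨g.symm x, g.nondegenerate x⟩

theorem PseudoRiemannianMetric.contMDiffOn_coord (g : PseudoRiemannianMetric m M) (x₀ : M) :
    ContMDiffOn (𝓡 m) 𝓘(ℝ, ModelMetric m) ∞ (g.coord x₀) (tangentBase (m := m) x₀) := by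
  have h := (Trivialization.contMDiffOn_section_baseSet_iff (IB := 𝓡 m) (n := ∞)
    (s := g.flat) (trivializationAt (EuclideanSpace ℝ (Fin m) →L[ℝ] EuclideanSpace ℝ (Fin m) →L[ℝ] ℝ)
    (fun x : M => TangentSpace (𝓡 m) x →L[ℝ] (TangentSpace (𝓡 m) x →L[ℝ] Trivial M ℝ x)) x₀)).1
    g.contMDiff.contMDiffOn
  refine h.mono fun x hx => ?_
  rw [hom_trivializationAt_baseSet, hom_trivializationAt_baseSet]
  exact ⟨hx, hx, Set.mem_univ _⟩

theorem tangentCoordSymm_apply {x₀ x : M} (hx : x ∈ tangentBase (m := m) x₀)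
    (v : EuclideanSpace ℝ (Fin m)) : tangentCoordSymm x₀ x v =
      (trivializationAt (EuclideanSpace ℝ (Fin m)) (TangentSpace (𝓡 m)) x₀).symm x v :=
  Trivialization.symmL_apply _ hx v

theorem PseudoRiemannianMetric.coord_apply (g : PseudoRiemannianMetric m M) {x₀ x : M}
    (hx : x ∈ tangentBase (m := m) x₀) (v w : EuclideanSpace ℝ (Fin m)) :
    g.coord x₀ x v w = g.model x (tangentCoordSymm x₀ x v) (tangentCoordSymm x₀ x w) := by
  have h := inCoordinates_apply_eq₂ (ϕ := g.flat x) (v := v) (w := w) hx hx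
    (x₀ := x₀) (E₃ := Trivial M ℝ) (F₃ := ℝ) (Set.mem_univ _)
  rw [PseudoRiemannianMetric.coord, hom_trivializationAt_apply]
  refine h.trans ?_
  rw [Trivialization.coe_linearMapAt_of_mem _ (Set.mem_univ _), tangentCoordSymm_apply hx,
    tangentCoordSymm_apply hx]
  rfl

theorem PseudoRiemannianMetric.isFrame_coord (g : PseudoRiemannianMetric m M) {x₀ x : M}
    (hx : x ∈ tangentBase (m := m) x₀) :
    IsFrame (g.coord x₀ x) (g.model x) (tangentCoordSymm x₀ x) (tangentCoord x₀ x) :=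
  ⟨tangentCoordSymm_comp hx, tangentCoord_comp_symm hx, fun v w => (g.coord_apply hx v w).symm⟩

/-- The bundle of covectors is trivialized contragrediently, by precomposition with the inverse
tangent trivialization, which is how `extMap` acts on the second summand. -/
theorem extTangent_trivializationAt {x₀ x : M} (hx : x ∈ tangentBase (m := m) x₀)
    (X : ExtTangent m x) :
    (trivializationAt (ExtModel m) (fun x : M => ExtTangent m x) x₀).continuousLinearMapAt ℝ x X =
      extMap (tangentCoord x₀ x) (tangentCoordSymm x₀ x) X := by
  have hb : x ∈ (trivializationAt (ExtModel m) (fun x : M => ExtTangent m x) x₀).baseSet := by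
    refine ⟨hx, ?_⟩
    rw [hom_trivializationAt_baseSet]
    exact ⟨hx, Set.mem_univ _⟩
  rw [Trivialization.continuousLinearMapAt_apply, Trivialization.coe_linearMapAt_of_mem _ hb]
  have h1 : (trivializationAt (EuclideanSpace ℝ (Fin m)) (TangentSpace (𝓡 m)) x₀ ⟨x, X.1⟩).2 =
      tangentCoord x₀ x X.1 := by
    exact (congrFun (Trivialization.coe_linearMapAt_of_mem (R := ℝ) (trivializationAt
      (EuclideanSpace ℝ (Fin m)) (TangentSpace (𝓡 m) (M := M)) x₀) hx) X.1).symm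
  refine Prod.ext h1 ?_
  change (trivializationAt (EuclideanSpace ℝ (Fin m) →L[ℝ] ℝ)
    (fun x : M => TangentSpace (𝓡 m) x →L[ℝ] Trivial M ℝ x) x₀ ⟨x, X.2⟩).2 = _
  rw [hom_trivializationAt_apply]
  refine ContinuousLinearMap.ext fun v => ?_
  change (Trivialization.continuousLinearMapAt ℝ (trivializationAt ℝ (Trivial M ℝ) x₀) x)
    (X.2 (tangentCoordSymm x₀ x v)) = X.2 (tangentCoordSymm x₀ x v)
  rw [Trivialization.continuousLinearMapAt_apply,
    Trivialization.coe_linearMapAt_of_mem _ (Set.mem_univ _)]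
  rfl

/-- The trivialization of the endomorphism bundle at `x₀`. -/
abbrev endTriv (x₀ : M) : Trivialization (EndModel m) (TotalSpace.proj : EndTotal m M → M) :=
  trivializationAt (EndModel m) (fun x : M => EndExt m x) x₀

theorem endTriv_baseSet (x₀ : M) : (endTriv (m := m) x₀).baseSet = tangentBase (m := m) x₀ := by
  have h : (trivializationAt (ExtModel m) (fun x : M => ExtTangent m x) x₀).baseSet =
      tangentBase (m := m) x₀ := by
    refine Set.Subset.antisymm (fun x hx => hx.1) fun x hx => ⟨hx, ?_⟩
    rw [hom_trivializationAt_baseSet]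
    exact ⟨hx, Set.mem_univ _⟩
  rw [endTriv, hom_trivializationAt_baseSet, h, Set.inter_self]

theorem endTriv_apply {x₀ x : M} (hx : x ∈ tangentBase (m := m) x₀) (S : EndExt m x) :
    (endTriv x₀ (TotalSpace.mk' (EndModel m) x S)).2 =
      (extMap (tangentCoord x₀ x) (tangentCoordSymm x₀ x)).comp
        (ContinuousLinearMap.comp (show EndModel m from S)
          (extMap (tangentCoordSymm x₀ x) (tangentCoord x₀ x))) := by
  rw [endTriv, hom_trivializationAt_apply]
  refine ContinuousLinearMap.ext fun X => ?_
  have hb : x ∈ (trivializationAt (ExtModel m) (fun x : M => ExtTangent m x) x₀).baseSet := by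
    have h := hx
    rw [← endTriv_baseSet, endTriv, hom_trivializationAt_baseSet] at h
    exact h.1
  have h1 : (trivializationAt (ExtModel m) (fun x : M => ExtTangent m x) x₀).symmL ℝ x X =
      extMap (tangentCoordSymm x₀ x) (tangentCoord x₀ x) X := by
    conv_rhs => rw [← Trivialization.continuousLinearMapAt_symmL (R := ℝ)
      (trivializationAt (ExtModel m) (fun x : M => ExtTangent m x) x₀) hb X]
    rw [extTangent_trivializationAt hx]
    have h2 := DFunLike.congr_fun (extMap_comp (tangentCoordSymm x₀ x) (tangentCoord x₀ x)
      (tangentCoord x₀ x) (tangentCoordSymm x₀ x))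
      ((trivializationAt (ExtModel m) (fun x : M => ExtTangent m x) x₀).symmL ℝ x X)
    rw [tangentCoordSymm_comp hx, extMap_id] at h2
    exact h2.symm
  have h3 := extTangent_trivializationAt hx (S ((trivializationAt (ExtModel m)
    (fun x : M => ExtTangent m x) x₀).symmL ℝ x X))
  refine h3.trans ?_
  rw [h1]
  rfl

end Frames

end

noncomputable section

/-! ### Families of endomorphisms defined by the metric -/

section NaturalFamily

variable {m : ℕ}

set_option synthInstance.maxHeartbeats 400000 in
instance EndModel.addCommGroup : AddCommGroup (EndModel m) := inferInstance

set_option synthInstance.maxHeartbeats 400000 in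
instance EndModel.normedAddCommGroup : NormedAddCommGroup (EndModel m) := inferInstance

set_option synthInstance.maxHeartbeats 400000 in
instance EndModel.normedSpace : NormedSpace ℝ (EndModel m) := inferInstance

set_option synthInstance.maxHeartbeats 400000 in
instance EndModel.finiteDimensional : FiniteDimensional ℝ (EndModel m) := inferInstance

/-- The conjugation of endomorphisms of `ℝ^m ⊕ (ℝ^m)^*` by the map induced by `k`, where `h` is the
inverse of `k`. -/
def extConj (k h : EuclideanSpace ℝ (Fin m) →L[ℝ] EuclideanSpace ℝ (Fin m)) (S : EndModel m) :
    EndModel m :=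
  (extMap k h).comp (S.comp (extMap h k))

theorem extConj_extConj (k h k' h' : EuclideanSpace ℝ (Fin m) →L[ℝ] EuclideanSpace ℝ (Fin m))
    (S : EndModel m) : extConj k h (extConj k' h' S) = extConj (k.comp k') (h'.comp h) S := rfl

theorem extConj_id (S : EndModel m) :
    extConj (ContinuousLinearMap.id ℝ _) (ContinuousLinearMap.id ℝ _) S = S := rfl

theorem contDiff_extConj : ContDiff ℝ ∞
    (fun a : ((EuclideanSpace ℝ (Fin m) →L[ℝ] EuclideanSpace ℝ (Fin m)) ×
      (EuclideanSpace ℝ (Fin m) →L[ℝ] EuclideanSpace ℝ (Fin m))) × EndModel m =>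
      extConj a.1.1 a.1.2 a.2) := by
  have h1 : ContDiff ℝ ∞ (fun a : ((EuclideanSpace ℝ (Fin m) →L[ℝ] EuclideanSpace ℝ (Fin m)) ×
      (EuclideanSpace ℝ (Fin m) →L[ℝ] EuclideanSpace ℝ (Fin m))) × EndModel m =>
      extMap a.1.1 a.1.2) := contDiff_extMap.comp contDiff_fst
  have h2 : ContDiff ℝ ∞ (fun a : ((EuclideanSpace ℝ (Fin m) →L[ℝ] EuclideanSpace ℝ (Fin m)) ×
      (EuclideanSpace ℝ (Fin m) →L[ℝ] EuclideanSpace ℝ (Fin m))) × EndModel m =>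
      extMap a.1.2 a.1.1) :=
    contDiff_extMap.comp (f := fun a : ((EuclideanSpace ℝ (Fin m) →L[ℝ]
      EuclideanSpace ℝ (Fin m)) × (EuclideanSpace ℝ (Fin m) →L[ℝ] EuclideanSpace ℝ (Fin m))) ×
      EndModel m => (a.1.2, a.1.1)) (by fun_prop)
  exact h1.clm_comp (contDiff_snd.clm_comp h2)

/-- A condition on endomorphisms of `ℝ^m ⊕ (ℝ^m)^*` which depends on a metric and is invariant under
isometries. -/
def IsNaturalFamily (Q : ModelMetric m → EndModel m → Prop) : Prop :=
  ∀ {f₁ f₀ : ModelMetric m} {H H' : EuclideanSpace ℝ (Fin m) →L[ℝ] EuclideanSpace ℝ (Fin m)},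
    IsFrame f₁ f₀ H H' → f₀.IsMetric → ∀ {S}, Q f₁ S → Q f₀ (extConj H H' S)

theorem isNaturalFamily_isModelTwistor (lam ell : ℝ) :
    IsNaturalFamily (m := m) (IsModelTwistor lam ell) :=
  fun h hf _ hS => h.isModelTwistor hf hS

theorem isNaturalFamily_isModelTwistor_sig (a b : ℕ) :
    IsNaturalFamily (m := m) fun f S => IsModelTwistor 1 1 f S ∧
      HasSignature (modelSigForm f S) a b :=
  fun h hf _ hS => ⟨h.isModelTwistor hf hS.1, h.hasSignature_modelSigForm hf hS.2⟩

variable {M : Type*} [TopologicalSpace M] [ChartedSpace (EuclideanSpace ℝ (Fin m)) M]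
  [IsManifold (𝓡 m) ∞ M]

theorem PseudoRiemannianMetric.isMetric_coord (g : PseudoRiemannianMetric m M) {x₀ x : M}
    (hx : x ∈ tangentBase (m := m) x₀) : (g.coord x₀ x).IsMetric :=
  (g.isFrame_coord hx).isMetric (g.isMetric_model x)

/-- The trivialization conjugates by an isometry from the metric at the point to its coordinate
expression, so an isometry-invariant condition can be read off in coordinates. -/
theorem IsNaturalFamily.endTriv_iff {Q : ModelMetric m → EndModel m → Prop}
    (hQ : IsNaturalFamily Q) (g : PseudoRiemannianMetric m M) {x₀ : M} (z : EndTotal m M)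
    (hz : z.proj ∈ tangentBase (m := m) x₀) :
    Q (g.model z.proj) z.snd ↔ Q (g.coord x₀ z.proj) (endTriv (m := m) x₀ z).2 := by
  have h := endTriv_apply hz z.snd
  have hF := g.isFrame_coord hz
  change (endTriv (m := m) x₀ z).2 = extConj (tangentCoord x₀ z.proj) (tangentCoordSymm x₀ z.proj)
    z.snd at h
  rw [h]
  refine ⟨fun h1 => hQ hF.symm (g.isMetric_coord hz) h1, fun h1 => ?_⟩
  have h2 := hQ hF (g.isMetric_model _) h1
  have h3 : ∀ S : EndModel m, extConj (tangentCoordSymm x₀ z.proj) (tangentCoord x₀ z.proj)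
      (extConj (tangentCoord x₀ z.proj) (tangentCoordSymm x₀ z.proj) S) = S := fun S => by
    rw [extConj_extConj, hF.right_inv, extConj_id]
  exact (congrArg (Q _) (h3 z.snd)).mp h2

theorem contMDiffOn_endTriv_conj {x₀ : M} {U : Set M} (hU : U ⊆ tangentBase (m := m) x₀)
    {φ ψ : M → EuclideanSpace ℝ (Fin m) →L[ℝ] EuclideanSpace ℝ (Fin m)}
    (hφ : ContMDiffOn (𝓡 m) 𝓘(ℝ, EuclideanSpace ℝ (Fin m) →L[ℝ] EuclideanSpace ℝ (Fin m)) ∞ φ U)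
    (hψ : ContMDiffOn (𝓡 m) 𝓘(ℝ, EuclideanSpace ℝ (Fin m) →L[ℝ] EuclideanSpace ℝ (Fin m)) ∞ ψ U) :
    ContMDiffOn ((𝓡 m).prod 𝓘(ℝ, EndModel m)) 𝓘(ℝ, EndModel m) ∞
      (fun z : EndTotal m M => extConj (φ z.proj) (ψ z.proj) (endTriv (m := m) x₀ z).2)
      (TotalSpace.proj ⁻¹' U) := by
  have h1 : ContMDiffOn ((𝓡 m).prod 𝓘(ℝ, EndModel m)) ((𝓡 m).prod 𝓘(ℝ, EndModel m)) ∞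
      (endTriv (m := m) (M := M) x₀) (TotalSpace.proj ⁻¹' U) :=
    (Trivialization.contMDiffOn (IB := 𝓡 m) (n := ∞) (endTriv (m := m) (M := M) x₀)).mono fun z hz => by
      rw [Trivialization.mem_source, endTriv_baseSet]
      exact hU hz
  have h2 : ContMDiffOn ((𝓡 m).prod 𝓘(ℝ, EndModel m)) 𝓘(ℝ, EndModel m) ∞
      (fun z : EndTotal m M => (endTriv (m := m) x₀ z).2) (TotalSpace.proj ⁻¹' U) :=
    contMDiff_snd.comp_contMDiffOn h1
  have hpr : ContMDiffOn ((𝓡 m).prod 𝓘(ℝ, EndModel m)) (𝓡 m) ∞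
      (TotalSpace.proj : EndTotal m M → M) (TotalSpace.proj ⁻¹' U) :=
    (contMDiff_proj (fun x : M => EndExt m x)).contMDiffOn
  have h3 := (((hφ.comp hpr fun z hz => hz).prodMk_space
    (hψ.comp hpr fun z hz => hz)).prodMk_space h2)
  exact contDiff_extConj.contMDiff.comp_contMDiffOn h3

theorem contMDiffOn_endTriv_symm_conj {x₀ : M} {U : Set M} (hU : U ⊆ tangentBase (m := m) x₀)
    {φ ψ : M → EuclideanSpace ℝ (Fin m) →L[ℝ] EuclideanSpace ℝ (Fin m)}
    (hφ : ContMDiffOn (𝓡 m) 𝓘(ℝ, EuclideanSpace ℝ (Fin m) →L[ℝ] EuclideanSpace ℝ (Fin m)) ∞ φ U)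
    (hψ : ContMDiffOn (𝓡 m) 𝓘(ℝ, EuclideanSpace ℝ (Fin m) →L[ℝ] EuclideanSpace ℝ (Fin m)) ∞ ψ U)
    {W : Type*} [NormedAddCommGroup W] [NormedSpace ℝ W] (R : W →L[ℝ] EndModel m) :
    ContMDiffOn ((𝓡 m).prod 𝓘(ℝ, W)) ((𝓡 m).prod 𝓘(ℝ, EndModel m)) ∞
      (fun a : M × W => (endTriv (m := m) x₀).toOpenPartialHomeomorph.symm
        (a.1, extConj (φ a.1) (ψ a.1) (R a.2))) (U ×ˢ Set.univ) := by
  have h1 : ContMDiffOn ((𝓡 m).prod 𝓘(ℝ, W)) (𝓡 m) ∞ (Prod.fst : M × W → M)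
    (U ×ˢ Set.univ) := contMDiff_fst.contMDiffOn
  have h2 : ContMDiffOn ((𝓡 m).prod 𝓘(ℝ, W)) 𝓘(ℝ, EndModel m) ∞ (fun a : M × W => R a.2)
    (U ×ˢ Set.univ) := (R.contDiff.contMDiff.comp contMDiff_snd).contMDiffOn
  have h3 := (((hφ.comp h1 fun z hz => hz.1).prodMk_space
    (hψ.comp h1 fun z hz => hz.1)).prodMk_space h2)
  have h4 := contDiff_extConj.contMDiff.comp_contMDiffOn h3
  exact (Trivialization.contMDiffOn_symm (IB := 𝓡 m) (n := ∞) (endTriv (m := m) (M := M) x₀)).comp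
    (h1.prodMk h4) fun a ha => by
      refine (Trivialization.mem_target (endTriv (m := m) (M := M) x₀)).2 ?_
      rw [endTriv_baseSet]
      exact hU ha.1

/-- The frame `φ = h (g.coord x₀ x)` carries the metric at nearby points to its value `f₀` at `x₀`.
After conjugation by it the condition `Q` no longer varies, so the linear coordinates `P` and `R`
are needed for `f₀` only. -/
theorem IsNaturalFamily.exists_localProduct {Q : ModelMetric m → EndModel m → Prop}
    (hQ : IsNaturalFamily Q) (g : PseudoRiemannianMetric m M) {Z : Set (EndTotal m M)}
    (hZ : ∀ z, z ∈ Z ↔ Q (g.model z.proj) z.snd) (x₀ : M) {W : Type*} [NormedAddCommGroup W]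
    [NormedSpace ℝ W] (P : EndModel m →L[ℝ] W) (R : W →L[ℝ] EndModel m) {F : Set W}
    (hP : ∀ S, Q (g.coord x₀ x₀) S → P S ∈ F ∧ R (P S) = S)
    (hR : ∀ w ∈ F, Q (g.coord x₀ x₀) (R w) ∧ P (R w) = w) :
    ∃ L : LocalProduct m ((𝓡 m).prod 𝓘(ℝ, EndModel m))
      (TotalSpace.proj : EndTotal m M → M) Z F, x₀ ∈ L.base := by
  set f₀ := g.coord x₀ x₀ with hf₀
  have hmet := g.isMetric_coord (mem_tangentBase (m := m) x₀)
  obtain ⟨h, hh⟩ := exists_contDiffAt_frame f₀ hmet.symm hmet.nondegenerate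
  obtain ⟨O, hO, hOopen, hfO⟩ := eventually_nhds_iff.1 hh
  set U : Set M := tangentBase (m := m) x₀ ∩ g.coord x₀ ⁻¹' O with hU
  have hUopen : IsOpen U :=
    (g.contMDiffOn_coord x₀).continuousOn.isOpen_inter_preimage (isOpen_tangentBase x₀) hOopen
  obtain ⟨φ, hφ⟩ : ∃ φ : M → EuclideanSpace ℝ (Fin m) →L[ℝ] EuclideanSpace ℝ (Fin m),
    φ = fun x => h (g.coord x₀ x) := ⟨_, rfl⟩
  -- The inverse is taken in the ring of endomorphisms, where inversion is smooth at units.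
  obtain ⟨ψ, hψ⟩ : ∃ ψ : M → EuclideanSpace ℝ (Fin m) →L[ℝ] EuclideanSpace ℝ (Fin m),
    ψ = fun x => Ring.inverse (φ x) := ⟨_, rfl⟩
  have hunit : ∀ x ∈ U, IsUnit (φ x) := fun x hx => by
    rw [hφ]
    exact ((hO _ hx.2).2 (g.isMetric_coord hx.1).symm).1
  have hframe : ∀ x ∈ U, IsFrame (g.coord x₀ x) f₀ (φ x) (ψ x) := fun x hx =>
    ⟨by rw [hψ]; exact Ring.mul_inverse_cancel _ (hunit x hx),
      by rw [hψ]; exact Ring.inverse_mul_cancel _ (hunit x hx), by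
      rw [hφ]
      exact ((hO _ hx.2).2 (g.isMetric_coord hx.1).symm).2⟩
  have hφs : ContMDiffOn (𝓡 m)
      𝓘(ℝ, EuclideanSpace ℝ (Fin m) →L[ℝ] EuclideanSpace ℝ (Fin m)) ∞ φ U := by
    rw [hφ]
    intro x hx
    exact ContMDiffAt.comp_contMDiffWithinAt (I' := 𝓘(ℝ, ModelMetric m)) x
      (hO _ hx.2).1.contMDiffAt ((g.contMDiffOn_coord x₀ x hx.1).mono Set.inter_subset_left)
  have hψs : ContMDiffOn (𝓡 m)
      𝓘(ℝ, EuclideanSpace ℝ (Fin m) →L[ℝ] EuclideanSpace ℝ (Fin m)) ∞ ψ U := by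
    rw [hψ]
    intro x hx
    obtain ⟨u, hu⟩ := hunit x hx
    have h1 : ContDiffAt ℝ ∞ (Ring.inverse : (EuclideanSpace ℝ (Fin m) →L[ℝ]
        EuclideanSpace ℝ (Fin m)) → _) (φ x) := by
      rw [← hu]
      exact contDiffAt_ringInverse ℝ u
    exact ContMDiffAt.comp_contMDiffWithinAt x h1.contMDiffAt (hφs x hx)
  have hmemE : ∀ z : EndTotal m M, z.proj ∈ U → z ∈ (endTriv (m := m) x₀).source := fun z hz => by
    rw [Trivialization.mem_source, endTriv_baseSet]
    exact hz.1
  have hmemT : ∀ x ∈ U, ∀ S : EndModel m, (x, S) ∈ (endTriv (m := m) (M := M) x₀).target :=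
    fun x hx S => by
    rw [Trivialization.mem_target, endTriv_baseSet]
    exact hx.1
  obtain ⟨fwd, hfwd⟩ : ∃ fwd : EndTotal m M → W, fwd = fun z =>
    P (extConj (φ z.proj) (ψ z.proj) (endTriv (m := m) x₀ z).2) := ⟨_, rfl⟩
  obtain ⟨bwd, hbwd⟩ : ∃ bwd : M × W → EndTotal m M, bwd = fun a =>
    (endTriv (m := m) x₀).toOpenPartialHomeomorph.symm (a.1, extConj (ψ a.1) (φ a.1) (R a.2)) := ⟨_, rfl⟩
  have hpr : ∀ x ∈ U, ∀ w, (bwd (x, w)).proj = x := fun x hx w => by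
    rw [hbwd]
    exact (endTriv (m := m) x₀).proj_symm_apply (hmemT x hx _)
  have hap : ∀ x ∈ U, ∀ w, (endTriv (m := m) x₀ (bwd (x, w))).2 = extConj (ψ x) (φ x) (R w) :=
    fun x hx w => by
      rw [hbwd]
      exact congrArg Prod.snd ((endTriv (m := m) x₀).apply_symm_apply (hmemT x hx _))
  have hPz : ∀ z ∈ Z, z.proj ∈ U → fwd z ∈ F ∧
      R (fwd z) = extConj (φ z.proj) (ψ z.proj) (endTriv (m := m) x₀ z).2 := fun z hz hzU => by
    rw [hfwd]
    exact hP _ (hQ (hframe _ hzU) hmet ((hQ.endTriv_iff g z hzU.1).1 ((hZ z).1 hz)))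
  refine ⟨{
    base := U
    isOpen_base := hUopen
    fwd := fwd
    bwd := bwd
    contMDiffOn_fwd := ?_
    contMDiffOn_bwd := ?_
    proj_bwd := hpr
    fwd_mem := fun z hz hzU => (hPz z hz hzU).1
    bwd_fwd := fun z hz hzU => ?_
    bwd_mem := fun x hx w hw => ?_
    fwd_bwd := fun x hx w hw => ?_ }, mem_tangentBase x₀, hfO⟩
  · rw [hfwd]
    exact P.contDiff.contMDiff.comp_contMDiffOn
      (contMDiffOn_endTriv_conj Set.inter_subset_left hφs hψs)
  · rw [hbwd]
    exact contMDiffOn_endTriv_symm_conj Set.inter_subset_left hψs hφs R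
  · have h1 : bwd (z.proj, fwd z) = (endTriv (m := m) x₀).toOpenPartialHomeomorph.symm
        (z.proj, extConj (ψ z.proj) (φ z.proj) (R (fwd z))) := by rw [hbwd]
    rw [h1, (hPz z hz hzU).2, extConj_extConj, (hframe _ hzU).left_inv, extConj_id]
    exact (endTriv (m := m) x₀).symm_apply_mk_proj (hmemE z hzU)
  · rw [hZ, hQ.endTriv_iff g _ (by rw [hpr x hx]; exact hx.1), hpr x hx, hap x hx]
    exact hQ (hframe x hx).symm (g.isMetric_coord hx.1) (hR w hw).1
  · have h1 : fwd (bwd (x, w)) = P (extConj (φ (bwd (x, w)).proj) (ψ (bwd (x, w)).proj)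
      (endTriv (m := m) x₀ (bwd (x, w))).2) := by rw [hfwd]
    rw [h1, hpr x hx, hap x hx, extConj_extConj, (hframe x hx).right_inv, extConj_id]
    exact (hR w hw).2

/-! ### Twistor spaces, integrable structures and signatures in terms of the model conditions -/

theorem mem_twistorSpace_iff (g : PseudoRiemannianMetric m M) (lam ell : ℝ) (z : EndTotal m M) :
    z ∈ twistorSpace g lam ell ↔ IsModelTwistor lam ell (g.model z.proj) z.snd :=
  ⟨fun h => ⟨h.1.sq, h.1.split, h.1.skew, h.2⟩, fun h => ⟨⟨h.sq, h.split, h.skew⟩, h.compatible⟩⟩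

theorem mem_twistorSpaceSig_iff (g : PseudoRiemannianMetric m M) (n : ℕ) (z : EndTotal m M) :
    z ∈ twistorSpaceSig g n ↔ IsModelTwistor 1 1 (g.model z.proj) z.snd ∧
      HasSignature (modelSigForm (g.model z.proj) z.snd) (2 * n) (2 * m - 2 * n) :=
  and_congr (mem_twistorSpace_iff g 1 1 z) Iff.rfl

theorem isIntegrableStructure_iff (g : PseudoRiemannianMetric m M) (lam ell : ℝ)
    (S : ∀ x : M, EndExt m x) : IsIntegrableStructure g lam ell S ↔
      (IsSmoothEndSection S ∧ ∀ x, TotalSpace.mk' (EndModel m) x (S x) ∈ twistorSpace g lam ell) ∧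
        IsCourantInvolutive lam S :=
  ⟨fun h => ⟨⟨h.1.1, fun x => ⟨h.1.2 x, h.2 x⟩⟩, h.1.3⟩,
    fun h => ⟨⟨h.1.1, fun x => (h.1.2 x).1, h.2⟩, fun x => (h.1.2 x).2⟩⟩

theorem isIntegrableStructureSig_iff (g : PseudoRiemannianMetric m M) (n : ℕ)
    (S : ∀ x : M, EndExt m x) : IsIntegrableStructureSig g n S ↔
      (IsSmoothEndSection S ∧ ∀ x, TotalSpace.mk' (EndModel m) x (S x) ∈ twistorSpaceSig g n) ∧
        IsCourantInvolutive 1 S :=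
  ⟨fun h => ⟨⟨h.1.1.1, fun x => ⟨⟨h.1.1.2 x, h.1.2 x⟩, h.2 x⟩⟩, h.1.1.3⟩,
    fun h => ⟨⟨⟨h.1.1, fun x => (h.1.2 x).1.1, h.2⟩, fun x => (h.1.2 x).1.2⟩,
      fun x => (h.1.2 x).2⟩⟩

/-- The bilinear form of a model metric. -/
def ModelMetric.form (f : ModelMetric m) : LinearMap.BilinForm ℝ (EuclideanSpace ℝ (Fin m)) :=
  LinearMap.mk₂ ℝ (fun v w => f v w) (by simp) (by simp) (by simp) (by simp)

/-- The signature of a model metric. -/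
def ModelMetric.HasSig (f : ModelMetric m) (p q : ℕ) : Prop := HasSignature f.form p q

theorem PseudoRiemannianMetric.hasSig_model (g : PseudoRiemannianMetric m M) {p q : ℕ}
    (hg : g.HasSignature p q) (x : M) : (g.model x).HasSig p q := hg x

theorem IsFrame.hasSig {f₁ f₀ : ModelMetric m}
    {H H' : EuclideanSpace ℝ (Fin m) →L[ℝ] EuclideanSpace ℝ (Fin m)} (h : IsFrame f₁ f₀ H H')
    {p q : ℕ} (hf : f₁.HasSig p q) : f₀.HasSig p q :=
  hasSignature_congr (LinearEquiv.ofLinearMap H.toLinearMap H'.toLinearMap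
    (LinearMap.ext h.apply_right) (LinearMap.ext h.apply_left)) (fun v => h.isometry v v) hf

theorem PseudoRiemannianMetric.hasSig_coord (g : PseudoRiemannianMetric m M) {p q : ℕ}
    (hg : g.HasSignature p q) {x₀ x : M} (hx : x ∈ tangentBase (m := m) x₀) :
    (g.coord x₀ x).HasSig p q :=
  (g.isFrame_coord hx).symm.hasSig (g.hasSig_model hg x)

/-- What remains for each case is linear algebra for one fixed metric of the given signature: linear
maps `P` and `R` which identify the model fibre with the orbit. -/
theorem isTwistorBundle_of_model {Γ V W D : Type*} [Group Γ] [TopologicalSpace Γ]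
    [IsTopologicalGroup Γ] [NormedAddCommGroup V] [NormedSpace ℝ V] [NormedAddCommGroup W]
    [NormedSpace ℝ W] [FiniteDimensional ℝ W] [NormedAddCommGroup D] [NormedSpace ℝ D]
    [FiniteDimensional ℝ D] {emb : Γ → V} {H : Subgroup Γ} {orb : Γ → W} (A : OrbitData emb H orb D)
    {Q : ModelMetric m → EndModel m → Prop}
    (hQ : IsNaturalFamily Q) (g : PseudoRiemannianMetric m M) {Z : Set (EndTotal m M)}
    (hZ : ∀ z, z ∈ Z ↔ Q (g.model z.proj) z.snd) {p q : ℕ} (hg : g.HasSignature p q)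
    (hPR : ∀ f₀ : ModelMetric m, f₀.IsMetric → f₀.HasSig p q →
      ∃ (P : EndModel m →ₗ[ℝ] W) (R : W →ₗ[ℝ] EndModel m),
        (∀ S, Q f₀ S → P S ∈ Set.range orb ∧ R (P S) = S) ∧
        ∀ w ∈ Set.range orb, Q f₀ (R w) ∧ P (R w) = w)
    {lam : ℝ} {T : (∀ x : M, EndExt m x) → Prop}
    (hT : ∀ S, T S ↔ (IsSmoothEndSection S ∧ ∀ x, TotalSpace.mk' (EndModel m) x (S x) ∈ Z) ∧
      IsCourantInvolutive lam S) :
    IsTwistorBundle Z emb H lam T := by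
  have hL : ∀ x : M, ∃ L : LocalProduct m ((𝓡 m).prod 𝓘(ℝ, EndModel m))
      (TotalSpace.proj : EndTotal m M → M) Z (Set.range orb), x ∈ L.base := fun x => by
    obtain ⟨P, R, hP, hR⟩ := hPR _ (g.isMetric_coord (mem_tangentBase x))
      (g.hasSig_coord hg (mem_tangentBase x))
    exact hQ.exists_localProduct g hZ x ⟨P, P.continuous_of_finiteDimensional⟩
      ⟨R, R.continuous_of_finiteDimensional⟩ hP hR
  choose L hL using hL
  exact isTwistorBundle_of_localProduct (A.congr (toEuclidean (E := D))) L hL hT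

end NaturalFamily

end

noncomputable section

/-! ### Symmetric spaces of matrix groups -/

/-- A linear involution which reverses products. -/
structure AntiInvolution (R : Type*) [NormedRing R] [NormedAlgebra ℝ R] where
  toLin : R →L[ℝ] R
  map_mul : ∀ a b, toLin (a * b) = toLin b * toLin a
  involutive : ∀ a, toLin (toLin a) = a

namespace AntiInvolution

variable {R : Type*} [NormedRing R] [NormedAlgebra ℝ R]

/-- An anti-involution of a finite-dimensional algebra. -/
def ofLinear [FiniteDimensional ℝ R] (l : R →ₗ[ℝ] R) (hmul : ∀ a b, l (a * b) = l b * l a)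
    (hinv : ∀ a, l (l a) = a) : AntiInvolution R where
  toLin := LinearMap.toContinuousLinearMap l
  map_mul := hmul
  involutive := hinv

variable (θ : AntiInvolution R)

theorem map_one : θ.toLin 1 = 1 := by
  have h := θ.map_mul (θ.toLin 1) 1
  rw [mul_one, θ.involutive, mul_one] at h
  exact h.symm

theorem isUnit {a : R} (ha : IsUnit a) : IsUnit (θ.toLin a) := by
  obtain ⟨u, rfl⟩ := ha
  refine ⟨⟨θ.toLin u, θ.toLin ↑u⁻¹, ?_, ?_⟩, rfl⟩
  · rw [← θ.map_mul, Units.inv_mul, θ.map_one]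
  · rw [← θ.map_mul, Units.mul_inv, θ.map_one]

theorem map_inverse (a : R) : θ.toLin (Ring.inverse a) = Ring.inverse (θ.toLin a) := by
  by_cases ha : IsUnit a
  · have h1 : θ.toLin a * θ.toLin (Ring.inverse a) = 1 := by
      rw [← θ.map_mul, Ring.inverse_mul_cancel _ ha, θ.map_one]
    calc θ.toLin (Ring.inverse a)
        = Ring.inverse (θ.toLin a) * (θ.toLin a * θ.toLin (Ring.inverse a)) := by
          rw [← mul_assoc, Ring.inverse_mul_cancel _ (θ.isUnit ha), one_mul]
      _ = _ := by rw [h1, mul_one]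
  · rw [Ring.inverse_non_unit _ ha, map_zero, Ring.inverse_non_unit]
    intro h
    have h1 := θ.isUnit h
    rw [θ.involutive] at h1
    exact ha h1

end AntiInvolution

/-- The Cayley transform `(1 + a) (1 - a)⁻¹`. -/
def cayley {R : Type*} [Ring R] (a : R) : R := (1 + a) * Ring.inverse (1 - a)

/-- The inverse Cayley transform `(w - 1) (w + 1)⁻¹`. -/
def cayleySymm {R : Type*} [Ring R] (w : R) : R := (w - 1) * Ring.inverse (w + 1)

/-! ### The Cayley transform in a normed algebra -/

section Cayley

variable {R : Type*} [NormedRing R] [NormedAlgebra ℝ R]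

theorem cayley_mul_sub {a : R} (ha : IsUnit (1 - a)) : cayley a * (1 - a) = 1 + a := by
  rw [cayley, mul_assoc, Ring.inverse_mul_cancel _ ha, mul_one]

theorem cayley_cayleySymm {w : R} (hw : IsUnit (w + 1)) : cayley (cayleySymm w) = w := by
  have h2 : IsUnit (2 : R) := by
    have h := (IsUnit.mk0 (2 : ℝ) two_ne_zero).map (algebraMap ℝ R)
    rwa [map_ofNat] at h
  -- With `c = cayleySymm w` the two identities used are `1 - c = 2 (w + 1)⁻¹` and `1 + c = w (1 -
  -- c)`.
  have h1 : 1 - cayleySymm w = 2 * Ring.inverse (w + 1) := by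
    have : (1 : R) = (w + 1) * Ring.inverse (w + 1) := (Ring.mul_inverse_cancel _ hw).symm
    rw [cayleySymm]
    nth_rewrite 1 [this]
    rw [← sub_mul]
    congr 1
    rw [add_sub_sub_cancel]
    exact one_add_one_eq_two
  have hw' : IsUnit (Ring.inverse (w + 1)) := by
    obtain ⟨u, hu⟩ := hw
    rw [← hu, Ring.inverse_unit]
    exact Units.isUnit _
  have h3 : IsUnit (1 - cayleySymm w) := by
    rw [h1]
    exact h2.mul hw'
  have h4 : 1 + cayleySymm w = w * (1 - cayleySymm w) := by
    have h5 : cayleySymm w * (w + 1) = w - 1 := by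
      rw [cayleySymm, mul_assoc, Ring.inverse_mul_cancel _ hw, mul_one]
    have h6 : w * cayleySymm w = cayleySymm w * w := by
      have hc : Commute w (Ring.inverse (w + 1)) := by
        obtain ⟨u, hu⟩ := hw
        rw [← hu, Ring.inverse_unit]
        refine Commute.units_inv_right ?_
        rw [hu]
        exact (Commute.refl w).add_right (Commute.one_right w)
      have hc2 : Commute w (w - 1) := (Commute.refl w).sub_right (Commute.one_right w)
      exact hc2.mul_right hc
    rw [mul_sub, mul_one, h6]
    rw [mul_add, mul_one] at h5
    have h7 : cayleySymm w * w = w - 1 - cayleySymm w := eq_sub_of_add_eq h5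
    rw [h7]
    abel
  rw [cayley, h4, mul_assoc, Ring.mul_inverse_cancel _ h3, mul_one]

theorem cayleySymm_cayley {a : R} (ha : IsUnit (1 - a)) : cayleySymm (cayley a) = a := by
  have h2 : IsUnit (2 : R) := by
    have h := (IsUnit.mk0 (2 : ℝ) two_ne_zero).map (algebraMap ℝ R)
    rwa [map_ofNat] at h
  have h0 := cayley_mul_sub ha
  have h1 : cayley a + 1 = 2 * Ring.inverse (1 - a) := by
    have : (1 : R) = (1 - a) * Ring.inverse (1 - a) := (Ring.mul_inverse_cancel _ ha).symm
    rw [cayley]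
    nth_rewrite 3 [this]
    rw [← add_mul]
    congr 1
    rw [add_add_sub_cancel]
    exact one_add_one_eq_two
  have ha' : IsUnit (Ring.inverse (1 - a)) := by
    obtain ⟨u, hu⟩ := ha
    rw [← hu, Ring.inverse_unit]
    exact Units.isUnit _
  have h3 : IsUnit (cayley a + 1) := by
    rw [h1]
    exact h2.mul ha'
  have hc : Commute a (Ring.inverse (1 - a)) := by
    obtain ⟨u, hu⟩ := ha
    rw [← hu, Ring.inverse_unit]
    refine Commute.units_inv_right ?_
    rw [hu]
    exact (Commute.one_right a).sub_right (Commute.refl a)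
  have h4 : a * cayley a = cayley a * a :=
    ((Commute.one_right a).add_right (Commute.refl a)).mul_right hc
  have h5 : cayley a - 1 = a * (cayley a + 1) := by
    rw [mul_add, mul_one, h4]
    rw [mul_sub, mul_one] at h0
    have h6 : cayley a = 1 + a + cayley a * a := eq_add_of_sub_eq h0
    nth_rewrite 1 [h6]
    abel
  rw [cayleySymm, h5, mul_assoc, Ring.mul_inverse_cancel _ h3, mul_one]

/-- For `b = 2a / (1 + a²)` one has `(1 ± a)² = (1 ± b)(1 + a²)`, and the quotient of the two
identities is the claim. -/
theorem cayley_mul_self {a b : R} (ha : IsUnit (1 - a)) (hb : IsUnit (1 - b))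
    (hu : IsUnit (1 + a * a)) (hab : 2 * a * Ring.inverse (1 + a * a) = b) :
    cayley a * cayley a = cayley b := by
  have h1 : b * (1 + a * a) = 2 * a := by
    rw [← hab, mul_assoc, Ring.inverse_mul_cancel _ hu, mul_one]
  have h0 := cayley_mul_sub ha
  have hc : Commute (1 - a) (1 + a) :=
    ((Commute.one_right _).add_right (((Commute.one_left a).sub_left (Commute.refl a))))
  have h2 : cayley a * cayley a * ((1 - a) * (1 - a)) = (1 + a) * (1 + a) := by
    calc _ = cayley a * (cayley a * (1 - a)) * (1 - a) := by simp only [mul_assoc]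
      _ = cayley a * ((1 - a) * (1 + a)) := by rw [h0, mul_assoc, hc.eq]
      _ = _ := by rw [← mul_assoc, h0]
  have h3 : (1 - a) * (1 - a) = (1 - b) * (1 + a * a) := by
    rw [sub_mul 1 b, h1]
    noncomm_ring
  have h4 : (1 + a) * (1 + a) = (1 + b) * (1 + a * a) := by
    rw [add_mul 1 b, h1]
    noncomm_ring
  have h5 : cayley a * cayley a * (1 - b) = 1 + b := by
    have h6 : cayley a * cayley a * (1 - b) * (1 + a * a) = (1 + b) * (1 + a * a) := by
      rw [mul_assoc, ← h3, h2, h4]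
    exact hu.mul_right_cancel h6
  rw [cayley.eq_1 b, ← h5, mul_assoc, Ring.mul_inverse_cancel _ hb, mul_one]

theorem AntiInvolution.map_cayley (θ : AntiInvolution R) {a : R} (ha : IsUnit (1 - a)) :
    θ.toLin (cayley a) = cayley (θ.toLin a) := by
  have hc : Commute (1 + θ.toLin a) (Ring.inverse (1 - θ.toLin a)) := by
    obtain ⟨u, hu⟩ := θ.isUnit ha
    rw [map_sub, θ.map_one] at hu
    rw [← hu, Ring.inverse_unit]
    refine Commute.units_inv_right ?_
    rw [hu]
    exact ((Commute.one_right _).sub_right ((Commute.one_left _).add_left (Commute.refl _)))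
  rw [cayley, θ.map_mul, θ.map_inverse, map_sub, map_add, θ.map_one, cayley, hc.eq]

theorem cayley_neg_mul {a : R} (ha : IsUnit (1 - a)) (ha' : IsUnit (1 + a)) :
    cayley (-a) * cayley a = 1 := by
  have hc : Commute (1 + a) (Ring.inverse (1 - a)) := by
    obtain ⟨u, hu⟩ := ha
    rw [← hu, Ring.inverse_unit]
    refine Commute.units_inv_right ?_
    rw [hu]
    exact ((Commute.one_right _).sub_right ((Commute.one_left _).add_left (Commute.refl _)))
  rw [cayley, cayley, sub_neg_eq_add, ← sub_eq_add_neg, hc.eq, mul_assoc,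
    ← mul_assoc _ _ (1 + a)]
  have hc2 : Commute (Ring.inverse (1 + a)) (Ring.inverse (1 - a)) := by
    obtain ⟨u, hu⟩ := ha'
    rw [← hu, Ring.inverse_unit]
    refine Commute.units_inv_left ?_
    rw [hu]
    exact hc
  rw [hc2.eq, mul_assoc, Ring.inverse_mul_cancel _ ha', mul_one, Ring.mul_inverse_cancel _ ha]

variable [CompleteSpace R]

theorem eventually_isUnit_one_sub : ∀ᶠ a : R in 𝓝 0, IsUnit (1 - a) := by
  have h : Filter.Tendsto (fun a : R => 1 - a) (𝓝 0) (𝓝 (1 - 0)) :=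
    (continuous_const.sub continuous_id).tendsto 0
  rw [sub_zero] at h
  exact h.eventually (Units.isOpen.mem_nhds isUnit_one)

theorem contDiffAt_cayley {a : R} (ha : IsUnit (1 - a)) :
    ContDiffAt ℝ ∞ (cayley : R → R) a := by
  obtain ⟨u, hu⟩ := ha
  have h1 : ContDiffAt ℝ ∞ (Ring.inverse : R → R) (1 - a) := by
    rw [← hu]
    exact contDiffAt_ringInverse ℝ u
  exact (contDiffAt_const.add contDiffAt_id).mul
    (h1.comp a (contDiffAt_const.sub contDiffAt_id))

theorem contDiffAt_cayleySymm {w : R} (hw : IsUnit (w + 1)) :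
    ContDiffAt ℝ ∞ (cayleySymm : R → R) w := by
  obtain ⟨u, hu⟩ := hw
  have h1 : ContDiffAt ℝ ∞ (Ring.inverse : R → R) (w + 1) := by
    rw [← hu]
    exact contDiffAt_ringInverse ℝ u
  exact (contDiffAt_id.sub contDiffAt_const).mul
    (h1.comp w (contDiffAt_id.add contDiffAt_const))

end Cayley

/-! ### Symmetric orbits and their local sections -/

section SymmetricSpace

variable {R : Type*} [NormedRing R] [NormedAlgebra ℝ R] [FiniteDimensional ℝ R]
  (θ σ : AntiInvolution R)

/-- The tangent space at the base point of the symmetric space. -/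
def symmetricTangent : Submodule ℝ R where
  carrier := {a | θ.toLin a = -a ∧ σ.toLin a = a}
  add_mem' {a b} ha hb := ⟨by rw [map_add, ha.1, hb.1, neg_add], by rw [map_add, ha.2, hb.2]⟩
  zero_mem' := by simp
  smul_mem' c a ha := ⟨by rw [map_smul, ha.1, smul_neg], by rw [map_smul, ha.2]⟩

theorem mul_inverse_mem_symmetricTangent {a : R} (ha : a ∈ symmetricTangent θ σ) :
    a * Ring.inverse (1 + a * a) ∈ symmetricTangent θ σ := by
  have hc : Ring.inverse (1 + a * a) * a = a * Ring.inverse (1 + a * a) := by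
    by_cases hu : IsUnit (1 + a * a)
    · obtain ⟨u, hu⟩ := hu
      rw [← hu, Ring.inverse_unit]
      refine Commute.units_inv_left ?_
      rw [hu]
      exact (Commute.one_left _).add_left ((Commute.refl a).mul_left (Commute.refl a))
    · rw [Ring.inverse_non_unit _ hu, zero_mul, mul_zero]
  refine ⟨?_, ?_⟩
  · rw [θ.map_mul, θ.map_inverse, map_add, θ.map_mul, θ.map_one, ha.1, neg_mul_neg, mul_neg, hc]
  · rw [σ.map_mul, σ.map_inverse, map_add, σ.map_mul, σ.map_one, ha.2, hc]

theorem exists_retraction (N : Submodule ℝ R) : ∃ pr : R →L[ℝ] N, ∀ a : N, pr a = a :=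
  Submodule.ClosedComplemented.of_finiteDimensional N

/-- The homogeneous space of the group of all `a` with `θ a * a = 1` by the subgroup fixed by the
involution `a ↦ θ (σ a)`, as the orbit of `1` under the action `(a, w) ↦ a w (σ a)`. -/
theorem nonempty_orbitData_symmetricSpace {Γ V : Type*} [Group Γ] [TopologicalSpace Γ]
    [NormedAddCommGroup V] [NormedSpace ℝ V] {emb : Γ → V} (hemb : Topology.IsInducing emb)
    (ε' : V ≃ₗ[ℝ] R) (ρ : Γ →* R) (hε' : ∀ a, ε' (emb a) = ρ a)
    (hρ : ∀ r, r ∈ Set.range ρ ↔ θ.toLin r * r = 1)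
    (hcomm : ∀ r, θ.toLin (σ.toLin r) = σ.toLin (θ.toLin r)) {H : Subgroup Γ}
    (hH : ∀ a, a ∈ H ↔ ρ a * σ.toLin (ρ a) = 1) :
    Nonempty (OrbitData emb H (fun a => ρ a * σ.toLin (ρ a)) (symmetricTangent θ σ)) := by
  have : CompleteSpace R := FiniteDimensional.complete ℝ R
  have : FiniteDimensional ℝ V := ε'.symm.finiteDimensional
  obtain ⟨ε, hε⟩ : ∃ ε : V ≃L[ℝ] R, ∀ a, ε (emb a) = ρ a := ⟨ε'.toContinuousLinearEquiv, hε'⟩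
  obtain ⟨pr, hpr⟩ := exists_retraction (symmetricTangent θ σ)
  obtain ⟨G, hG0, hG⟩ := Submodule.exists_contDiffAt_half (symmetricTangent θ σ)
    fun a ha => mul_inverse_mem_symmetricTangent θ σ ha
  have hinv : ∀ a, ρ a * ρ a⁻¹ = 1 := fun a => by rw [← map_mul, mul_inv_cancel, map_one]
  have hinv' : ∀ a, ρ a⁻¹ * ρ a = 1 := fun a => by rw [← map_mul, inv_mul_cancel, map_one]
  have hsinv : ∀ a, σ.toLin (ρ a) * σ.toLin (ρ a⁻¹) = 1 := fun a => by
    rw [← σ.map_mul, hinv', σ.map_one]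
  -- The group element is chosen with image `cayley (G v)`, a square root of `cayley v`. Only `v`
  -- near `0` matter, where this element does lie in the range of `ρ`.
  obtain ⟨param, hparam⟩ : ∃ param : symmetricTangent θ σ → Γ, ∀ v : symmetricTangent θ σ,
      cayley (G v : R) ∈ Set.range ρ → ρ (param v) = cayley (G v : R) :=
    ⟨fun v => Classical.epsilon fun a => ρ a = cayley (G v : R),
      fun v hv => Classical.epsilon_spec (p := fun a => ρ a = cayley (G v : R)) hv⟩
  have hGc : ContinuousAt G 0 := hG.self_of_nhds.1.continuousAt
  have hGt : Filter.Tendsto (fun v => (G v : R)) (𝓝 0) (𝓝 0) := by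
    have h := (continuous_subtype_val.continuousAt (x := G 0)).comp hGc
    rw [ContinuousAt] at h
    simpa [hG0, Function.comp_def] using h
  have hvt : Filter.Tendsto (fun v : symmetricTangent θ σ => (v : R)) (𝓝 0) (𝓝 0) :=
    continuous_subtype_val.tendsto' _ _ rfl
  have hgood : ∀ᶠ v in 𝓝 (0 : symmetricTangent θ σ), ContDiffAt ℝ ∞ G v ∧
      IsUnit (1 - (G v : R)) ∧ ρ (param v) = cayley (G v : R) ∧ IsUnit (1 - (v : R)) ∧
      ρ (param v) * σ.toLin (ρ (param v)) = cayley (v : R) := by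
    have hGn : Filter.Tendsto (fun v => -(G v : R)) (𝓝 0) (𝓝 0) := by simpa using hGt.neg
    have hGsq : Filter.Tendsto (fun v => -((G v : R) * G v)) (𝓝 0) (𝓝 0) := by
      simpa using (hGt.mul hGt).neg
    filter_upwards [hG, hGt.eventually eventually_isUnit_one_sub,
      hGn.eventually eventually_isUnit_one_sub, hvt.eventually eventually_isUnit_one_sub,
      hGsq.eventually eventually_isUnit_one_sub] with v h1 h2 h3 h4 h5
    rw [sub_neg_eq_add] at h3 h5
    -- Since `θ` changes the sign of `G v`, it maps `cayley (G v)` to `cayley (-G v)`, its inverse;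
    -- so the group equation `θ(u) u = 1` holds. As `σ` fixes `G v`, also `u σ(u) = u²`.
    have h6 : ρ (param v) = cayley (G v : R) := by
      refine hparam v ((hρ _).2 ?_)
      rw [θ.map_cayley h2, (G v).2.1, cayley_neg_mul h2 h3]
    refine ⟨h1.1, h2, h6, h4, ?_⟩
    rw [h6, σ.map_cayley h2, (G v).2.2, cayley_mul_self h2 h4 h5 h1.2]
  have h20 : IsUnit ((1 : R) + 1) := by
    have h := (IsUnit.mk0 (2 : ℝ) two_ne_zero).map (algebraMap ℝ R)
    rwa [map_ofNat, ← one_add_one_eq_two] at h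
  have horb1 : ρ 1 * σ.toLin (ρ 1) = 1 := by rw [map_one, σ.map_one, mul_one]
  have hplus : ∀ᶠ w : R in 𝓝 (ρ 1 * σ.toLin (ρ 1)), IsUnit (w + 1) := by
    rw [horb1]
    have h : Filter.Tendsto (fun w : R => w + 1) (𝓝 1) (𝓝 (1 + 1)) :=
      (continuous_id.add continuous_const).tendsto 1
    exact h.eventually (Units.isOpen.mem_nhds h20)
  -- A point `w` of the orbit satisfies `σ(w) = w` and `θ(w) w = 1`. The inverse Cayley transform
  -- turns these into the linear equations of the tangent space.
  have hmem : ∀ w : R, IsUnit (w + 1) → w ∈ Set.range (fun a => ρ a * σ.toLin (ρ a)) →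
      cayleySymm w ∈ symmetricTangent θ σ := by
    rintro _ hu ⟨a, rfl⟩
    dsimp only at hu ⊢
    obtain ⟨w, hw⟩ : ∃ w, w = ρ a * σ.toLin (ρ a) := ⟨_, rfl⟩
    rw [← hw] at hu ⊢
    have hσ : σ.toLin w = w := by rw [hw, σ.map_mul, σ.involutive]
    have ha : θ.toLin (ρ a) * ρ a = 1 := (hρ _).1 ⟨a, rfl⟩
    have ha' : ρ a * θ.toLin (ρ a) = 1 := by
      have h1 : θ.toLin (ρ a) = ρ a⁻¹ := by
        rw [← mul_one (θ.toLin (ρ a)), ← hinv a, ← mul_assoc, ha, one_mul]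
      rw [h1, hinv]
    -- Here it is essential that `θ` and `σ` commute: then `σ(ρ a)` satisfies the group equation as
    -- well.
    have hθ : θ.toLin w * w = 1 := by
      rw [hw, θ.map_mul, hcomm, mul_assoc, ← mul_assoc (θ.toLin (ρ a)), ha, one_mul,
        ← σ.map_mul, ha', σ.map_one]
    have hc : Ring.inverse (w + 1) * (w - 1) = (w - 1) * Ring.inverse (w + 1) := by
      obtain ⟨u, hu⟩ := hu
      rw [← hu, Ring.inverse_unit]
      refine Commute.units_inv_left ?_
      rw [hu]
      exact ((Commute.refl w).sub_right (Commute.one_right w)).add_left (Commute.one_left _)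
    refine ⟨?_, ?_⟩
    · have h1 : (w + 1) * cayleySymm w = w - 1 := by
        rw [cayleySymm, ← hc, ← mul_assoc, Ring.mul_inverse_cancel _ hu, one_mul]
      have h2 : cayleySymm w * (w + 1) = w - 1 := by
        rw [cayleySymm, mul_assoc, Ring.inverse_mul_cancel _ hu, mul_one]
      -- With `c = cayleySymm w`, applying `θ` to `(w + 1) c = w - 1` and multiplying by `w` on the
      -- right gives `θ(c) (1 + w) = 1 - w`, while `c (w + 1) = w - 1`.
      have h3 := congrArg (fun r => θ.toLin r * w) h1
      simp only [θ.map_mul, map_add, map_sub, θ.map_one, mul_assoc, add_mul, sub_mul, hθ,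
        one_mul] at h3
      refine hu.mul_right_cancel ?_
      rw [neg_mul, h2, neg_sub, add_comm w 1, mul_add]
      exact h3
    · rw [cayleySymm, σ.map_mul, σ.map_inverse, map_sub, map_add, hσ, σ.map_one, hc]
  exact ⟨{
    isInducing_emb := hemb
    translate := fun a v => ε.symm (ρ a * ε v)
    contDiff_translate := fun a => ε.symm.contDiff.comp (contDiff_const.mul ε.contDiff)
    translate_emb := fun a b => by rw [ε.symm_apply_eq, hε, hε, map_mul]
    orbExt := fun v => ε v * σ.toLin (ε v)
    contDiff_orbExt := ε.contDiff.mul (σ.toLin.contDiff.comp ε.contDiff)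
    orbExt_emb := fun a => by rw [hε]
    act := fun a w => ρ a * w * σ.toLin (ρ a)
    contDiff_act := fun a => (contDiff_const.mul contDiff_id).mul contDiff_const
    act_orb := fun a b => by simp only [map_mul, σ.map_mul, mul_assoc]
    orb_eq_iff := fun a b => by
      rw [hH, map_mul, σ.map_mul]
      constructor
      · intro h
        calc ρ a⁻¹ * ρ b * (σ.toLin (ρ b) * σ.toLin (ρ a⁻¹))
            = ρ a⁻¹ * (ρ b * σ.toLin (ρ b)) * σ.toLin (ρ a⁻¹) := by simp only [mul_assoc]
          _ = ρ a⁻¹ * ρ a * (σ.toLin (ρ a) * σ.toLin (ρ a⁻¹)) := by rw [← h]; simp only [mul_assoc]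
          _ = 1 := by rw [hinv', hsinv, one_mul]
      · intro h
        have hsinv' : σ.toLin (ρ a⁻¹) * σ.toLin (ρ a) = 1 := by
          rw [← σ.map_mul, hinv, σ.map_one]
        calc ρ a * σ.toLin (ρ a)
            = ρ a * (ρ a⁻¹ * ρ b * (σ.toLin (ρ b) * σ.toLin (ρ a⁻¹))) * σ.toLin (ρ a) := by
              rw [h, mul_one]
          _ = ρ a * ρ a⁻¹ * (ρ b * σ.toLin (ρ b)) * (σ.toLin (ρ a⁻¹) * σ.toLin (ρ a)) := by
              simp only [mul_assoc]
          _ = _ := by rw [hinv, hsinv', one_mul, mul_one]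
    param := param
    coord := fun w => pr (cayleySymm w)
    coord_orb_one := by rw [horb1, cayleySymm, sub_self, zero_mul, map_zero]
    orb_param_zero := by
      rw [hgood.self_of_nhds.2.2.2.2, horb1]
      simp [cayley]
    contDiffAt_param := by
      filter_upwards [hgood.eventually_nhds] with v hv
      have h1 : ContDiffAt ℝ ∞ (fun v => ε.symm (cayley (G v : R))) v := by
        have h2 : ContDiffAt ℝ ∞ (fun v => (G v : R)) v :=
          (symmetricTangent θ σ).subtypeL.contDiff.contDiffAt.comp v hv.self_of_nhds.1
        have h3 : ContDiffAt ℝ ∞ (fun v => cayley (G v : R)) v :=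
          ContDiffAt.comp (g := cayley) v (contDiffAt_cayley hv.self_of_nhds.2.1) h2
        exact ε.symm.contDiff.contDiffAt.comp v h3
      refine h1.congr_of_eventuallyEq (hv.mono fun u hu => ?_)
      dsimp only
      rw [← hu.2.2.1, ← hε, ε.symm_apply_apply]
    coord_orb_param := by
      filter_upwards [hgood] with v hv
      rw [hv.2.2.2.2, cayleySymm_cayley hv.2.2.2.1, hpr]
    contDiffAt_coord := by
      filter_upwards [hplus] with w hw
      exact pr.contDiff.contDiffAt.comp w (contDiffAt_cayleySymm hw)
    orb_param_coord := by
      have ht : Filter.Tendsto (fun w => pr (cayleySymm w)) (𝓝 (ρ 1 * σ.toLin (ρ 1))) (𝓝 0) := by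
        have h := (pr.contDiff.contDiffAt.comp _
          (contDiffAt_cayleySymm hplus.self_of_nhds)).continuousAt
        rw [ContinuousAt] at h
        have h1 : pr (cayleySymm (ρ 1 * σ.toLin (ρ 1))) = 0 := by
          rw [horb1, cayleySymm, sub_self, zero_mul, map_zero]
        rw [Function.comp_apply, h1] at h
        exact h
      filter_upwards [hplus, ht.eventually hgood] with w hw h1 h2
      rw [h1.2.2.2.2]
      have h3 := congrArg Subtype.val (hpr ⟨_, hmem w hw h2⟩)
      dsimp only at h3
      rw [h3, cayley_cayleySymm hw] }⟩

end SymmetricSpace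

end

noncomputable section

/-! ### Orthonormal frames of indefinite forms -/

/-- The diagonal entries of `diag (1_n, -1_n')`. -/
def signs (n n' : ℕ) : Fin n ⊕ Fin n' → ℝ := Sum.elim (fun _ => 1) (fun _ => -1)

theorem signs_mul_self {n n' : ℕ} (i : Fin n ⊕ Fin n') : signs n n' i * signs n n' i = 1 := by
  rcases i with i | i <;> simp [signs]

section Sylvester

variable {V : Type*} [AddCommGroup V] [Module ℝ V] {B : LinearMap.BilinForm ℝ V}

theorem ncard_signs_pos (n n' : ℕ) : {i | 0 < signs n n' i}.ncard = n := by
  have h : {i | 0 < signs n n' i} = Set.range Sum.inl := by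
    ext i
    rcases i with i | i
    · simp [signs]
    · simp only [Set.mem_ofPred_eq, signs, Sum.elim_inr, Set.mem_range, reduceCtorEq, exists_false,
        iff_false]
      norm_num
  rw [h, ← Set.image_univ, Set.ncard_image_of_injective _ Sum.inl_injective, Set.ncard_univ,
    Nat.card_fin]

theorem ncard_signs_neg (n n' : ℕ) : {i | signs n n' i < 0}.ncard = n' := by
  have h : {i | signs n n' i < 0} = Set.range Sum.inr := by
    ext i
    rcases i with i | i
    · simp only [Set.mem_ofPred_eq, signs, Sum.elim_inl, Set.mem_range, reduceCtorEq, exists_false,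
        iff_false]
      norm_num
    · simp [signs]
  rw [h, ← Set.image_univ, Set.ncard_image_of_injective _ Sum.inr_injective, Set.ncard_univ,
    Nat.card_fin]

theorem hasSignature_of_frame {n n' : ℕ} (κ : V ≃ₗ[ℝ] (Fin n ⊕ Fin n' → ℝ))
    (hκ : ∀ v, B v v = ∑ i, signs n n' i * (κ v i * κ v i)) : HasSignature B n n' := by
  have h : QuadraticMap.Equivalent B.toQuadraticMap
      (QuadraticMap.weightedSumSquares ℝ (signs n n')) := by
    refine ⟨⟨κ, fun v => ?_⟩⟩
    rw [QuadraticMap.weightedSumSquares_apply]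
    exact (hκ v).symm
  exact ⟨(QuadraticForm.sigPos_of_equiv_weightedSumSquares h).trans (ncard_signs_pos n n'),
    (QuadraticForm.sigNeg_of_equiv_weightedSumSquares h).trans (ncard_signs_neg n n')⟩

theorem bilinForm_eq_of_diagonal {ι : Type*} [Fintype ι] (w : ι → ℝ) (hs : ∀ v w, B v w = B w v)
    (κ : V →ₗ[ℝ] (ι → ℝ)) (hκ : ∀ v, B v v = ∑ i, w i * (κ v i * κ v i)) (u v : V) :
    B u v = ∑ i, w i * (κ u i * κ v i) := by
  have h1 := hκ (u + v)
  have h3 : B (u + v) (u + v) = B u u + B u v + (B u v + B v v) := by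
    rw [map_add, map_add, LinearMap.add_apply, LinearMap.add_apply, hs v u]
  rw [h3] at h1
  simp only [map_add, Pi.add_apply, hκ] at h1
  have h2 : ∑ i, w i * ((κ u i + κ v i) * (κ u i + κ v i)) = ∑ i, w i * (κ u i * κ u i) +
      ∑ i, w i * (κ v i * κ v i) + 2 * ∑ i, w i * (κ u i * κ v i) := by
    rw [Finset.mul_sum, ← Finset.sum_add_distrib, ← Finset.sum_add_distrib]
    exact Finset.sum_congr rfl fun i _ => by ring
  rw [h2] at h1
  linarith

theorem exists_orthonormal_frame [FiniteDimensional ℝ V] (hs : ∀ v w, B v w = B w v)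
    (hB : ∀ v, (∀ w, B v w = 0) → v = 0) :
    ∃ (n n' : ℕ) (κ : V ≃ₗ[ℝ] (Fin n ⊕ Fin n' → ℝ)), n + n' = Module.finrank ℝ V ∧
      ∀ v w, B v w = ∑ i, signs n n' i * (κ v i * κ w i) := by
  have hassoc : QuadraticMap.associated (R := ℝ) B.toQuadraticMap = B :=
    QuadraticMap.associated_left_inverse ℝ fun v w => hs v w
  obtain ⟨w, hw, ⟨e⟩⟩ := QuadraticForm.equivalent_one_neg_one_weighted_sum_squared
    B.toQuadraticMap (by rw [hassoc]; exact fun v hv => hB v hv)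
  classical
  let n := Fintype.card {i // w i = 1}
  let n' := Fintype.card {i // ¬ w i = 1}
  -- Sylvester's theorem gives weights `±1` in no particular order; this bijection puts the positive
  -- ones first.
  let r : Fin n ⊕ Fin n' ≃ Fin (Module.finrank ℝ V) :=
    ((Fintype.equivFin {i // w i = 1}).symm.sumCongr
      (Fintype.equivFin {i // ¬ w i = 1}).symm).trans (Equiv.sumCompl _)
  have hr : ∀ i, w (r i) = signs n n' i := by
    rintro (i | i)
    · exact ((Fintype.equivFin {i // w i = 1}).symm i).2
    · exact (hw _).resolve_right ((Fintype.equivFin {i // ¬ w i = 1}).symm i).2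
  have hcard : n + n' = Module.finrank ℝ V := by
    simpa using Fintype.card_congr r
  refine ⟨n, n', e.toLinearEquiv.trans (LinearEquiv.funCongrLeft ℝ ℝ r), hcard, ?_⟩
  refine bilinForm_eq_of_diagonal _ hs
    (e.toLinearEquiv.trans (LinearEquiv.funCongrLeft ℝ ℝ r)).toLinearMap fun v => ?_
  have h := e.map_app v
  rw [QuadraticMap.weightedSumSquares_apply] at h
  refine h.symm.trans ?_
  rw [← r.sum_comp]
  exact Finset.sum_congr rfl fun i _ => by rw [hr]; rfl

theorem exists_frame_of_hasSignature [FiniteDimensional ℝ V] (hs : ∀ v w, B v w = B w v)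
    (hB : ∀ v, (∀ w, B v w = 0) → v = 0) {p q : ℕ} (hpq : HasSignature B p q) :
    ∃ κ : V ≃ₗ[ℝ] (Fin p ⊕ Fin q → ℝ), ∀ v w, B v w = ∑ i, signs p q i * (κ v i * κ w i) := by
  obtain ⟨n, n', κ, -, hκ⟩ := exists_orthonormal_frame hs hB
  have h := hasSignature_of_frame κ fun v => hκ v v
  obtain rfl : n = p := h.1.symm.trans hpq.1
  obtain rfl : n' = q := h.2.symm.trans hpq.2
  exact ⟨κ, hκ⟩

end Sylvester

/-! ### Linear algebra of the model fibres -/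

/-- The trace of `S J J` equals `k tr S`, and by anticommutation and cyclicity also its own
negative. Thus the vanishing of the trace follows from the other twistor conditions. -/
theorem trace_eq_zero_of_anticommute {V : Type*} [AddCommGroup V] [Module ℝ V] {S J : V →ₗ[ℝ] V}
    {k : ℝ} (hk : k ≠ 0) (hJ : J * J = k • (1 : V →ₗ[ℝ] V)) (h : S * J = -(J * S)) :
    LinearMap.trace ℝ V S = 0 := by
  have h1 : LinearMap.trace ℝ V (S * J * J) = k * LinearMap.trace ℝ V S := by
    rw [mul_assoc, hJ, mul_smul_comm, mul_one, map_smul, smul_eq_mul]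
  have h2 : LinearMap.trace ℝ V (S * J * J) = -LinearMap.trace ℝ V (S * J * J) := by
    conv_lhs => rw [h, neg_mul, map_neg, mul_assoc, LinearMap.trace_mul_comm]
  rw [h1] at h2
  have h3 : k * LinearMap.trace ℝ V S = 0 := by linarith
  exact (mul_eq_zero.1 h3).resolve_left hk

section Model

variable {m : ℕ}

theorem ModelMetric.IsMetric.inverse_apply {f : ModelMetric m} (hf : f.IsMetric)
    (v : EuclideanSpace ℝ (Fin m)) : f.inverse (f v) = v :=
  hf.injective (hf.apply_inverse _)

theorem ModelMetric.IsMetric.modelI_modelI {f : ModelMetric m} (hf : f.IsMetric) (k : ℝ)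
    (X : ExtModel m) : modelI f k (modelI f k X) = k • X := by
  rw [modelI_apply, modelI_apply]
  refine Prod.ext ?_ ?_
  · simp [hf.inverse_apply]
  · simp [hf.apply_inverse]

theorem IsModelTwistor.of_anticommute {lam ell : ℝ} {f : ModelMetric m} (hf : f.IsMetric)
    (hk : lam * ell ≠ 0) {S : EndModel m} (sq : ∀ X, S (S X) = lam • X)
    (skew : ∀ X Y, modelPairing (S X) Y = -modelPairing X (S Y))
    (compatible : ∀ X, S (modelI f (-(lam * ell)) X) = -modelI f (-(lam * ell)) (S X)) :
    IsModelTwistor lam ell f S := by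
  refine ⟨ContinuousLinearMap.ext sq, trace_eq_zero_of_anticommute (neg_ne_zero.2 hk)
    (J := (modelI f (-(lam * ell))).toLinearMap) ?_ ?_, skew, ContinuousLinearMap.ext compatible⟩
  · exact LinearMap.ext fun X => hf.modelI_modelI _ X
  · exact LinearMap.ext compatible

theorem IsModelTwistor.apply_apply {lam ell : ℝ} {f : ModelMetric m} {S : EndModel m}
    (hS : IsModelTwistor lam ell f S) (X : ExtModel m) : S (S X) = lam • X :=
  DFunLike.congr_fun hS.sq X

theorem IsModelTwistor.apply_modelI {lam ell : ℝ} {f : ModelMetric m} {S : EndModel m}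
    (hS : IsModelTwistor lam ell f S) (X : ExtModel m) :
    S (modelI f (-(lam * ell)) X) = -modelI f (-(lam * ell)) (S X) :=
  DFunLike.congr_fun hS.compatible X

/-! ### The model fibres with `lam ell = -1` -/

/-- The embedding of `ℝ^m` as the `δ`-eigenspace of `I_1`, `δ = ±1`. -/
def eigenIncl (f : ModelMetric m) (δ : ℝ) : EuclideanSpace ℝ (Fin m) →L[ℝ] ExtModel m :=
  (ContinuousLinearMap.id ℝ _).prod (δ • f)

/-- The projection to the `δ`-eigenspace of `I_1`, `δ = ±1`. -/
def eigenProj (f : ModelMetric m) (δ : ℝ) : ExtModel m →L[ℝ] EuclideanSpace ℝ (Fin m) :=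
  (1 / 2 : ℝ) • (ContinuousLinearMap.fst ℝ _ _ + δ • f.inverse.comp (ContinuousLinearMap.snd ℝ _ _))

theorem eigenIncl_apply (f : ModelMetric m) (δ : ℝ) (v : EuclideanSpace ℝ (Fin m)) :
    eigenIncl f δ v = (v, δ • f v) := rfl

theorem eigenProj_apply (f : ModelMetric m) (δ : ℝ) (X : ExtModel m) :
    eigenProj f δ X = (1 / 2 : ℝ) • (X.1 + δ • f.inverse X.2) := rfl

/-- The endomorphism which maps the `1`-eigenspace of `I_1` to the `-1`-eigenspace by `A` and
conversely by `B`. -/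
def eigenSwap (f : ModelMetric m) (A B : EuclideanSpace ℝ (Fin m) →L[ℝ] EuclideanSpace ℝ (Fin m)) :
    EndModel m :=
  (eigenIncl f (-1)).comp (A.comp (eigenProj f 1)) + (eigenIncl f 1).comp (B.comp (eigenProj f (-1)))

theorem eigenSwap_apply (f : ModelMetric m)
    (A B : EuclideanSpace ℝ (Fin m) →L[ℝ] EuclideanSpace ℝ (Fin m)) (X : ExtModel m) :
    eigenSwap f A B X = eigenIncl f (-1) (A (eigenProj f 1 X)) +
      eigenIncl f 1 (B (eigenProj f (-1) X)) := rfl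

section

variable {f : ModelMetric m} (hf : f.IsMetric)

include hf

theorem eigenProj_eigenIncl {δ : ℝ} (hδ : δ * δ = 1) (v : EuclideanSpace ℝ (Fin m)) :
    eigenProj f δ (eigenIncl f δ v) = v := by
  rw [eigenProj_apply, eigenIncl_apply]
  simp only [map_smul, hf.inverse_apply, smul_smul, hδ]
  rw [one_smul, ← two_smul ℝ v, smul_smul]
  norm_num

theorem eigenProj_eigenIncl_neg {δ : ℝ} (hδ : δ * δ = 1) (v : EuclideanSpace ℝ (Fin m)) :
    eigenProj f δ (eigenIncl f (-δ) v) = 0 := by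
  rw [eigenProj_apply, eigenIncl_apply]
  simp [hf.inverse_apply, smul_smul, hδ]

theorem eigenProj_neg_eigenIncl {δ : ℝ} (hδ : δ * δ = 1) (v : EuclideanSpace ℝ (Fin m)) :
    eigenProj f (-δ) (eigenIncl f δ v) = 0 := by
  rw [eigenProj_apply, eigenIncl_apply]
  simp [hf.inverse_apply, smul_smul, hδ]

theorem eigenIncl_add_eigenIncl (X : ExtModel m) :
    eigenIncl f 1 (eigenProj f 1 X) + eigenIncl f (-1) (eigenProj f (-1) X) = X := by
  rw [eigenProj_apply, eigenProj_apply, eigenIncl_apply, eigenIncl_apply]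
  refine Prod.ext ?_ ?_
  · simp only [Prod.fst_add]
    module
  · simp only [Prod.snd_add, map_smul, map_add, hf.apply_inverse]
    module

theorem eigenProj_modelI (δ : ℝ) (hδ : δ * δ = 1) (X : ExtModel m) :
    eigenProj f δ (modelI f 1 X) = δ • eigenProj f δ X := by
  rw [eigenProj_apply, eigenProj_apply, modelI_apply]
  simp only [hf.inverse_apply, one_smul]
  rw [smul_comm δ (1 / 2 : ℝ), smul_add δ, smul_smul δ δ, hδ, one_smul, add_comm]

theorem modelI_eigenIncl (δ : ℝ) (hδ : δ * δ = 1) (v : EuclideanSpace ℝ (Fin m)) :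
    modelI f 1 (eigenIncl f δ v) = δ • eigenIncl f δ v := by
  rw [modelI_apply, eigenIncl_apply]
  refine Prod.ext ?_ ?_
  · simp [hf.inverse_apply]
  · simp [smul_smul, hδ]

theorem modelPairing_eigenIncl (δ : ℝ) (v w : EuclideanSpace ℝ (Fin m)) :
    modelPairing (eigenIncl f δ v) (eigenIncl f δ w) = 2 * δ * f v w := by
  simp [modelPairing, eigenIncl_apply, hf.symm w v]
  ring

theorem modelPairing_eigenIncl_neg (δ : ℝ) (v w : EuclideanSpace ℝ (Fin m)) :
    modelPairing (eigenIncl f δ v) (eigenIncl f (-δ) w) = 0 := by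
  simp [modelPairing, eigenIncl_apply, hf.symm w v]

/-- The form `b` restricts to `2 δ f` on the `δ`-eigenspace of `I_1`. The opposite signs for `δ =
±1` turn skew-symmetry of `S` into adjointness of its two off-diagonal blocks. -/
theorem IsModelTwistor.exists_eigenSwap {lam ell : ℝ} (hk : lam * ell = -1) {S : EndModel m}
    (hS : IsModelTwistor lam ell f S) :
    let A := (eigenProj f (-1)).comp (S.comp (eigenIncl f 1))
    let B := (eigenProj f 1).comp (S.comp (eigenIncl f (-1)))
    S = eigenSwap f A B ∧ (∀ v, A (B v) = lam • v) ∧ (∀ v, B (A v) = lam • v) ∧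
      ∀ v w, f (A v) w = f v (B w) := by
  intro A B
  have hI := hS.apply_modelI
  rw [hk, neg_neg] at hI
  -- Anticommutation forces each diagonal block to equal its own negative, up to the nonzero factor
  -- `δ`.
  have hzero : ∀ δ : ℝ, δ * δ = 1 → ∀ v, eigenProj f δ (S (eigenIncl f δ v)) = 0 :=
    fun δ hδ v => by
      have hδ0 : δ ≠ 0 := fun h => by simp [h] at hδ
      have h1 := hI (eigenIncl f δ v)
      rw [modelI_eigenIncl hf δ hδ, map_smul] at h1
      have h2 := congrArg (eigenProj f δ) h1
      rw [map_smul, map_neg, eigenProj_modelI hf δ hδ, eq_neg_iff_add_eq_zero, ← two_smul ℝ,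
        smul_eq_zero, smul_eq_zero] at h2
      exact (h2.resolve_left two_ne_zero).resolve_left hδ0
  have hA : ∀ v, S (eigenIncl f 1 v) = eigenIncl f (-1) (A v) := fun v => by
    have h1 := eigenIncl_add_eigenIncl hf (S (eigenIncl f 1 v))
    rw [hzero 1 (by norm_num), map_zero, zero_add] at h1
    exact h1.symm
  have hB : ∀ v, S (eigenIncl f (-1) v) = eigenIncl f 1 (B v) := fun v => by
    have h1 := eigenIncl_add_eigenIncl hf (S (eigenIncl f (-1) v))
    rw [hzero (-1) (by norm_num), map_zero, add_zero] at h1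
    exact h1.symm
  have h1 : (1 : ℝ) * 1 = 1 := by norm_num
  have h2 : (-1 : ℝ) * -1 = 1 := by norm_num
  refine ⟨ContinuousLinearMap.ext fun X => ?_, fun v => ?_, fun v => ?_, fun v w => ?_⟩
  · conv_lhs => rw [← eigenIncl_add_eigenIncl hf X, map_add, hA, hB]
    rfl
  · have h3 := hS.apply_apply (eigenIncl f (-1) v)
    rw [hB, hA, ← map_smul] at h3
    have h4 := congrArg (eigenProj f (-1)) h3
    rwa [eigenProj_eigenIncl hf h2, eigenProj_eigenIncl hf h2] at h4
  · have h3 := hS.apply_apply (eigenIncl f 1 v)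
    rw [hA, hB, ← map_smul] at h3
    have h4 := congrArg (eigenProj f 1) h3
    rwa [eigenProj_eigenIncl hf h1, eigenProj_eigenIncl hf h1] at h4
  · have h3 := hS.skew (eigenIncl f 1 v) (eigenIncl f (-1) w)
    rw [hA, hB, modelPairing_eigenIncl hf, modelPairing_eigenIncl hf] at h3
    linarith

theorem eigenProj_eigenSwap_one (A B : EuclideanSpace ℝ (Fin m) →L[ℝ] EuclideanSpace ℝ (Fin m)) :
    (eigenProj f (-1)).comp ((eigenSwap f A B).comp (eigenIncl f 1)) = A := by
  refine ContinuousLinearMap.ext fun v => ?_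
  simp only [ContinuousLinearMap.comp_apply, eigenSwap_apply, map_add,
    eigenProj_eigenIncl hf (show (1 : ℝ) * 1 = 1 by norm_num),
    eigenProj_eigenIncl hf (show (-1 : ℝ) * -1 = 1 by norm_num),
    eigenProj_neg_eigenIncl hf (show (1 : ℝ) * 1 = 1 by norm_num), add_zero]

theorem eigenProj_eigenSwap_neg_one
    (A B : EuclideanSpace ℝ (Fin m) →L[ℝ] EuclideanSpace ℝ (Fin m)) :
    (eigenProj f 1).comp ((eigenSwap f A B).comp (eigenIncl f (-1))) = B := by
  refine ContinuousLinearMap.ext fun v => ?_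
  simp only [ContinuousLinearMap.comp_apply, eigenSwap_apply, map_add,
    eigenProj_eigenIncl hf (show (1 : ℝ) * 1 = 1 by norm_num),
    eigenProj_eigenIncl hf (show (-1 : ℝ) * -1 = 1 by norm_num),
    eigenProj_eigenIncl_neg hf (show (1 : ℝ) * 1 = 1 by norm_num), zero_add]

theorem isModelTwistor_eigenSwap {lam ell : ℝ} (hk : lam * ell = -1)
    {A B : EuclideanSpace ℝ (Fin m) →L[ℝ] EuclideanSpace ℝ (Fin m)}
    (hAB : ∀ v, A (B v) = lam • v) (hBA : ∀ v, B (A v) = lam • v)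
    (hadj : ∀ v w, f (A v) w = f v (B w)) : IsModelTwistor lam ell f (eigenSwap f A B) := by
  have h1 : (1 : ℝ) * 1 = 1 := by norm_num
  have h2 : (-1 : ℝ) * -1 = 1 := by norm_num
  have hplus : ∀ v, eigenSwap f A B (eigenIncl f 1 v) = eigenIncl f (-1) (A v) := fun v => by
    rw [eigenSwap_apply, eigenProj_eigenIncl hf h1, eigenProj_neg_eigenIncl hf h1, map_zero,
      map_zero, add_zero]
  have hminus : ∀ v, eigenSwap f A B (eigenIncl f (-1) v) = eigenIncl f 1 (B v) := fun v => by
    rw [eigenSwap_apply, eigenProj_eigenIncl hf h2, eigenProj_eigenIncl_neg hf h1, map_zero,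
      map_zero, zero_add]
  have hadj' : ∀ v w, f (B v) w = f v (A w) := fun v w => by
    rw [hf.symm, ← hadj, hf.symm]
  refine IsModelTwistor.of_anticommute hf (by rw [hk]; norm_num) (fun X => ?_) (fun X Y => ?_)
    fun X => ?_
  · rw [← eigenIncl_add_eigenIncl hf X]
    simp only [map_add, hplus, hminus, hAB, hBA, map_smul, smul_add]
  · rw [← eigenIncl_add_eigenIncl hf X, ← eigenIncl_add_eigenIncl hf Y]
    obtain ⟨x, hx⟩ : ∃ x, x = eigenProj f 1 X := ⟨_, rfl⟩
    obtain ⟨x', hx'⟩ : ∃ x, x = eigenProj f (-1) X := ⟨_, rfl⟩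
    obtain ⟨y, hy⟩ : ∃ x, x = eigenProj f 1 Y := ⟨_, rfl⟩
    obtain ⟨y', hy'⟩ : ∃ x, x = eigenProj f (-1) Y := ⟨_, rfl⟩
    rw [← hx, ← hx', ← hy, ← hy', map_add, map_add, hplus, hplus, hminus, hminus]
    have hadd : ∀ X X' Y Y' : ExtModel m, modelPairing (X + X') (Y + Y') = modelPairing X Y +
        modelPairing X Y' + (modelPairing X' Y + modelPairing X' Y') := fun X X' Y Y' => by
      simp [modelPairing]
      ring
    have h3 : ∀ v w, modelPairing (eigenIncl f 1 v) (eigenIncl f (-1) w) = 0 :=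
      modelPairing_eigenIncl_neg hf 1
    have h4 : ∀ v w, modelPairing (eigenIncl f (-1) v) (eigenIncl f 1 w) = 0 := fun v w => by
      have h5 := modelPairing_eigenIncl_neg hf (-1) v w
      rwa [neg_neg] at h5
    rw [hadd, hadd, h3, h3, h4, h4, modelPairing_eigenIncl hf, modelPairing_eigenIncl hf,
      modelPairing_eigenIncl hf, modelPairing_eigenIncl hf, hadj, hadj']
    ring
  · rw [hk, neg_neg, ← eigenIncl_add_eigenIncl hf X]
    simp only [map_add, hplus, hminus, modelI_eigenIncl hf _ h1, modelI_eigenIncl hf _ h2,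
      map_smul, one_smul, neg_smul, neg_add, map_neg, neg_neg]
    module

end

end Model

end

noncomputable section

/-! ### Matrix groups preserving a form -/

section FormGroup

variable {ι K : Type*} [Fintype ι] [DecidableEq ι]

theorem mem_formGroup [CommRing K] {B : Matrix ι ι K} {A : GL ι K} :
    A ∈ formGroup B ↔ (A : Matrix ι ι K)ᵀ * B * (A : Matrix ι ι K) = B := Iff.rfl

/-- The topology on units also records the inverse. On a form group the inverse is `B' Aᵀ B`, a
continuous function of the entries, so the entries alone induce the topology. -/
theorem isInducing_entries [CommRing K] [TopologicalSpace K] [IsTopologicalRing K]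
    {B B' : Matrix ι ι K} (hB : B' * B = 1) :
    Topology.IsInducing (entries : formGroup B → ι → ι → K) := by
  have h0 : Topology.IsInducing
      (fun A : formGroup B => Units.embedProduct (Matrix ι ι K) (A : GL ι K)) :=
    Units.isInducing_embedProduct.comp Topology.IsInducing.subtypeVal
  have h1 : Continuous (fun A : formGroup B => ((A : GL ι K) : Matrix ι ι K)) :=
    Units.continuous_val.comp continuous_subtype_val
  have h2 : Continuous (entries : formGroup B → ι → ι → K) :=
    continuous_pi fun i => continuous_pi fun j => h1.matrix_elem i j
  have h3 : Continuous (fun a : ι → ι → K =>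
      ((Matrix.of a, MulOpposite.op (B' * (Matrix.of a)ᵀ * B)) :
        Matrix ι ι K × (Matrix ι ι K)ᵐᵒᵖ)) := by
    have h4 : Continuous (fun a : ι → ι → K => Matrix.of a) := continuous_id
    exact h4.prodMk (MulOpposite.continuous_op.comp
      ((continuous_const.matrix_mul h4.matrix_transpose).matrix_mul continuous_const))
  refine Topology.IsInducing.of_comp h2 h3 ?_
  convert h0 using 1
  funext A
  refine Prod.ext rfl ?_
  have h5 : B' * ((A : GL ι K) : Matrix ι ι K)ᵀ * B * ((A : GL ι K) : Matrix ι ι K) = 1 := by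
    have h6 := mem_formGroup.1 A.2
    rw [mul_assoc, mul_assoc, ← mul_assoc _ B, h6, hB]
  have h7 : B' * ((A : GL ι K) : Matrix ι ι K)ᵀ * B = (((A : GL ι K)⁻¹ : GL ι K) : Matrix ι ι K) :=
    Units.eq_inv_of_mul_eq_one_right h5
  exact congrArg MulOpposite.op h7

/-- The adjoint `B Aᵀ B` with respect to the symmetric form `B` with `B² = 1`. -/
def formAdjoint [CommRing K] [Algebra ℝ K] (B : Matrix ι ι K) :
    Matrix ι ι K →ₗ[ℝ] Matrix ι ι K where
  toFun A := B * Aᵀ * B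
  map_add' A C := by rw [Matrix.transpose_add, mul_add, add_mul]
  map_smul' c A := by
    rw [Matrix.transpose_smul, mul_smul_comm, smul_mul_assoc, RingHom.id_apply]

section

variable [CommRing K] [Algebra ℝ K] {B : Matrix ι ι K} (hB : B * B = 1) (hBt : Bᵀ = B)

theorem formAdjoint_apply (A : Matrix ι ι K) : formAdjoint B A = B * Aᵀ * B := rfl

include hB

theorem formAdjoint_mul (A C : Matrix ι ι K) :
    formAdjoint B (A * C) = formAdjoint B C * formAdjoint B A := by
  simp only [formAdjoint_apply, Matrix.transpose_mul]
  calc B * (Cᵀ * Aᵀ) * B = B * Cᵀ * 1 * Aᵀ * B := by rw [mul_one]; simp only [mul_assoc]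
    _ = _ := by rw [← hB]; simp only [mul_assoc]

include hBt

theorem formAdjoint_formAdjoint (A : Matrix ι ι K) : formAdjoint B (formAdjoint B A) = A := by
  simp only [formAdjoint_apply, Matrix.transpose_mul, Matrix.transpose_transpose, hBt]
  calc B * (B * (A * B)) * B = B * B * A * (B * B) := by simp only [mul_assoc]
    _ = A := by rw [hB, one_mul, mul_one]

omit hBt in
theorem formAdjoint_mul_self_eq_one_iff (A : Matrix ι ι K) :
    formAdjoint B A * A = 1 ↔ Aᵀ * B * A = B := by
  rw [formAdjoint_apply]
  constructor
  · intro h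
    calc Aᵀ * B * A = B * B * (Aᵀ * B * A) := by rw [hB, one_mul]
      _ = B * (B * Aᵀ * B * A) := by simp only [mul_assoc]
      _ = B := by rw [h, mul_one]
  · intro h
    calc B * Aᵀ * B * A = B * (Aᵀ * B * A) := by simp only [mul_assoc]
      _ = 1 := by rw [h, hB]

end

/-- The inclusion of a matrix group into the algebra of matrices. -/
def formGroupVal [CommRing K] (B : Matrix ι ι K) : formGroup B →* Matrix ι ι K :=
  (Units.coeHom _).comp (formGroup B).subtype

theorem mem_range_formGroupVal [CommRing K] [Algebra ℝ K] {B : Matrix ι ι K} (hB : B * B = 1)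
    (A : Matrix ι ι K) : A ∈ Set.range (formGroupVal B) ↔ formAdjoint B A * A = 1 := by
  rw [formAdjoint_mul_self_eq_one_iff hB]
  constructor
  · rintro ⟨a, rfl⟩
    exact a.2
  · intro h
    have h1 := (formAdjoint_mul_self_eq_one_iff hB A).2 h
    exact ⟨⟨⟨A, formAdjoint B A, mul_eq_one_comm.1 h1, h1⟩, h⟩, rfl⟩

end FormGroup

/-! ### The group `O(p, q) × O(p, q)` modulo the diagonal -/

section PseudoOrthogonal

variable {p q : ℕ}

/-- The matrix `diag (1_p, -1_q)`. -/
abbrev signMatrix (p q : ℕ) : Matrix (Fin p ⊕ Fin q) (Fin p ⊕ Fin q) ℝ :=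
  LieAlgebra.Orthogonal.indefiniteDiagonal (Fin p) (Fin q) ℝ

theorem signMatrix_eq (p q : ℕ) : signMatrix p q = Matrix.diagonal (signs p q) := rfl

theorem signMatrix_mul_self (p q : ℕ) : signMatrix p q * signMatrix p q = 1 := by
  rw [signMatrix_eq, Matrix.diagonal_mul_diagonal]
  simp only [signs_mul_self]
  exact Matrix.diagonal_one

theorem signMatrix_transpose (p q : ℕ) : (signMatrix p q)ᵀ = signMatrix p q :=
  Matrix.diagonal_transpose _

attribute [local instance] Matrix.linftyOpNormedRing Matrix.linftyOpNormedAlgebra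

/-- Pairs of real matrices. -/
abbrev MatrixPair (p q : ℕ) : Type :=
  Matrix (Fin p ⊕ Fin q) (Fin p ⊕ Fin q) ℝ × Matrix (Fin p ⊕ Fin q) (Fin p ⊕ Fin q) ℝ

/-- The adjoint on pairs of matrices. -/
def pairAdjoint (p q : ℕ) : AntiInvolution (MatrixPair p q) :=
  AntiInvolution.ofLinear
    ((formAdjoint (signMatrix p q)).prodMap (formAdjoint (signMatrix p q)))
    (fun a b => Prod.ext (formAdjoint_mul (signMatrix_mul_self p q) _ _)
      (formAdjoint_mul (signMatrix_mul_self p q) _ _))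
    (fun a => Prod.ext
      (formAdjoint_formAdjoint (signMatrix_mul_self p q) (signMatrix_transpose p q) _)
      (formAdjoint_formAdjoint (signMatrix_mul_self p q) (signMatrix_transpose p q) _))

/-- The adjoint on pairs of matrices composed with the interchange. -/
def pairSwapAdjoint (p q : ℕ) : AntiInvolution (MatrixPair p q) :=
  AntiInvolution.ofLinear
    (((formAdjoint (signMatrix p q)).comp (LinearMap.snd ℝ _ _)).prod
      ((formAdjoint (signMatrix p q)).comp (LinearMap.fst ℝ _ _)))
    (fun a b => Prod.ext (formAdjoint_mul (signMatrix_mul_self p q) _ _)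
      (formAdjoint_mul (signMatrix_mul_self p q) _ _))
    (fun a => Prod.ext
      (formAdjoint_formAdjoint (signMatrix_mul_self p q) (signMatrix_transpose p q) _)
      (formAdjoint_formAdjoint (signMatrix_mul_self p q) (signMatrix_transpose p q) _))

theorem pairAdjoint_apply (a : MatrixPair p q) : (pairAdjoint p q).toLin a =
    (formAdjoint (signMatrix p q) a.1, formAdjoint (signMatrix p q) a.2) := rfl

theorem pairSwapAdjoint_apply (a : MatrixPair p q) : (pairSwapAdjoint p q).toLin a =
    (formAdjoint (signMatrix p q) a.2, formAdjoint (signMatrix p q) a.1) := rfl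

/-- The inclusion of `O(p, q) × O(p, q)` into pairs of matrices. -/
def pairVal (p q : ℕ) : pseudoOrthogonal p q × pseudoOrthogonal p q →* MatrixPair p q :=
  (formGroupVal (signMatrix p q)).prodMap (formGroupVal (signMatrix p q))

theorem mem_range_pairVal (a : MatrixPair p q) :
    a ∈ Set.range (pairVal p q) ↔ (pairAdjoint p q).toLin a * a = 1 := by
  have h := fun A => mem_range_formGroupVal (signMatrix_mul_self p q) A
  rw [pairAdjoint_apply, Prod.ext_iff]
  change _ ↔ formAdjoint (signMatrix p q) a.1 * a.1 = 1 ∧ formAdjoint (signMatrix p q) a.2 * a.2 = 1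
  rw [← h, ← h]
  constructor
  · rintro ⟨b, rfl⟩
    exact ⟨⟨b.1, rfl⟩, ⟨b.2, rfl⟩⟩
  · rintro ⟨⟨b, hb⟩, ⟨c, hc⟩⟩
    exact ⟨(b, c), Prod.ext hb hc⟩

/-- The orbit map of `O(p, q) × O(p, q)`. -/
def pairOrbit (p q : ℕ) (a : pseudoOrthogonal p q × pseudoOrthogonal p q) : MatrixPair p q :=
  pairVal p q a * (pairSwapAdjoint p q).toLin (pairVal p q a)

theorem adjoint_mul_formGroupVal (a : pseudoOrthogonal p q) :
    formAdjoint (signMatrix p q) (formGroupVal (signMatrix p q) a) *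
      formGroupVal (signMatrix p q) a = 1 :=
  (mem_range_formGroupVal (signMatrix_mul_self p q) _).1 ⟨a, rfl⟩

/-- The orbit map is `(a, b) ↦ (a b⁻¹, b a⁻¹)`, since the adjoint is the inverse on the group. The
orbit consists of the pairs `(u, u⁻¹)` with `u` in `O(p, q)`, and `(u, 1)` is a preimage. -/
theorem mem_range_pairOrbit (w : MatrixPair p q) :
    w ∈ Set.range (pairOrbit p q) ↔ w.2 = formAdjoint (signMatrix p q) w.1 ∧ w.2 * w.1 = 1 := by
  have hinv := formAdjoint_formAdjoint (signMatrix_mul_self p q) (signMatrix_transpose p q)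
  constructor
  · rintro ⟨⟨a, b⟩, rfl⟩
    change formGroupVal (signMatrix p q) b * formAdjoint _ (formGroupVal (signMatrix p q) a) =
      formAdjoint _ (formGroupVal (signMatrix p q) a *
        formAdjoint _ (formGroupVal (signMatrix p q) b)) ∧
      formGroupVal (signMatrix p q) b * formAdjoint _ (formGroupVal (signMatrix p q) a) *
      (formGroupVal (signMatrix p q) a * formAdjoint _ (formGroupVal (signMatrix p q) b)) = 1
    rw [formAdjoint_mul (signMatrix_mul_self p q), hinv]
    refine ⟨rfl, ?_⟩
    rw [mul_assoc, ← mul_assoc (formAdjoint _ (formGroupVal (signMatrix p q) a)),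
      adjoint_mul_formGroupVal, one_mul, mul_eq_one_comm, adjoint_mul_formGroupVal]
  · rintro ⟨h1, h2⟩
    rw [h1] at h2
    obtain ⟨a, ha⟩ := (mem_range_formGroupVal (signMatrix_mul_self p q) w.1).2 h2
    refine ⟨(a, 1), Prod.ext ?_ ?_⟩
    · change formGroupVal (signMatrix p q) a * formAdjoint _ (formGroupVal (signMatrix p q) 1) = _
      rw [ha, map_one, formAdjoint_apply, Matrix.transpose_one, mul_one, signMatrix_mul_self,
        mul_one]
    · change formGroupVal (signMatrix p q) 1 * formAdjoint _ (formGroupVal (signMatrix p q) a) = _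
      rw [ha, map_one, one_mul, h1]

theorem nonempty_orbitData_pseudoOrthogonal (p q : ℕ) : Nonempty (OrbitData
    (entriesPair : pseudoOrthogonal p q × pseudoOrthogonal p q → _) (diagonalHom p q).range
    (pairOrbit p q) (symmetricTangent (pairAdjoint p q) (pairSwapAdjoint p q))) := by
  refine nonempty_orbitData_symmetricSpace (pairAdjoint p q) (pairSwapAdjoint p q) ?_
    ((Matrix.ofLinearEquiv ℝ).prodCongr (Matrix.ofLinearEquiv ℝ)) (pairVal p q) (fun a => rfl)
    mem_range_pairVal (fun r => rfl) fun a => ?_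
  · exact (isInducing_entries (signMatrix_mul_self p q)).prodMap
      (isInducing_entries (signMatrix_mul_self p q))
  · obtain ⟨a, b⟩ := a
    rw [pairSwapAdjoint_apply, Prod.ext_iff]
    change _ ↔ formGroupVal (signMatrix p q) a * formAdjoint _ (formGroupVal (signMatrix p q) b) = 1
      ∧ formGroupVal (signMatrix p q) b * formAdjoint _ (formGroupVal (signMatrix p q) a) = 1
    have hab : ∀ a b : pseudoOrthogonal p q, formGroupVal (signMatrix p q) a *
        formAdjoint _ (formGroupVal (signMatrix p q) b) = 1 → a = b := fun a b h => by
      have h1 : formGroupVal (signMatrix p q) a = formGroupVal (signMatrix p q) b := by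
        rw [← mul_one (formGroupVal (signMatrix p q) a), ← adjoint_mul_formGroupVal b, ← mul_assoc,
          h, one_mul]
      exact Subtype.ext (Units.ext h1)
    constructor
    · rintro ⟨c, hc⟩
      obtain ⟨rfl, rfl⟩ : c = a ∧ c = b := Prod.ext_iff.1 hc
      have h := mul_eq_one_comm.1 (adjoint_mul_formGroupVal c)
      exact ⟨h, h⟩
    · rintro ⟨h, -⟩
      obtain rfl := hab a b h
      exact ⟨a, rfl⟩

end PseudoOrthogonal

end

noncomputable section

/-! ### The twistor bundles for `lam ell = -1` -/

section SplitBundle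

variable {m p q : ℕ}

theorem ModelMetric.IsMetric.exists_frame {f : ModelMetric m} (hf : f.IsMetric)
    (hpq : f.HasSig p q) : ∃ κ : EuclideanSpace ℝ (Fin m) ≃ₗ[ℝ] (Fin p ⊕ Fin q → ℝ),
      ∀ v w, f v w = ∑ i, signs p q i * (κ v i * κ w i) :=
  exists_frame_of_hasSignature (B := f.form) hf.symm hf.nondegenerate hpq

/-- The matrix of an endomorphism in a frame. -/
def frameMatrix {ι : Type*} [Fintype ι] [DecidableEq ι]
    (κ : EuclideanSpace ℝ (Fin m) ≃ₗ[ℝ] (ι → ℝ)) :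
    (EuclideanSpace ℝ (Fin m) →L[ℝ] EuclideanSpace ℝ (Fin m)) ≃ₗ[ℝ] Matrix ι ι ℝ :=
  LinearMap.toContinuousLinearMap.symm.trans (κ.conj.trans LinearMap.toMatrix')

theorem frameMatrix_mulVec {ι : Type*} [Fintype ι] [DecidableEq ι]
    (κ : EuclideanSpace ℝ (Fin m) ≃ₗ[ℝ] (ι → ℝ))
    (A : EuclideanSpace ℝ (Fin m) →L[ℝ] EuclideanSpace ℝ (Fin m)) (v : EuclideanSpace ℝ (Fin m)) :
    frameMatrix κ A *ᵥ κ v = κ (A v) := by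
  change LinearMap.toMatrix' (κ.conj A.toLinearMap) *ᵥ κ v = κ (A v)
  rw [LinearMap.toMatrix'_mulVec, LinearEquiv.conj_apply_apply, κ.symm_apply_apply]
  rfl

theorem frameMatrix_comp {ι : Type*} [Fintype ι] [DecidableEq ι]
    (κ : EuclideanSpace ℝ (Fin m) ≃ₗ[ℝ] (ι → ℝ))
    (A B : EuclideanSpace ℝ (Fin m) →L[ℝ] EuclideanSpace ℝ (Fin m)) (c : ℝ) :
    frameMatrix κ A * frameMatrix κ B = c • (1 : Matrix ι ι ℝ) ↔ ∀ v, A (B v) = c • v := by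
  constructor
  · intro h v
    apply κ.injective
    rw [← frameMatrix_mulVec, ← frameMatrix_mulVec, Matrix.mulVec_mulVec, h, Matrix.smul_mulVec,
      Matrix.one_mulVec, map_smul]
  · intro h
    refine Matrix.ext_of_mulVec_single fun i => ?_
    obtain ⟨v, hv⟩ := κ.surjective (Pi.single i 1)
    rw [← hv, ← Matrix.mulVec_mulVec, frameMatrix_mulVec, frameMatrix_mulVec, h, map_smul,
      Matrix.smul_mulVec, Matrix.one_mulVec]

theorem frameMatrix_adjoint {f : ModelMetric m}
    {κ : EuclideanSpace ℝ (Fin m) ≃ₗ[ℝ] (Fin p ⊕ Fin q → ℝ)}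
    (hκ : ∀ v w, f v w = ∑ i, signs p q i * (κ v i * κ w i))
    (A B : EuclideanSpace ℝ (Fin m) →L[ℝ] EuclideanSpace ℝ (Fin m)) :
    frameMatrix κ B = formAdjoint (signMatrix p q) (frameMatrix κ A) ↔
      ∀ v w, f (A v) w = f v (B w) := by
  have h1 : ∀ v w, f v w = κ v ⬝ᵥ signMatrix p q *ᵥ κ w := fun v w => by
    rw [hκ, signMatrix_eq, dotProduct]
    refine Finset.sum_congr rfl fun i _ => ?_
    rw [Matrix.mulVec_diagonal]
    ring
  have hA : ∀ v w, f (A v) w = κ v ⬝ᵥ ((frameMatrix κ A)ᵀ * signMatrix p q) *ᵥ κ w :=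
    fun v w => by
      rw [h1, ← frameMatrix_mulVec, ← Matrix.mulVec_mulVec, Matrix.dotProduct_mulVec _ (_)ᵀ,
        Matrix.vecMul_transpose]
  have hB : ∀ v w, f v (B w) = κ v ⬝ᵥ (signMatrix p q * frameMatrix κ B) *ᵥ κ w :=
    fun v w => by
      rw [h1, ← frameMatrix_mulVec, Matrix.mulVec_mulVec]
  constructor
  · intro h v w
    rw [hA, hB, h, formAdjoint_apply, mul_assoc, ← mul_assoc (signMatrix p q), signMatrix_mul_self,
      one_mul]
  · intro h
    have h2 : (frameMatrix κ A)ᵀ * signMatrix p q = signMatrix p q * frameMatrix κ B := by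
      ext i j
      obtain ⟨v, hv⟩ := κ.surjective (Pi.single i 1)
      obtain ⟨w, hw⟩ := κ.surjective (Pi.single j 1)
      have h3 := h v w
      rw [hA, hB, hv, hw] at h3
      simpa using h3
    rw [formAdjoint_apply, mul_assoc, h2, ← mul_assoc, signMatrix_mul_self, one_mul]

attribute [local instance] Matrix.linftyOpNormedRing Matrix.linftyOpNormedAlgebra

/-- Right and left multiplication of the components by `s` and `lam s`. -/
def pairTwist (lam : ℝ) (s : Matrix (Fin p ⊕ Fin q) (Fin p ⊕ Fin q) ℝ) :
    MatrixPair p q →ₗ[ℝ] MatrixPair p q :=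
  (LinearMap.mulRight ℝ s).prodMap (LinearMap.mulLeft ℝ (lam • s))

/-- The endomorphism `eigenSwap`, as a linear map. -/
def eigenSwapLinear (f : ModelMetric m) :
    ((EuclideanSpace ℝ (Fin m) →L[ℝ] EuclideanSpace ℝ (Fin m)) ×
      (EuclideanSpace ℝ (Fin m) →L[ℝ] EuclideanSpace ℝ (Fin m))) →ₗ[ℝ] EndModel m where
  toFun a := eigenSwap f a.1 a.2
  map_add' a b := by
    refine ContinuousLinearMap.ext fun X => ?_
    simp only [eigenSwap_apply, add_apply, Prod.fst_add, Prod.snd_add, map_add]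
    abel
  map_smul' c a := by
    refine ContinuousLinearMap.ext fun X => ?_
    simp only [eigenSwap_apply, smul_apply, Prod.smul_fst, Prod.smul_snd, map_smul, smul_add,
      RingHom.id_apply]

/-- The components of an endomorphism which interchanges the eigenspaces of `I_1`. -/
def eigenComponents (f : ModelMetric m) : EndModel m →ₗ[ℝ]
    ((EuclideanSpace ℝ (Fin m) →L[ℝ] EuclideanSpace ℝ (Fin m)) ×
      (EuclideanSpace ℝ (Fin m) →L[ℝ] EuclideanSpace ℝ (Fin m))) where
  toFun S := ((eigenProj f (-1)).comp (S.comp (eigenIncl f 1)),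
    (eigenProj f 1).comp (S.comp (eigenIncl f (-1))))
  map_add' S T := by
    refine Prod.ext ?_ ?_ <;> refine ContinuousLinearMap.ext fun X => ?_
    · exact map_add (eigenProj f (-1)) _ _
    · exact map_add (eigenProj f 1) _ _
  map_smul' c S := by
    refine Prod.ext ?_ ?_ <;> refine ContinuousLinearMap.ext fun X => ?_
    · exact map_smul (eigenProj f (-1)) _ _
    · exact map_smul (eigenProj f 1) _ _

/-- The block `A` of `S` multiplies the metric by `lam`, and so does the involution `s`, by `hsη`.
Hence `A s` is an isometry in both cases, and `(A s, lam s B)` is it together with its inverse. -/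
theorem exists_splitCoordinates {lam ell : ℝ} (hlam : lam * lam = 1) (hk : lam * ell = -1)
    {s : Matrix (Fin p ⊕ Fin q) (Fin p ⊕ Fin q) ℝ} (hs : s * s = 1) (hst : sᵀ = s)
    (hsη : signMatrix p q * s = lam • (s * signMatrix p q))
    {f : ModelMetric m} (hf : f.IsMetric) (hpq : f.HasSig p q) :
    ∃ (P : EndModel m →ₗ[ℝ] MatrixPair p q) (R : MatrixPair p q →ₗ[ℝ] EndModel m),
      (∀ S, IsModelTwistor lam ell f S → P S ∈ Set.range (pairOrbit p q) ∧ R (P S) = S) ∧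
      ∀ w ∈ Set.range (pairOrbit p q), IsModelTwistor lam ell f (R w) ∧ P (R w) = w := by
  obtain ⟨κ, hκ⟩ := hf.exists_frame hpq
  let c := frameMatrix κ
  have htwist : ∀ w : MatrixPair p q, pairTwist lam s (pairTwist lam s w) = w := fun w => by
    refine Prod.ext ?_ ?_
    · change w.1 * s * s = w.1
      rw [mul_assoc, hs, mul_one]
    · change lam • s * (lam • s * w.2) = w.2
      rw [smul_mul_assoc, smul_mul_assoc, mul_smul_comm, smul_smul, hlam, one_smul, ← mul_assoc, hs,
        one_mul]
  -- Commuting `s` past the sign matrix produces the factor `lam`, so the twist by `s` is compatible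
  -- with taking adjoints.
  have hadj : ∀ U : Matrix (Fin p ⊕ Fin q) (Fin p ⊕ Fin q) ℝ,
      formAdjoint (signMatrix p q) (U * s) = lam • (s * formAdjoint (signMatrix p q) U) :=
    fun U => by
      rw [formAdjoint_apply, formAdjoint_apply, Matrix.transpose_mul, hst, ← mul_assoc, hsη]
      simp only [smul_mul_assoc, mul_assoc]
  refine ⟨(pairTwist lam s).comp ((c.toLinearMap.prodMap c.toLinearMap).comp (eigenComponents f)),
    (eigenSwapLinear f).comp ((c.symm.toLinearMap.prodMap c.symm.toLinearMap).comp
      (pairTwist lam s)), fun S hS => ?_, fun w hw => ?_⟩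
  · obtain ⟨h1, h2, h3, h4⟩ := hS.exists_eigenSwap hf hk
    obtain ⟨A, hA⟩ : ∃ A, A = (eigenProj f (-1)).comp (S.comp (eigenIncl f 1)) := ⟨_, rfl⟩
    obtain ⟨B, hB⟩ : ∃ B, B = (eigenProj f 1).comp (S.comp (eigenIncl f (-1))) := ⟨_, rfl⟩
    rw [← hA, ← hB] at h1
    rw [← hA, ← hB] at h2 h3 h4
    have hP : pairTwist lam s (c.toLinearMap.prodMap c.toLinearMap (eigenComponents f S)) =
        (c A * s, lam • s * c B) := by rw [hA, hB]; rfl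
    refine ⟨?_, ?_⟩
    · rw [LinearMap.comp_apply, LinearMap.comp_apply, hP, mem_range_pairOrbit]
      dsimp only
      rw [hadj, ← (frameMatrix_adjoint hκ A B).2 h4]
      refine ⟨smul_mul_assoc _ _ _, ?_⟩
      have h5 : c B * c A = lam • 1 := (frameMatrix_comp κ B A lam).2 h3
      calc lam • s * c B * (c A * s) = lam • s * (c B * c A) * s := by simp only [mul_assoc]
        _ = 1 := by
          rw [h5, mul_smul_comm, mul_one, smul_smul, hlam, one_smul, hs]
    · rw [LinearMap.comp_apply, LinearMap.comp_apply, LinearMap.comp_apply, LinearMap.comp_apply,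
        htwist]
      change eigenSwap f (c.symm (c _)) (c.symm (c _)) = _
      rw [c.symm_apply_apply, c.symm_apply_apply]
      refine Eq.trans ?_ h1.symm
      rw [hA, hB]
      rfl
  · rw [mem_range_pairOrbit] at hw
    obtain ⟨A, hA⟩ : ∃ A, A = c.symm (w.1 * s) := ⟨_, rfl⟩
    obtain ⟨B, hB⟩ : ∃ B, B = c.symm (lam • s * w.2) := ⟨_, rfl⟩
    have hcA : c A = w.1 * s := by rw [hA, c.apply_symm_apply]
    have hcB : c B = lam • s * w.2 := by rw [hB, c.apply_symm_apply]
    have hR : eigenSwapLinear f ((c.symm.toLinearMap.prodMap c.symm.toLinearMap)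
        (pairTwist lam s w)) = eigenSwap f A B := by rw [hA, hB]; rfl
    have hBA : c B * c A = lam • 1 := by
      rw [hcA, hcB]
      calc lam • s * w.2 * (w.1 * s) = lam • s * (w.2 * w.1) * s := by simp only [mul_assoc]
        _ = lam • 1 := by rw [hw.2, mul_one, smul_mul_assoc, hs]
    have hAB : c A * c B = lam • 1 := by
      have h1 : (lam • c B) * c A = 1 := by
        rw [smul_mul_assoc, hBA, smul_smul, hlam, one_smul]
      have h2 := mul_eq_one_comm.1 h1
      rw [mul_smul_comm] at h2
      rw [← h2, smul_smul, hlam, one_smul]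
    refine ⟨?_, ?_⟩
    · rw [LinearMap.comp_apply, LinearMap.comp_apply, hR]
      refine isModelTwistor_eigenSwap hf hk ((frameMatrix_comp κ A B lam).1 hAB)
        ((frameMatrix_comp κ B A lam).1 hBA) ((frameMatrix_adjoint hκ A B).1 ?_)
      change c B = formAdjoint _ (c A)
      rw [hcA, hcB, hadj, hw.1, smul_mul_assoc]
    · rw [LinearMap.comp_apply, LinearMap.comp_apply, LinearMap.comp_apply, LinearMap.comp_apply,
        hR]
      have h1 : c.toLinearMap.prodMap c.toLinearMap (eigenComponents f (eigenSwap f A B)) =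
          (c A, c B) :=
        Prod.ext (congrArg c (eigenProj_eigenSwap_one hf A B))
          (congrArg c (eigenProj_eigenSwap_neg_one hf A B))
      rw [h1, hcA, hcB]
      exact htwist w

/-- The matrix which interchanges the two summands. -/
def swapMatrix (p : ℕ) : Matrix (Fin p ⊕ Fin p) (Fin p ⊕ Fin p) ℝ := Matrix.fromBlocks 0 1 1 0

theorem swapMatrix_mul_self : swapMatrix p * swapMatrix p = 1 := by
  simp [swapMatrix, Matrix.fromBlocks_multiply]

theorem swapMatrix_transpose : (swapMatrix p)ᵀ = swapMatrix p := by
  simp [swapMatrix, Matrix.fromBlocks_transpose]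

theorem signMatrix_mul_swapMatrix :
    signMatrix p p * swapMatrix p = (-1 : ℝ) • (swapMatrix p * signMatrix p p) := by
  have h : signMatrix p p = Matrix.fromBlocks 1 0 0 (-1) := by
    ext i j
    rcases i with i | i <;> rcases j with j | j <;>
      simp [signMatrix_eq, signs, Matrix.diagonal_apply, Matrix.one_apply, ← Matrix.diagonal_one, apply_ite]
  rw [h]
  simp [swapMatrix, Matrix.fromBlocks_multiply, Matrix.fromBlocks_neg]

variable {M : Type*} [TopologicalSpace M] [ChartedSpace (EuclideanSpace ℝ (Fin m)) M]
  [IsManifold (𝓡 m) ∞ M]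

theorem isTwistorBundle_pseudoOrthogonal (g : PseudoRiemannianMetric m M) {lam ell : ℝ}
    (hlam : lam * lam = 1) (hk : lam * ell = -1)
    {s : Matrix (Fin p ⊕ Fin q) (Fin p ⊕ Fin q) ℝ} (hs : s * s = 1) (hst : sᵀ = s)
    (hsη : signMatrix p q * s = lam • (s * signMatrix p q)) (hg : g.HasSignature p q) :
    IsTwistorBundle (twistorSpace g lam ell)
      (entriesPair : pseudoOrthogonal p q × pseudoOrthogonal p q → _) (diagonalHom p q).range
      lam (IsIntegrableStructure g lam ell) := by
  obtain ⟨A⟩ := nonempty_orbitData_pseudoOrthogonal p q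
  exact isTwistorBundle_of_model A (isNaturalFamily_isModelTwistor lam ell) g
    (mem_twistorSpace_iff g lam ell) hg
    (fun f hf hpq => exists_splitCoordinates hlam hk hs hst hsη hf hpq)
    (isIntegrableStructure_iff g lam ell)

/-- The block `A` satisfies `f (A v) (A v) = f v (B A v) = -f v v`, so `f` is equivalent to `-f` and
its positive and negative indices agree. -/
theorem IsModelTwistor.signature_eq {f : ModelMetric m} (hf : f.IsMetric) (hpq : f.HasSig p q)
    {S : EndModel m} (hS : IsModelTwistor (-1) 1 f S) : p = q := by
  obtain ⟨-, hAB, hBA, hadj⟩ := hS.exists_eigenSwap hf (by norm_num)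
  obtain ⟨A, hA⟩ : ∃ A, A = (eigenProj f (-1)).comp (S.comp (eigenIncl f 1)) := ⟨_, rfl⟩
  obtain ⟨B, hB⟩ : ∃ B, B = (eigenProj f 1).comp (S.comp (eigenIncl f (-1))) := ⟨_, rfl⟩
  rw [← hA, ← hB] at hAB hBA hadj
  have h : QuadraticMap.Equivalent f.form.toQuadraticMap (-f.form.toQuadraticMap) := by
    refine ⟨⟨LinearEquiv.ofLinearMap A.toLinearMap (-B).toLinearMap ?_ ?_, fun v => ?_⟩⟩
    · refine LinearMap.ext fun v => ?_
      change A (-B v) = v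
      rw [map_neg, hAB]
      simp
    · refine LinearMap.ext fun v => ?_
      change -B (A v) = v
      rw [hBA]
      simp
    · change -(f (A v) (A v)) = f v v
      rw [hadj, hBA]
      simp
  exact hpq.1.symm.trans (h.sigPos_eq.trans ((sigPos_neg).trans hpq.2))

end SplitBundle

end

noncomputable section

/-! ### The model twistor fibres for `lam ell = 1` -/

section ComplexFrame

variable {m : ℕ} {ι : Type*} [Fintype ι]

theorem ModelMetric.IsMetric.exists_frame_of_card {f : ModelMetric m} (hf : f.IsMetric)
    (hι : Fintype.card ι = m) : ∃ (ε : ι → ℝ) (κ : EuclideanSpace ℝ (Fin m) ≃ₗ[ℝ] (ι → ℝ)),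
      (∀ i, ε i * ε i = 1) ∧ ∀ v w, f v w = ∑ i, ε i * (κ v i * κ w i) := by
  obtain ⟨a, b, κ, hab, hκ⟩ := exists_orthonormal_frame (B := f.form) hf.symm hf.nondegenerate
  have hcard : Fintype.card ι = Fintype.card (Fin a ⊕ Fin b) := by
    rw [hι, Fintype.card_sum, Fintype.card_fin, Fintype.card_fin, hab, finrank_euclideanSpace_fin]
  let e := Fintype.equivOfCardEq hcard
  refine ⟨fun i => signs a b (e i), κ.trans (LinearEquiv.funCongrLeft ℝ ℝ e),
    fun i => signs_mul_self _, fun v w => ?_⟩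
  refine (hκ v w).trans ?_
  rw [← e.sum_comp]
  rfl

theorem exists_mul_self_eq_neg {ε : ℝ} (hε : ε * ε = 1) :
    ∃ c : ℂ, c ≠ 0 ∧ c * c = -(ε : ℂ) := by
  rcases mul_self_eq_one_iff.1 hε with rfl | rfl
  · exact ⟨Complex.I, Complex.I_ne_zero, by simp⟩
  · exact ⟨1, one_ne_zero, by simp⟩

/-- In a frame with `f = ∑ ε_i x_i²` the coordinates are `c_i (κ(u)_i + i κ(f⁻¹ σ)_i)` with `c_i² =
-ε_i`, so the signature disappears over `ℂ`. The minus sign makes the signature form the real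
Hermitian form of the matrix of `S`, without a change of sign. -/
theorem ModelMetric.IsMetric.exists_complexFrame {f : ModelMetric m} (hf : f.IsMetric)
    (hι : Fintype.card ι = m) : ∃ ζ : ExtModel m ≃ₗ[ℝ] (ι → ℂ),
      (∀ X, ζ (modelI f (-1) X) = Complex.I • ζ X) ∧
      ∀ X Y, modelPairing X Y = -(ζ X ⬝ᵥ ζ Y).im := by
  obtain ⟨ε, κ, hε, hκ⟩ := hf.exists_frame_of_card hι
  choose c hc0 hc using fun i => exists_mul_self_eq_neg (hε i)
  let z : ExtModel m →ₗ[ℝ] (ι → ℂ) :=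
    { toFun := fun X i => c i * (κ X.1 i + Complex.I * κ (f.inverse X.2) i)
      map_add' := fun X Y => by
        funext i
        simp only [Prod.fst_add, Prod.snd_add, map_add, Pi.add_apply, Complex.ofReal_add]
        ring
      map_smul' := fun r X => by
        funext i
        simp only [Prod.smul_fst, Prod.smul_snd, map_smul, Pi.smul_apply, smul_eq_mul,
          Complex.ofReal_mul, RingHom.id_apply, Complex.real_smul]
        ring }
  let z' : (ι → ℂ) →ₗ[ℝ] ExtModel m :=
    { toFun := fun w => (κ.symm fun i => (w i / c i).re, f (κ.symm fun i => (w i / c i).im))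
      map_add' := fun w w' => by
        refine Prod.ext (Eq.trans (congrArg κ.symm (funext fun i => ?_)) (map_add κ.symm _ _))
          (Eq.trans (congrArg (fun a => f (κ.symm a)) (funext fun i => ?_))
            ((congrArg f (map_add κ.symm _ _)).trans (map_add f _ _)))
        · simp [add_div]
        · simp [add_div]
      map_smul' := fun r w => by
        refine Prod.ext (Eq.trans (congrArg κ.symm (funext fun i => ?_)) (map_smul κ.symm r _))
          (Eq.trans (congrArg (fun a => f (κ.symm a)) (funext fun i => ?_))
            ((congrArg f (map_smul κ.symm r _)).trans (map_smul f r _)))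
        · simp [mul_div_assoc]
        · simp [mul_div_assoc] }
  have h1 : z ∘ₗ z' = LinearMap.id := by
    refine LinearMap.ext fun w => funext fun i => ?_
    change c i * ((κ (κ.symm fun i => (w i / c i).re) i : ℝ) +
      Complex.I * (κ (f.inverse (f (κ.symm fun i => (w i / c i).im))) i : ℝ)) = w i
    rw [hf.inverse_apply, κ.apply_symm_apply, κ.apply_symm_apply, mul_comm Complex.I,
      Complex.re_add_im, mul_div_cancel₀ _ (hc0 i)]
  have h2 : z' ∘ₗ z = LinearMap.id := by
    refine LinearMap.ext fun X => ?_
    have h3 : ∀ i, c i * ((κ X.1 i : ℂ) + Complex.I * κ (f.inverse X.2) i) / c i =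
        (κ X.1 i : ℂ) + Complex.I * κ (f.inverse X.2) i := fun i => mul_div_cancel_left₀ _ (hc0 i)
    change ((κ.symm fun i =>
      (c i * ((κ X.1 i : ℂ) + Complex.I * κ (f.inverse X.2) i) / c i).re),
      f (κ.symm fun i => (c i * ((κ X.1 i : ℂ) + Complex.I * κ (f.inverse X.2) i) / c i).im)) = X
    simp only [h3]
    refine Prod.ext ?_ ?_
    · simp
    · simp [hf.apply_inverse]
  refine ⟨LinearEquiv.ofLinearMap z z' h1 h2, fun X => funext fun i => ?_, fun X Y => ?_⟩
  · change c i * ((κ ((-1 : ℝ) • f.inverse X.2) i : ℝ) + Complex.I * (κ (f.inverse (f X.1)) i : ℝ)) =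
      Complex.I • (c i * ((κ X.1 i : ℂ) + Complex.I * κ (f.inverse X.2) i))
    rw [hf.inverse_apply, map_smul]
    simp only [Pi.smul_apply, smul_eq_mul, neg_mul, one_mul, Complex.ofReal_neg]
    linear_combination (-(c i) * (κ (f.inverse X.2) i : ℂ)) * Complex.I_mul_I
  · have h3 : modelPairing X Y = f X.1 (f.inverse Y.2) + f (f.inverse X.2) Y.1 := by
      rw [modelPairing, hf.symm X.1, hf.apply_inverse, hf.apply_inverse]
    rw [h3, hκ, hκ, ← Finset.sum_add_distrib]
    change _ = -(∑ i, c i * ((κ X.1 i : ℂ) + Complex.I * κ (f.inverse X.2) i) *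
      (c i * ((κ Y.1 i : ℂ) + Complex.I * κ (f.inverse Y.2) i))).im
    rw [Complex.im_sum, ← Finset.sum_neg_distrib]
    refine Finset.sum_congr rfl fun i _ => ?_
    have h4 : c i * ((κ X.1 i : ℂ) + Complex.I * κ (f.inverse X.2) i) *
        (c i * ((κ Y.1 i : ℂ) + Complex.I * κ (f.inverse Y.2) i)) = -(ε i : ℂ) *
        (((κ X.1 i : ℂ) + Complex.I * κ (f.inverse X.2) i) *
          ((κ Y.1 i : ℂ) + Complex.I * κ (f.inverse Y.2) i)) := by
      rw [← hc i]
      ring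
    rw [h4]
    simp
    ring

/-- The Hermitian matrices `M` with `Mᵀ M = lam`. -/
def hermitianTwistors [DecidableEq ι] (lam : ℝ) : Set (Matrix ι ι ℂ) :=
  {M | Mᴴ = M ∧ Mᵀ * M = (lam : ℂ) • (1 : Matrix ι ι ℂ)}

/-- The antilinear endomorphism with a given matrix. -/
def antilinearEnd (ζ : ExtModel m ≃ₗ[ℝ] (ι → ℂ)) : Matrix ι ι ℂ →ₗ[ℝ] EndModel m where
  toFun M := LinearMap.toContinuousLinearMap
    { toFun := fun X => ζ.symm (M *ᵥ star (ζ X))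
      map_add' := fun X Y => by rw [map_add, star_add, Matrix.mulVec_add, map_add]
      map_smul' := fun r X => by
        have h : star (r • ζ X) = r • star (ζ X) := by
          funext i
          simp
        rw [map_smul, h, Matrix.mulVec_smul, map_smul, RingHom.id_apply] }
  map_add' M N := by
    refine ContinuousLinearMap.ext fun X => ?_
    change ζ.symm ((M + N) *ᵥ star (ζ X)) = ζ.symm (M *ᵥ star (ζ X)) + ζ.symm (N *ᵥ star (ζ X))
    rw [Matrix.add_mulVec, map_add]
  map_smul' r M := by
    refine ContinuousLinearMap.ext fun X => ?_
    change ζ.symm ((r • M) *ᵥ star (ζ X)) = r • ζ.symm (M *ᵥ star (ζ X))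
    rw [Matrix.smul_mulVec, map_smul]

theorem antilinearEnd_apply (ζ : ExtModel m ≃ₗ[ℝ] (ι → ℂ)) (M : Matrix ι ι ℂ) (X : ExtModel m) :
    antilinearEnd ζ M X = ζ.symm (M *ᵥ star (ζ X)) := rfl

theorem apply_antilinearEnd (ζ : ExtModel m ≃ₗ[ℝ] (ι → ℂ)) (M : Matrix ι ι ℂ) (X : ExtModel m) :
    ζ (antilinearEnd ζ M X) = M *ᵥ star (ζ X) := ζ.apply_symm_apply _

variable [DecidableEq ι]

/-- The matrix of an antilinear endomorphism. -/
def antilinearMatrix (ζ : ExtModel m ≃ₗ[ℝ] (ι → ℂ)) : EndModel m →ₗ[ℝ] Matrix ι ι ℂ where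
  toFun S := Matrix.of fun i j => ζ (S (ζ.symm (Pi.single j 1))) i
  map_add' S T := by
    ext i j
    simp
  map_smul' r S := by
    ext i j
    simp

theorem antilinearMatrix_antilinearEnd (ζ : ExtModel m ≃ₗ[ℝ] (ι → ℂ)) (M : Matrix ι ι ℂ) :
    antilinearMatrix ζ (antilinearEnd ζ M) = M := by
  ext i j
  change ζ (antilinearEnd ζ M (ζ.symm (Pi.single j 1))) i = M i j
  rw [apply_antilinearEnd, ζ.apply_symm_apply]
  have h : star (Pi.single j 1 : ι → ℂ) = Pi.single j 1 := by
    rw [← Pi.single_star, star_one]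
  rw [h, Matrix.mulVec_single_one]
  rfl

theorem antilinearEnd_antilinearMatrix {f : ModelMetric m} {ζ : ExtModel m ≃ₗ[ℝ] (ι → ℂ)}
    (hζ : ∀ X, ζ (modelI f (-1) X) = Complex.I • ζ X) {S : EndModel m}
    (hS : ∀ X, S (modelI f (-1) X) = -modelI f (-1) (S X)) :
    antilinearEnd ζ (antilinearMatrix ζ S) = S := by
  refine ContinuousLinearMap.ext fun X => ?_
  rw [antilinearEnd_apply, ζ.symm_apply_eq]
  let T : (ι → ℂ) →ₗ[ℝ] (ι → ℂ) := ζ.toLinearMap ∘ₗ S.toLinearMap ∘ₗ ζ.symm.toLinearMap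
  have hT : ∀ z, T (Complex.I • z) = -(Complex.I • T z) := fun z => by
    change ζ (S (ζ.symm (Complex.I • z))) = -(Complex.I • ζ (S (ζ.symm z)))
    have h1 : ζ.symm (Complex.I • z) = modelI f (-1) (ζ.symm z) := by
      rw [ζ.symm_apply_eq, hζ, ζ.apply_symm_apply]
    rw [h1, hS, map_neg, hζ]
  have hTc : ∀ (c : ℂ) (z : ι → ℂ), T (c • z) = (starRingEnd ℂ c) • T z := fun c z => by
    have h1 : c • z = c.re • z + c.im • (Complex.I • z) := by
      funext i
      simp only [Pi.smul_apply, Pi.add_apply, smul_eq_mul, Complex.real_smul]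
      conv_lhs => rw [← Complex.re_add_im c]
      ring
    rw [h1, map_add, map_smul, map_smul, hT]
    funext i
    simp only [Pi.smul_apply, Pi.add_apply, Pi.neg_apply, smul_eq_mul, Complex.real_smul]
    have h2 : starRingEnd ℂ c = c.re - c.im * Complex.I :=
      Complex.ext (by simp) (by simp)
    rw [h2]
    ring
  have h3 : ζ X = ∑ j, ζ X j • (Pi.single j 1 : ι → ℂ) := by
    funext i
    simp [Finset.sum_apply, Pi.single_apply]
  have h4 : ζ (S X) = T (ζ X) := by
    change _ = ζ (S (ζ.symm (ζ X)))
    rw [ζ.symm_apply_apply]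
  rw [h4]
  conv_rhs => rw [h3, map_sum]
  funext i
  simp only [hTc, Finset.sum_apply, Pi.smul_apply, smul_eq_mul, Matrix.mulVec, dotProduct]
  exact Finset.sum_congr rfl fun j _ => mul_comm _ _

theorem mulVec_dotProduct_star (M : Matrix ι ι ℂ) (z w : ι → ℂ) :
    (M *ᵥ star z) ⬝ᵥ w = star z ⬝ᵥ (Mᵀ *ᵥ w) := by
  rw [Matrix.dotProduct_mulVec, Matrix.vecMul_transpose]

/-- Both sides are sesquilinear in `(z, w)` before imaginary parts are taken, so the identity
compares `Mᵀ` with the entrywise conjugate of `M`. -/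
theorem skew_antilinear_iff (M : Matrix ι ι ℂ) :
    (∀ z w : ι → ℂ, ((M *ᵥ star z) ⬝ᵥ w).im = -(z ⬝ᵥ (M *ᵥ star w)).im) ↔ Mᴴ = M := by
  have hconj : ∀ z w : ι → ℂ, -(z ⬝ᵥ (M *ᵥ star w)).im = (star z ⬝ᵥ (M.map star *ᵥ w)).im :=
    fun z w => by
      have h : star z ⬝ᵥ (M.map star *ᵥ w) = star (z ⬝ᵥ (M *ᵥ star w)) := by
        simp [dotProduct, Matrix.mulVec, Finset.mul_sum, star_sum]
      rw [h]
      simp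
  constructor
  · intro h
    have h1 : ∀ z w : ι → ℂ, star z ⬝ᵥ (Mᵀ *ᵥ w) = star z ⬝ᵥ (M.map star *ᵥ w) := fun z w => by
      have h2 : ∀ w : ι → ℂ, (star z ⬝ᵥ (Mᵀ *ᵥ w)).im = (star z ⬝ᵥ (M.map star *ᵥ w)).im :=
        fun w => by rw [← mulVec_dotProduct_star, h, hconj]
      refine Complex.ext ?_ (h2 w)
      -- Replacing `w` by `i w` turns equality of imaginary parts into equality of real parts.
      have h3 := h2 (Complex.I • w)
      simp only [Matrix.mulVec_smul, dotProduct_smul, smul_eq_mul, Complex.mul_im, Complex.I_re,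
        Complex.I_im, zero_mul, one_mul, zero_add] at h3
      exact h3
    have h2 : Mᵀ = M.map star := by
      ext i j
      have h3 := h1 (Pi.single i 1) (Pi.single j 1)
      have h4 : star (Pi.single i 1 : ι → ℂ) = Pi.single i 1 := by
        rw [← Pi.single_star, star_one]
      rw [h4] at h3
      simpa using h3
    ext i j
    have h3 := congrFun (congrFun h2 i) j
    simp only [Matrix.transpose_apply, Matrix.map_apply] at h3
    rw [Matrix.conjTranspose_apply, h3, star_star]
  · intro h z w
    have h2 : Mᵀ = M.map star := by
      ext i j
      conv_lhs => rw [← h]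
      rfl
    rw [mulVec_dotProduct_star, hconj, h2]

/-- Anticommutation with `I_{-1}` says that `S` is antilinear, `S z = M z̄`. Skew-symmetry then says
that `M` is Hermitian, and `S² = lam` that `M Mᵀ = lam`. -/
theorem exists_complexCoordinates (lam : ℝ) {ell : ℝ} (hk : lam * ell = 1) {f : ModelMetric m}
    (hf : f.IsMetric) (hι : Fintype.card ι = m) :
    ∃ (ζ : ExtModel m ≃ₗ[ℝ] (ι → ℂ)) (P : EndModel m →ₗ[ℝ] Matrix ι ι ℂ)
      (R : Matrix ι ι ℂ →ₗ[ℝ] EndModel m),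
      (∀ S, IsModelTwistor lam ell f S → P S ∈ hermitianTwistors lam ∧ R (P S) = S) ∧
      (∀ M ∈ hermitianTwistors lam, IsModelTwistor lam ell f (R M)) ∧ (∀ M, P (R M) = M) ∧
      ∀ M X, modelSigForm f (R M) X X = ((M *ᵥ star (ζ X)) ⬝ᵥ ζ X).re := by
  obtain ⟨ζ, hζ, hb⟩ := hf.exists_complexFrame (ι := ι) hι
  have hskew : ∀ M : Matrix ι ι ℂ, (∀ X Y, modelPairing (antilinearEnd ζ M X) Y =
      -modelPairing X (antilinearEnd ζ M Y)) ↔ Mᴴ = M := fun M => by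
    rw [← skew_antilinear_iff]
    simp only [hb, apply_antilinearEnd, neg_neg]
    constructor
    · intro h z w
      have h1 := h (ζ.symm z) (ζ.symm w)
      rw [ζ.apply_symm_apply, ζ.apply_symm_apply] at h1
      linarith
    · intro h X Y
      rw [h]
      simp
  -- The square of `z ↦ M z̄` is `M` times its entrywise conjugate, which is `Mᵀ` for Hermitian `M`.
  -- Taking adjoints interchanges `M Mᵀ = lam` and `Mᵀ M = lam`.
  have hsq : ∀ M : Matrix ι ι ℂ, Mᴴ = M → ((∀ X, antilinearEnd ζ M (antilinearEnd ζ M X) = lam • X)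
      ↔ Mᵀ * M = (lam : ℂ) • (1 : Matrix ι ι ℂ)) := fun M hM => by
    have hMt : Mᵀᴴ = Mᵀ := congrArg Matrix.transpose hM
    have h1 : ∀ X, ζ (antilinearEnd ζ M (antilinearEnd ζ M X)) = (M * Mᵀ) *ᵥ ζ X := fun X => by
      rw [apply_antilinearEnd, apply_antilinearEnd, Matrix.star_mulVec, star_star,
        ← Matrix.mulVec_mulVec, hM, Matrix.mulVec_transpose]
    have h2 : Mᵀ * M = (lam : ℂ) • (1 : Matrix ι ι ℂ) ↔ M * Mᵀ = (lam : ℂ) • 1 := by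
      rw [← Matrix.conjTranspose_inj, Matrix.conjTranspose_mul, hM, hMt, Matrix.conjTranspose_smul,
        Matrix.conjTranspose_one]
      simp
    rw [h2]
    constructor
    · intro h
      refine Matrix.ext_of_mulVec_single fun j => ?_
      obtain ⟨X, hX⟩ := ζ.surjective (Pi.single j 1)
      rw [← hX, ← h1, h, map_smul, Matrix.smul_mulVec, Matrix.one_mulVec]
      funext i
      simp
    · intro h X
      apply ζ.injective
      rw [h1, h, map_smul, Matrix.smul_mulVec, Matrix.one_mulVec]
      funext i
      simp
  refine ⟨ζ, antilinearMatrix ζ, antilinearEnd ζ, fun S hS => ?_, fun M hM => ?_,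
    antilinearMatrix_antilinearEnd ζ, fun M X => ?_⟩
  · have hI := hS.apply_modelI
    rw [hk] at hI
    have h1 := antilinearEnd_antilinearMatrix hζ hI
    have h2 := (hskew (antilinearMatrix ζ S)).1 (by rw [h1]; exact hS.skew)
    exact ⟨⟨h2, (hsq _ h2).1 (by rw [h1]; exact hS.apply_apply)⟩, h1⟩
  · refine IsModelTwistor.of_anticommute hf (by rw [hk]; exact one_ne_zero) ((hsq M hM.1).2 hM.2)
      ((hskew M).2 hM.1) fun X => ?_
    apply ζ.injective
    rw [hk, apply_antilinearEnd, map_neg, hζ, hζ, apply_antilinearEnd]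
    have h1 : star (Complex.I • ζ X) = -(Complex.I • star (ζ X)) := by
      funext i
      simp
    rw [h1, Matrix.mulVec_neg, Matrix.mulVec_smul]
  -- An antilinear map takes `i` to `-i`, and `-Im(-i h) = Re h`.
  · change modelPairing (antilinearEnd ζ M (modelI f (-1) X)) X = _
    rw [hb, apply_antilinearEnd, hζ]
    have h1 : star (Complex.I • ζ X) = -(Complex.I • star (ζ X)) := by
      funext i
      simp
    rw [h1, Matrix.mulVec_neg, Matrix.mulVec_smul, neg_dotProduct, smul_dotProduct]
    simp

end ComplexFrame

end

noncomputable section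

/-! ### Normal forms of Hermitian matrices under complex orthogonal matrices -/

section NormalForm

variable {ι : Type*} [Fintype ι] [DecidableEq ι]

/-- The complex matrix `diag (1_a, -1_b)`. -/
def complexSigns (a b : ℕ) : Matrix (Fin a ⊕ Fin b) (Fin a ⊕ Fin b) ℂ :=
  Matrix.diagonal fun i => (signs a b i : ℂ)

theorem complexSigns_mul_self (a b : ℕ) : complexSigns a b * complexSigns a b = 1 := by
  rw [complexSigns, Matrix.diagonal_mul_diagonal]
  simp only [← Complex.ofReal_mul, signs_mul_self, Complex.ofReal_one]
  exact Matrix.diagonal_one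

theorem complexSigns_transpose (a b : ℕ) : (complexSigns a b)ᵀ = complexSigns a b :=
  Matrix.diagonal_transpose _

theorem complexSigns_conjTranspose (a b : ℕ) : (complexSigns a b)ᴴ = complexSigns a b := by
  rw [complexSigns, Matrix.diagonal_conjTranspose]
  congr 1
  funext i
  simp

theorem hermitianTwistors.mul_transpose {lam : ℝ} {M : Matrix ι ι ℂ}
    (hM : M ∈ hermitianTwistors lam) : M * Mᵀ = (lam : ℂ) • (1 : Matrix ι ι ℂ) := by
  have h := congrArg Matrix.conjTranspose hM.2
  have hMt : Mᵀᴴ = Mᵀ := congrArg Matrix.transpose hM.1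
  rw [Matrix.conjTranspose_mul, hM.1, hMt, Matrix.conjTranspose_smul,
    Matrix.conjTranspose_one] at h
  simpa using h

theorem hermitianTwistors.mulVec_star_mulVec_star {lam : ℝ} {M : Matrix ι ι ℂ}
    (hM : M ∈ hermitianTwistors lam) (z : ι → ℂ) : M *ᵥ star (M *ᵥ star z) = (lam : ℂ) • z := by
  rw [Matrix.star_mulVec, star_star, hM.1, ← Matrix.mulVec_transpose, Matrix.mulVec_mulVec,
    hermitianTwistors.mul_transpose hM, Matrix.smul_mulVec, Matrix.one_mulVec]

theorem hermitianTwistors.dotProduct_mulVec_star {lam : ℝ} {M : Matrix ι ι ℂ}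
    (hM : M ∈ hermitianTwistors lam) (z w : ι → ℂ) :
    (M *ᵥ star z) ⬝ᵥ (M *ᵥ star w) = (lam : ℂ) * star (z ⬝ᵥ w) := by
  rw [mulVec_dotProduct_star, Matrix.mulVec_mulVec, hM.2, Matrix.smul_mulVec, Matrix.one_mulVec,
    dotProduct_smul, smul_eq_mul]
  congr 1
  simp [dotProduct]

/-- The map `τ z = M z̄` is an antilinear involution with `τ z · τ w` the conjugate of `z · w`. Its
fixed space is a real form of `ℂ^ι` on which the dot product is real and nondegenerate; the columns
of `C` are an orthonormal basis of it. -/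
theorem hermitianTwistors.exists_real_frame {M : Matrix ι ι ℂ}
    (hM : M ∈ hermitianTwistors 1) : ∃ (a b : ℕ) (C : Matrix ι (Fin a ⊕ Fin b) ℂ),
      Cᵀ * C = complexSigns a b ∧ C * complexSigns a b * Cᵀ = 1 ∧
      M = C * complexSigns a b * Cᴴ := by
  have hMM : ∀ z, M *ᵥ star (M *ᵥ star z) = z := fun z => by
    rw [hermitianTwistors.mulVec_star_mulVec_star hM, Complex.ofReal_one, one_smul]
  have hdot : ∀ z w, (M *ᵥ star z) ⬝ᵥ (M *ᵥ star w) = star (z ⬝ᵥ w) := fun z w => by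
    rw [hermitianTwistors.dotProduct_mulVec_star hM, Complex.ofReal_one, one_mul]
  let V : Submodule ℝ (ι → ℂ) :=
    { carrier := {z | M *ᵥ star z = z}
      add_mem' := fun {z w} hz hw => by
        change M *ᵥ star (z + w) = z + w
        rw [star_add, Matrix.mulVec_add, hz, hw]
      zero_mem' := by
        change M *ᵥ star 0 = 0
        rw [star_zero, Matrix.mulVec_zero]
      smul_mem' := fun r z hz => by
        change M *ᵥ star (r • z) = r • z
        have h : star (r • z) = r • star z := by
          funext i
          simp
        rw [h, Matrix.mulVec_smul, hz] }
  have hV : ∀ z : V, M *ᵥ star (z : ι → ℂ) = z := fun z => z.2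
  have hadd : ∀ y, y + M *ᵥ star y ∈ V := fun y => by
    change M *ᵥ star (y + M *ᵥ star y) = y + M *ᵥ star y
    rw [star_add, Matrix.mulVec_add, hMM, add_comm]
  have hsub : ∀ y, -(Complex.I • (y - M *ᵥ star y)) ∈ V := fun y => by
    change M *ᵥ star (-(Complex.I • (y - M *ᵥ star y))) = -(Complex.I • (y - M *ᵥ star y))
    have h : star (-(Complex.I • (y - M *ᵥ star y))) = Complex.I • (star y - star (M *ᵥ star y)) := by
      funext i
      simp
    rw [h, Matrix.mulVec_smul, Matrix.mulVec_sub, hMM, ← smul_neg, neg_sub]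
  let B : LinearMap.BilinForm ℝ V := LinearMap.mk₂ ℝ
    (fun z w => ((z : ι → ℂ) ⬝ᵥ (w : ι → ℂ)).re)
    (fun z z' w => by simp) (fun c z w => by simp) (fun z w w' => by simp) (fun c z w => by simp)
  have hB : ∀ z w : V, (z : ι → ℂ) ⬝ᵥ (w : ι → ℂ) = (B z w : ℝ) := fun z w => by
    have h := hdot z w
    rw [hV, hV] at h
    exact (Complex.conj_eq_iff_re.1 h.symm).symm
  -- For `z` fixed by `τ`, pairing with `y + τ y` gives `2 Re (z · y)`. So vanishing on the real
  -- form gives vanishing of `Re (z · y)` for all `y`, and `y = z̄` gives `∑ |z_i|² = 0`.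
  have hnd : ∀ z : V, (∀ w, B z w = 0) → z = 0 := fun z hz => by
    have h1 : ∀ y : ι → ℂ, ((z : ι → ℂ) ⬝ᵥ y).re = 0 := fun y => by
      have h2 : ((z : ι → ℂ) ⬝ᵥ (y + M *ᵥ star y)).re = 0 := hz ⟨_, hadd y⟩
      have h3 : (z : ι → ℂ) ⬝ᵥ (M *ᵥ star y) = star ((z : ι → ℂ) ⬝ᵥ y) := by
        rw [← hdot, hV]
      rw [dotProduct_add, h3, Complex.add_re] at h2
      have h4 : (star ((z : ι → ℂ) ⬝ᵥ y)).re = ((z : ι → ℂ) ⬝ᵥ y).re := Complex.conj_re _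
      rw [h4] at h2
      linarith
    have h2 := h1 (star (z : ι → ℂ))
    have h3 : ((z : ι → ℂ) ⬝ᵥ star (z : ι → ℂ)).re = ∑ i, Complex.normSq ((z : ι → ℂ) i) := by
      simp [dotProduct, Complex.mul_conj]
    rw [h3, Finset.sum_eq_zero_iff_of_nonneg fun i _ => Complex.normSq_nonneg _] at h2
    refine Subtype.ext (funext fun i => ?_)
    exact Complex.normSq_eq_zero.1 (h2 i (Finset.mem_univ i))
  obtain ⟨a, b, κ, -, hκ⟩ := exists_orthonormal_frame (B := B)
    (fun v w => congrArg Complex.re (dotProduct_comm _ _)) hnd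
  let C : Matrix ι (Fin a ⊕ Fin b) ℂ := Matrix.of fun i k => (κ.symm (Pi.single k 1) : ι → ℂ) i
  have hC : ∀ (z : V) (k : Fin a ⊕ Fin b), (Cᵀ *ᵥ (z : ι → ℂ)) k = (signs a b k * κ z k : ℝ) :=
    fun z k => by
      change (κ.symm (Pi.single k 1) : ι → ℂ) ⬝ᵥ (z : ι → ℂ) = _
      rw [hB, hκ, κ.apply_symm_apply]
      congr 1
      rw [Finset.sum_eq_single k]
      · rw [Pi.single_eq_same, one_mul]
      · intro j _ hj
        rw [Pi.single_eq_of_ne hj, zero_mul, mul_zero]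
      · exact fun h => absurd (Finset.mem_univ k) h
  have h1 : Cᵀ * C = complexSigns a b := by
    ext k l
    change (Cᵀ *ᵥ (κ.symm (Pi.single l 1) : ι → ℂ)) k = _
    rw [hC, κ.apply_symm_apply, complexSigns, Matrix.diagonal_apply, Pi.single_apply]
    split_ifs <;> simp
  -- The matrix `C η Cᵀ` expands a fixed vector in the frame, so it is the identity on the real
  -- form, and then everywhere by complex linearity.
  have h2 : ∀ z : V, (C * complexSigns a b * Cᵀ) *ᵥ (z : ι → ℂ) = z := fun z => by
    have h3 : complexSigns a b *ᵥ (Cᵀ *ᵥ (z : ι → ℂ)) = fun k => (κ z k : ℂ) := by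
      funext k
      rw [complexSigns, Matrix.mulVec_diagonal, hC, ← Complex.ofReal_mul, ← mul_assoc,
        signs_mul_self, one_mul]
    rw [← Matrix.mulVec_mulVec, ← Matrix.mulVec_mulVec, h3]
    have h4 : z = ∑ k, κ z k • κ.symm (Pi.single k 1) := by
      apply κ.injective
      rw [map_sum κ]
      funext j
      simp [Finset.sum_apply, Pi.single_apply]
    have h5 : (z : ι → ℂ) = ∑ k, ((κ z k • κ.symm (Pi.single k 1) : V) : ι → ℂ) := by
      conv_lhs => rw [h4]
      exact map_sum V.subtype _ _
    funext i
    have h6 := congrFun h5 i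
    rw [Finset.sum_apply] at h6
    refine Eq.trans ?_ h6.symm
    change ∑ k, C i k * (κ z k : ℂ) = _
    refine Finset.sum_congr rfl fun k _ => ?_
    change (κ.symm (Pi.single k 1) : ι → ℂ) i * (κ z k : ℂ) =
      κ z k • (κ.symm (Pi.single k 1) : ι → ℂ) i
    rw [Complex.real_smul, mul_comm]
  have h3 : C * complexSigns a b * Cᵀ = 1 := by
    refine Matrix.ext_of_mulVec_single fun j => ?_
    obtain ⟨y, hy⟩ : ∃ y : ι → ℂ, y = Pi.single j 1 := ⟨_, rfl⟩
    rw [← hy, Matrix.one_mulVec]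
    -- Real and imaginary parts of `y` with respect to `τ`: both `y + τ y` and `-i (y - τ y)` are
    -- fixed by `τ`.
    have h4 : y = (1 / 2 : ℂ) • ((y + M *ᵥ star y) +
        Complex.I • (-(Complex.I • (y - M *ᵥ star y)))) := by
      rw [smul_neg, smul_smul, Complex.I_mul_I, neg_one_smul, neg_neg, add_add_sub_cancel,
        ← two_smul ℂ, smul_smul]
      norm_num
    rw [h4, Matrix.mulVec_smul, Matrix.mulVec_add, Matrix.mulVec_smul, h2 ⟨_, hadd y⟩,
      h2 ⟨_, hsub y⟩]
  refine ⟨a, b, C, h1, h3, ?_⟩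
  have h4 : Cᵀᴴ * complexSigns a b * Cᴴ = 1 := by
    have h5 := congrArg Matrix.conjTranspose h3
    rwa [Matrix.conjTranspose_mul, Matrix.conjTranspose_mul, complexSigns_conjTranspose,
      Matrix.conjTranspose_one, ← Matrix.mul_assoc] at h5
  -- The columns of `C` are fixed by `τ`; here `Cᵀᴴ` is the entrywise conjugate.
  have h5 : M * Cᵀᴴ = C := by
    ext i k
    exact congrFun (hV (κ.symm (Pi.single k 1))) i
  calc M = M * (Cᵀᴴ * complexSigns a b * Cᴴ) := by rw [h4, mul_one]
    _ = M * Cᵀᴴ * complexSigns a b * Cᴴ := by simp only [Matrix.mul_assoc]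
    _ = _ := by rw [h5]

theorem hasSignature_of_weights {V J : Type*} [AddCommGroup V] [Module ℝ V] [Fintype J]
    {B : LinearMap.BilinForm ℝ V} (w : J → ℝ) (κ : V ≃ₗ[ℝ] (J → ℝ))
    (hκ : ∀ v, B v v = ∑ j, w j * (κ v j * κ v j)) :
    HasSignature B {j | 0 < w j}.ncard {j | w j < 0}.ncard := by
  have h : QuadraticMap.Equivalent B.toQuadraticMap (QuadraticMap.weightedSumSquares ℝ w) := by
    refine ⟨⟨κ, fun v => ?_⟩⟩
    rw [QuadraticMap.weightedSumSquares_apply]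
    exact (hκ v).symm
  exact ⟨QuadraticForm.sigPos_of_equiv_weightedSumSquares h,
    QuadraticForm.sigNeg_of_equiv_weightedSumSquares h⟩

theorem card_eq_of_complex_frame {a b : ℕ} {C : Matrix ι (Fin a ⊕ Fin b) ℂ}
    (h1 : Cᵀ * C = complexSigns a b) (h2 : C * complexSigns a b * Cᵀ = 1) :
    Fintype.card ι = a + b := by
  have h3 : complexSigns a b * Cᵀ * C = 1 := by
    rw [Matrix.mul_assoc, h1, complexSigns_mul_self]
  have h4 := Matrix.square_of_invertible C (complexSigns a b * Cᵀ) (by rw [← Matrix.mul_assoc, h2]) h3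
  simpa using h4

/-- In the coordinates `y = Cᵀ ζ` the form is `∑ ε_k |y_k|²`, and each complex coordinate
contributes two real squares of the same sign. -/
theorem hasSignature_of_complex_frame {V : Type*} [AddCommGroup V] [Module ℝ V]
    {B : LinearMap.BilinForm ℝ V} (ζ : V ≃ₗ[ℝ] (ι → ℂ)) {M : Matrix ι ι ℂ}
    (hB : ∀ v, B v v = ((M *ᵥ star (ζ v)) ⬝ᵥ ζ v).re) {a b : ℕ} {C : Matrix ι (Fin a ⊕ Fin b) ℂ}
    (h1 : Cᵀ * C = complexSigns a b) (h2 : C * complexSigns a b * Cᵀ = 1)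
    (hM : M = C * complexSigns a b * Cᴴ) : HasSignature B (2 * a) (2 * b) := by
  let τ : (ι → ℂ) ≃ₗ[ℝ] (Fin a ⊕ Fin b → ℂ) := LinearEquiv.ofLinearMap
    (Cᵀ.mulVecLin.restrictScalars ℝ) ((C * complexSigns a b).mulVecLin.restrictScalars ℝ)
    (LinearMap.ext fun y => by
      change Cᵀ *ᵥ ((C * complexSigns a b) *ᵥ y) = y
      rw [Matrix.mulVec_mulVec, ← Matrix.mul_assoc, h1, complexSigns_mul_self, Matrix.one_mulVec])
    (LinearMap.ext fun y => by
      change (C * complexSigns a b) *ᵥ (Cᵀ *ᵥ y) = y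
      rw [Matrix.mulVec_mulVec, h2, Matrix.one_mulVec])
  let κ : V ≃ₗ[ℝ] ((Fin a ⊕ Fin b) × Fin 2 → ℝ) := ζ.trans (τ.trans
    ((LinearEquiv.piCongrRight fun _ => Complex.basisOneI.equivFun).trans
      (LinearEquiv.curry ℝ ℝ (Fin a ⊕ Fin b) (Fin 2)).symm))
  have hκ : ∀ v k j, κ v (k, j) = Complex.basisOneI.equivFun ((Cᵀ *ᵥ ζ v) k) j :=
    fun v k j => rfl
  have h := hasSignature_of_weights (B := B) (fun j => signs a b j.1) κ fun v => by
    rw [hB, Fintype.sum_prod_type]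
    have h3 : (M *ᵥ star (ζ v)) ⬝ᵥ ζ v =
        ∑ k, (signs a b k : ℂ) * (star ((Cᵀ *ᵥ ζ v) k) * (Cᵀ *ᵥ ζ v) k) := by
      have h4 : Cᴴ *ᵥ star (ζ v) = star (Cᵀ *ᵥ ζ v) := by
        rw [Matrix.star_mulVec, ← Matrix.mulVec_transpose]
        rfl
      rw [hM, ← Matrix.mulVec_mulVec, h4, ← Matrix.mulVec_mulVec, dotProduct_comm,
        Matrix.dotProduct_mulVec, ← Matrix.mulVec_transpose]
      refine Finset.sum_congr rfl fun k _ => ?_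
      rw [complexSigns, Matrix.mulVec_diagonal, Pi.star_apply]
      ring
    rw [h3, Complex.re_sum]
    refine Finset.sum_congr rfl fun k _ => ?_
    rw [Fin.sum_univ_two, hκ, hκ]
    simp
    ring
  have hc : ∀ s : Set (Fin a ⊕ Fin b), {j : (Fin a ⊕ Fin b) × Fin 2 | j.1 ∈ s}.ncard = 2 * s.ncard :=
    fun s => by
      have h5 : {j : (Fin a ⊕ Fin b) × Fin 2 | j.1 ∈ s} = s ×ˢ Set.univ := by
        ext j
        simp
      rw [h5, Set.ncard_prod, Set.ncard_univ, Nat.card_fin, mul_comm]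
  have hp := hc {k | 0 < signs a b k}
  have hn := hc {k | signs a b k < 0}
  rw [ncard_signs_pos] at hp
  rw [ncard_signs_neg] at hn
  exact ⟨h.1.trans hp, h.2.trans hn⟩

end NormalForm

end

noncomputable section

/-! ### The quaternionic normal form -/

section Quaternionic

variable {ι : Type*} [Fintype ι] [DecidableEq ι]

/-- The Hermitian matrix `i J`, where `J` is the standard complex structure. -/
def hermitianJ (k : Type*) [DecidableEq k] : Matrix (k ⊕ k) (k ⊕ k) ℂ :=
  Matrix.fromBlocks 0 (-(Complex.I • 1)) (Complex.I • 1) 0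

theorem hermitianJ_mul_self (k : Type*) [Fintype k] [DecidableEq k] :
    hermitianJ k * hermitianJ k = 1 := by
  simp [hermitianJ, Matrix.fromBlocks_multiply, smul_smul]

theorem hermitianJ_conjTranspose (k : Type*) [DecidableEq k] : (hermitianJ k)ᴴ = hermitianJ k := by
  simp [hermitianJ, Matrix.fromBlocks_conjTranspose]

theorem hermitianJ_transpose (k : Type*) [DecidableEq k] :
    (hermitianJ k)ᵀ = ((-1 : ℝ) : ℂ) • hermitianJ k := by
  simp [hermitianJ, Matrix.fromBlocks_transpose, Matrix.fromBlocks_neg]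

theorem card_le_of_mul_eq_one {κ : Type*} [Fintype κ] [DecidableEq κ] {N : Matrix κ ι ℂ}
    {X : Matrix ι κ ℂ} (h : N * X = 1) : Fintype.card κ ≤ Fintype.card ι := by
  have hinj : Function.Injective X.mulVecLin := fun v w hvw => by
    have h1 : N *ᵥ (X *ᵥ v) = N *ᵥ (X *ᵥ w) := congrArg (N *ᵥ ·) hvw
    rwa [Matrix.mulVec_mulVec, Matrix.mulVec_mulVec, h, Matrix.one_mulVec, Matrix.one_mulVec] at h1
  simpa using LinearMap.finrank_le_finrank_of_injective hinj

/-! ### Eigenvectors of a Hermitian matrix with `Mᵀ M = -1` -/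

section Eigenframe

variable {κ : Type*} [Fintype κ] [DecidableEq κ] {M : Matrix ι ι ℂ}
  (hM : M ∈ hermitianTwistors (-1)) {u : Matrix ι κ ℂ} {d : κ → ℝ} (huu : uᴴ * u = 1)
  (hMu : M * u = u * Matrix.diagonal fun i => (d i : ℂ))

omit [DecidableEq ι] [Fintype κ] in
theorem conjTranspose_diagonal_ofReal (d : κ → ℝ) :
    (Matrix.diagonal fun i => (d i : ℂ))ᴴ = Matrix.diagonal fun i => (d i : ℂ) := by
  rw [Matrix.diagonal_conjTranspose]
  congr 1
  funext i
  simp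

include hM hMu

/-- Conjugating `M u = u D` gives `Mᵀ ū = ū D`, and `M Mᵀ = -1` then gives `M ū D = -ū`. So
conjugation takes an eigenvector with eigenvalue `d` to one with eigenvalue `-1/d`. -/
theorem mul_conj_mul_diagonal :
    M * uᵀᴴ * Matrix.diagonal (fun i => (d i : ℂ)) = -uᵀᴴ := by
  have hMt : Mᵀᴴ = Mᵀ := congrArg Matrix.transpose hM.1
  have h1 := congrArg (fun N : Matrix ι κ ℂ => Nᵀᴴ) hMu
  simp only [Matrix.transpose_mul, Matrix.conjTranspose_mul, Matrix.diagonal_transpose,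
    conjTranspose_diagonal_ofReal, hMt] at h1
  rw [Matrix.mul_assoc, ← h1, ← Matrix.mul_assoc, hermitianTwistors.mul_transpose hM,
    Matrix.smul_mul, Matrix.one_mul]
  simp

/-- If `d_i d_j > 0`, then `u_j` and the conjugate of `u_i` have distinct eigenvalues `d_j` and
`-1/d_i`, so they are Hermitian orthogonal. In formulas, `(d_i d_j + 1) (uᵀ u)_{ij} = 0`. -/
theorem transpose_mul_eq_zero (hd : ∀ i j, 0 < d i * d j) : uᵀ * u = 0 := by
  have h1 := congrArg Matrix.conjTranspose (mul_conj_mul_diagonal hM hMu)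
  rw [Matrix.conjTranspose_mul, Matrix.conjTranspose_mul, Matrix.conjTranspose_conjTranspose,
    conjTranspose_diagonal_ofReal, hM.1, Matrix.conjTranspose_neg,
    Matrix.conjTranspose_conjTranspose] at h1
  have h2 := congrArg (fun N => N * u) h1
  simp only [Matrix.mul_assoc, hMu, Matrix.neg_mul] at h2
  ext i j
  have h3 := congrFun (congrFun h2 i) j
  rw [← Matrix.mul_assoc uᵀ, ← Matrix.mul_assoc, Matrix.mul_diagonal, Matrix.diagonal_mul,
    Matrix.neg_apply] at h3
  have h4 : ((d i * d j + 1 : ℝ) : ℂ) * (uᵀ * u) i j = 0 := by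
    push_cast
    linear_combination h3
  have h5 : ((d i * d j + 1 : ℝ) : ℂ) ≠ 0 := by
    rw [Complex.ofReal_ne_zero]
    have := hd i j
    positivity
  exact (mul_eq_zero.1 h4).resolve_left h5

include huu

/-- The columns of `u` and their conjugates together are orthonormal for the Hermitian inner
product. -/
theorem two_mul_card_le (hd : ∀ i j, 0 < d i * d j) : 2 * Fintype.card κ ≤ Fintype.card ι := by
  have h1 := transpose_mul_eq_zero hM hMu hd
  have h2 : uᴴ * uᵀᴴ = 0 := by
    have h3 := congrArg Matrix.conjTranspose h1
    rwa [Matrix.conjTranspose_mul, Matrix.conjTranspose_zero] at h3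
  have h3 : uᵀ * uᵀᴴ = 1 := by
    have h4 := congrArg Matrix.transpose huu
    rwa [Matrix.transpose_mul, Matrix.transpose_one] at h4
  have h4 : Matrix.fromRows uᴴ uᵀ * Matrix.fromCols u uᵀᴴ = 1 := by
    rw [Matrix.fromRows_mul_fromCols, huu, h1, h2, h3, Matrix.fromBlocks_one]
  have h5 := card_le_of_mul_eq_one h4
  rw [Fintype.card_sum] at h5
  omega

/-- The isotropic vectors `u_i` and their conjugates form hyperbolic planes for the complex
symmetric form. Suitable sums and differences are orthonormal vectors which `z ↦ M z̄` permutes in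
the standard quaternionic way. -/
theorem exists_quaternionic_frame (hd : ∀ i, 0 < d i) : ∃ A : Matrix ι (κ ⊕ κ) ℂ,
    Aᵀ * A = 1 ∧ M * Aᵀᴴ = A * hermitianJ κ := by
  have h1 := transpose_mul_eq_zero hM hMu fun i j => mul_pos (hd i) (hd j)
  obtain ⟨N, hN⟩ : ∃ N, N = uᵀᴴ := ⟨_, rfl⟩
  have hMN := mul_conj_mul_diagonal hM hMu
  have hNN : Nᵀ * N = 0 := by
    have h3 := congrArg (fun Z : Matrix κ κ ℂ => Zᵀᴴ) h1
    simp only [Matrix.conjTranspose_mul, Matrix.transpose_mul, Matrix.transpose_zero,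
      Matrix.conjTranspose_zero] at h3
    rw [hN]
    exact h3
  have huN : uᵀ * N = 1 := by
    have h4 := congrArg Matrix.transpose huu
    rw [Matrix.transpose_mul, Matrix.transpose_one] at h4
    rw [hN]
    exact h4
  have hNu : Nᵀ * u = 1 := by
    rw [hN]
    exact huu
  -- Normalization `y = (2d)^{-1/2}`: the vectors `d y u ± y ū` have square `± 2 d y² = ± 1`.
  obtain ⟨y, hy⟩ : ∃ y : κ → ℝ, ∀ i, d i * y i * y i = 1 / 2 := by
    refine ⟨fun i => (Real.sqrt (2 * d i))⁻¹, fun i => ?_⟩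
    have h5 : Real.sqrt (2 * d i) * Real.sqrt (2 * d i) = 2 * d i :=
      Real.mul_self_sqrt (by have := hd i; positivity)
    rw [mul_assoc, ← mul_inv, h5]
    have := (hd i).ne'
    field_simp
  obtain ⟨D, hD⟩ : ∃ D : Matrix κ κ ℂ, D = Matrix.diagonal fun i => (d i : ℂ) := ⟨_, rfl⟩
  obtain ⟨Y, hY⟩ : ∃ Y : Matrix κ κ ℂ, Y = Matrix.diagonal fun i => (y i : ℂ) := ⟨_, rfl⟩
  obtain ⟨E, hE⟩ : ∃ E : Matrix κ κ ℂ, E = Matrix.diagonal fun i => ((d i * y i : ℝ) : ℂ) :=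
    ⟨_, rfl⟩
  have hDY : D * Y = E := by
    rw [hD, hY, hE, Matrix.diagonal_mul_diagonal]
    simp
  have hEY : E * Y = (1 / 2 : ℂ) • (1 : Matrix κ κ ℂ) := by
    rw [hE, hY, Matrix.diagonal_mul_diagonal, Matrix.smul_one_eq_diagonal]
    congr 1
    funext i
    rw [← Complex.ofReal_mul, hy]
    simp
  have hYE : Y * E = (1 / 2 : ℂ) • (1 : Matrix κ κ ℂ) := by
    rw [hE, hY, Matrix.diagonal_mul_diagonal, Matrix.smul_one_eq_diagonal]
    congr 1
    funext i
    rw [← Complex.ofReal_mul, mul_comm, hy]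
    simp
  have hEt : Eᵀ = E := by rw [hE, Matrix.diagonal_transpose]
  have hYt : Yᵀ = Y := by rw [hY, Matrix.diagonal_transpose]
  have hEh : Eᴴ = E := by rw [hE]; exact conjTranspose_diagonal_ofReal _
  have hYh : Yᴴ = Y := by rw [hY]; exact conjTranspose_diagonal_ofReal _
  have hNh : Nᵀᴴ = u := by rw [hN]; exact Matrix.conjTranspose_conjTranspose u
  have key : ∀ s t : ℂ, (u * E + s • (N * Y))ᵀ * (u * E + t • (N * Y)) =
      ((s + t) / 2) • (1 : Matrix κ κ ℂ) := fun s t => by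
    rw [Matrix.transpose_add, Matrix.transpose_smul, Matrix.transpose_mul, Matrix.transpose_mul,
      hEt, hYt, Matrix.add_mul, Matrix.mul_add, Matrix.mul_add]
    have e1 : E * uᵀ * (u * E) = 0 := by
      rw [Matrix.mul_assoc, ← Matrix.mul_assoc uᵀ, h1, Matrix.zero_mul, Matrix.mul_zero]
    have e2 : E * uᵀ * (t • (N * Y)) = t • (1 / 2 : ℂ) • (1 : Matrix κ κ ℂ) := by
      rw [Matrix.mul_smul, Matrix.mul_assoc, ← Matrix.mul_assoc uᵀ, huN, Matrix.one_mul, hEY]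
    have e3 : s • (Y * Nᵀ) * (u * E) = s • (1 / 2 : ℂ) • (1 : Matrix κ κ ℂ) := by
      rw [Matrix.smul_mul, Matrix.mul_assoc, ← Matrix.mul_assoc Nᵀ, hNu, Matrix.one_mul, hYE]
    have e4 : s • (Y * Nᵀ) * (t • (N * Y)) = 0 := by
      rw [Matrix.smul_mul, Matrix.mul_smul, Matrix.mul_assoc, ← Matrix.mul_assoc Nᵀ, hNN,
        Matrix.zero_mul, Matrix.mul_zero, smul_zero, smul_zero]
    rw [e1, e2, e3, e4, zero_add, add_zero, smul_smul, smul_smul, ← add_smul]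
    congr 1
    ring
  have hMNE : M * (N * E) = -(N * Y) := by
    rw [← hDY, ← Matrix.mul_assoc, ← Matrix.mul_assoc, hN, hD, hMN, Matrix.neg_mul]
  have hMuY : M * (u * Y) = u * E := by
    rw [← Matrix.mul_assoc, hMu, ← hD, Matrix.mul_assoc, hDY]
  have hconj : ∀ s : ℂ, (u * E + s • (N * Y))ᵀᴴ = N * E + star s • (u * Y) := fun s => by
    rw [Matrix.transpose_add, Matrix.transpose_smul, Matrix.transpose_mul, Matrix.transpose_mul,
      hEt, hYt, Matrix.conjTranspose_add, Matrix.conjTranspose_smul, Matrix.conjTranspose_mul,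
      Matrix.conjTranspose_mul, hEh, hYh, hNh, ← hN]
  -- The columns of `a` have square `1`, those of `b` have square `-1`, and they are orthogonal. The
  -- antilinear map sends `a` to `b` and `b` to `-a`.
  obtain ⟨a, ha⟩ : ∃ a, a = u * E + (1 : ℂ) • (N * Y) := ⟨_, rfl⟩
  obtain ⟨b, hb⟩ : ∃ b, b = u * E + (-1 : ℂ) • (N * Y) := ⟨_, rfl⟩
  have hMa : M * aᵀᴴ = b := by
    rw [ha, hconj, Matrix.mul_add, hMNE, star_one, one_smul, hMuY, hb, neg_one_smul, add_comm]
  have hMb : M * bᵀᴴ = -a := by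
    rw [hb, hconj, Matrix.mul_add, hMNE, star_neg, star_one, Matrix.mul_smul, hMuY, ha,
      neg_one_smul, one_smul, neg_add, add_comm]
  have hI : Complex.I * Complex.I = -1 := Complex.I_mul_I
  -- The factor `-i` corrects the square of the second half to `1`; since the map is antilinear,
  -- this turns its matrix `J` into `i J`.
  refine ⟨Matrix.fromCols a (-(Complex.I • b)), ?_, ?_⟩
  · rw [Matrix.transpose_fromCols, Matrix.fromRows_mul_fromCols, ← Matrix.fromBlocks_one,
      Matrix.fromBlocks_inj]
    refine ⟨?_, ?_, ?_, ?_⟩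
    · rw [ha, key]
      norm_num
    · rw [Matrix.mul_neg, Matrix.mul_smul, ha, hb, key]
      norm_num
    · rw [Matrix.transpose_neg, Matrix.transpose_smul, Matrix.neg_mul, Matrix.smul_mul, ha, hb, key]
      norm_num
    · rw [Matrix.transpose_neg, Matrix.transpose_smul, Matrix.neg_mul, Matrix.mul_neg, neg_neg, Matrix.smul_mul,
        Matrix.mul_smul, hb, key, smul_smul, smul_smul, hI]
      norm_num
  · rw [hermitianJ, Matrix.fromCols_mul_fromBlocks, Matrix.transpose_fromCols,
      Matrix.conjTranspose_fromRows_eq_fromCols_conjTranspose, Matrix.mul_fromCols, hMa,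
      Matrix.transpose_neg, Matrix.transpose_smul, Matrix.conjTranspose_neg,
      Matrix.conjTranspose_smul, Matrix.mul_neg, Matrix.mul_smul, hMb]
    congr 1
    · simp [smul_smul]
    · simp

end Eigenframe

/-- No eigenvalue of `M` vanishes. The positive and the negative eigenvectors each span at most half
of the space and together all of it, so each span exactly half, and the positive ones provide the
frame. -/
theorem hermitianTwistors.exists_quaternionic_frame {M : Matrix ι ι ℂ}
    (hM : M ∈ hermitianTwistors (-1)) : ∃ (k : ℕ) (A : Matrix ι (Fin k ⊕ Fin k) ℂ),
      Fintype.card ι = 2 * k ∧ Aᵀ * A = 1 ∧ M * Aᵀᴴ = A * hermitianJ (Fin k) := by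
  have hH : M.IsHermitian := hM.1
  obtain ⟨U, hU⟩ : ∃ U : Matrix ι ι ℂ, U = hH.eigenvectorUnitary := ⟨_, rfl⟩
  obtain ⟨μ, hμ⟩ : ∃ μ, μ = hH.eigenvalues := ⟨_, rfl⟩
  have hUU : Uᴴ * U = 1 := by rw [hU]; exact Unitary.coe_star_mul_self _
  have hMU : M * U = U * Matrix.diagonal fun i => (μ i : ℂ) := by
    ext i j
    have h1 := congrFun (hH.mulVec_eigenvectorBasis j) i
    rw [Matrix.mul_diagonal, hU, hμ, mul_comm]
    exact h1
  -- A zero eigenvalue would contradict the invertibility of `M` expressed by `Mᵀ M = -1`.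
  have hμ0 : ∀ i, μ i ≠ 0 := fun i hi => by
    have h1 : M * U * Matrix.diagonal (Pi.single i 1) = 0 := by
      rw [hMU, Matrix.mul_assoc, Matrix.diagonal_mul_diagonal]
      have h2 : (fun j => (μ j : ℂ) * (Pi.single i 1 : ι → ℂ) j) = 0 := by
        funext j
        by_cases hj : j = i
        · rw [hj, hi]; simp
        · simp [hj]
      rw [h2]
      simp
    have h2 : Uᴴ * (-(Mᵀ * (M * U * Matrix.diagonal (Pi.single i 1)))) =
        Matrix.diagonal (Pi.single i 1) := by
      rw [← Matrix.mul_assoc Mᵀ, ← Matrix.mul_assoc Mᵀ, hM.2, Matrix.smul_mul, Matrix.smul_mul,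
        Matrix.one_mul, Complex.ofReal_neg, Complex.ofReal_one, neg_one_smul, neg_neg,
        ← Matrix.mul_assoc, hUU, Matrix.one_mul]
    rw [h1, Matrix.mul_zero, neg_zero, Matrix.mul_zero] at h2
    have h3 := congrFun (congrFun h2 i) i
    simp at h3
  have hsub : ∀ {κ : Type} [Fintype κ] [DecidableEq κ] (e : κ → ι), Function.Injective e →
      (U.submatrix id e)ᴴ * U.submatrix id e = 1 ∧
      M * U.submatrix id e = U.submatrix id e * Matrix.diagonal fun i => (μ (e i) : ℂ) :=
    fun {κ} _ _ e he => by
      constructor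
      · rw [Matrix.conjTranspose_submatrix,
          ← Matrix.submatrix_mul _ _ e id e Function.bijective_id, hUU, Matrix.submatrix_one e he]
      · ext i j
        rw [Matrix.mul_diagonal]
        have h1 := congrFun (congrFun hMU i) (e j)
        rw [Matrix.mul_diagonal] at h1
        exact h1
  obtain ⟨k, ⟨ep⟩⟩ : ∃ k, Nonempty (Fin k ≃ {i // 0 < μ i}) :=
    ⟨_, ⟨(Fintype.equivFin _).symm⟩⟩
  obtain ⟨l, ⟨en⟩⟩ : ∃ l, Nonempty (Fin l ≃ {i // ¬ 0 < μ i}) :=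
    ⟨_, ⟨(Fintype.equivFin _).symm⟩⟩
  have hcard : k + l = Fintype.card ι := by
    have h1 := Fintype.card_congr ((ep.sumCongr en).trans (Equiv.sumCompl fun i => 0 < μ i))
    simpa using h1
  have hp := hsub (fun i => (ep i : ι)) (Subtype.val_injective.comp ep.injective)
  have hn := hsub (fun i => (en i : ι)) (Subtype.val_injective.comp en.injective)
  have hneg : ∀ i, μ (en i) < 0 := fun i => lt_of_le_of_ne (not_lt.1 (en i).2) (hμ0 _)
  have h1 := two_mul_card_le hM hp.1 hp.2 fun i j => mul_pos (ep i).2 (ep j).2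
  have h2 := two_mul_card_le hM hn.1 hn.2 fun i j => mul_pos_of_neg_of_neg (hneg i) (hneg j)
  rw [Fintype.card_fin] at h1 h2
  obtain ⟨A, hA⟩ := _root_.exists_quaternionic_frame hM hp.1 hp.2 fun i => (ep i).2
  exact ⟨k, A, by omega, hA⟩

end Quaternionic

end

noncomputable section

/-! ### Quotients of the complex orthogonal group -/

section ComplexOrthogonal

variable {ι : Type*} [Fintype ι] [DecidableEq ι]

/-- The adjoint `N Aᴴ N` with respect to the Hermitian form `N` with `N² = 1`. -/
def hermitianAdjoint (N : Matrix ι ι ℂ) : Matrix ι ι ℂ →ₗ[ℝ] Matrix ι ι ℂ where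
  toFun A := N * Aᴴ * N
  map_add' A C := by rw [Matrix.conjTranspose_add, mul_add, add_mul]
  map_smul' c A := by
    rw [Matrix.conjTranspose_smul, mul_smul_comm, smul_mul_assoc, RingHom.id_apply, star_trivial]

theorem hermitianAdjoint_apply (N A : Matrix ι ι ℂ) : hermitianAdjoint N A = N * Aᴴ * N := rfl

theorem hermitianAdjoint_mul {N : Matrix ι ι ℂ} (hN : N * N = 1) (A C : Matrix ι ι ℂ) :
    hermitianAdjoint N (A * C) = hermitianAdjoint N C * hermitianAdjoint N A := by
  simp only [hermitianAdjoint_apply, Matrix.conjTranspose_mul]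
  calc N * (Cᴴ * Aᴴ) * N = N * Cᴴ * 1 * Aᴴ * N := by rw [mul_one]; simp only [mul_assoc]
    _ = _ := by rw [← hN]; simp only [mul_assoc]

theorem hermitianAdjoint_hermitianAdjoint {N : Matrix ι ι ℂ} (hN : N * N = 1) (hNH : Nᴴ = N)
    (A : Matrix ι ι ℂ) : hermitianAdjoint N (hermitianAdjoint N A) = A := by
  simp only [hermitianAdjoint_apply, Matrix.conjTranspose_mul, Matrix.conjTranspose_conjTranspose,
    hNH]
  calc N * (N * (A * N)) * N = N * N * A * (N * N) := by simp only [mul_assoc]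
    _ = A := by rw [hN, one_mul, mul_one]

theorem mem_range_formGroupVal_one (A : Matrix ι ι ℂ) :
    A ∈ Set.range (formGroupVal (1 : Matrix ι ι ℂ)) ↔ Aᵀ * A = 1 := by
  rw [mem_range_formGroupVal (one_mul 1), formAdjoint_apply, one_mul, mul_one]

/-- For complex orthogonal `A` the inverse of `Aᴴ` is the conjugate matrix `Aᵀᴴ`. The stabilizer
condition thus becomes linear over the reals in `A`: it says that `A` commutes with the antilinear
map `z ↦ N z̄`. -/
theorem mul_hermitianAdjoint_eq_one_iff {N A : Matrix ι ι ℂ} (hN : N * N = 1) (hA : Aᵀ * A = 1) :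
    A * hermitianAdjoint N A = 1 ↔ A * N = N * Aᵀᴴ := by
  have h1 : Aᴴ * Aᵀᴴ = 1 := by
    rw [← Matrix.conjTranspose_mul, hA, Matrix.conjTranspose_one]
  have h2 : Aᵀᴴ * Aᴴ = 1 := mul_eq_one_comm.1 h1
  rw [hermitianAdjoint_apply]
  constructor
  · intro h
    calc A * N = A * (N * (Aᴴ * Aᵀᴴ)) := by rw [h1, mul_one]
      _ = A * (N * Aᴴ * (N * N) * Aᵀᴴ) := by rw [hN]; simp only [mul_assoc, one_mul]
      _ = A * (N * Aᴴ * N) * N * Aᵀᴴ := by simp only [mul_assoc]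
      _ = N * Aᵀᴴ := by rw [h, one_mul]
  · intro h
    calc A * (N * Aᴴ * N) = A * N * Aᴴ * N := by simp only [mul_assoc]
      _ = N * (Aᵀᴴ * Aᴴ) * N := by rw [h]; simp only [mul_assoc]
      _ = 1 := by rw [h2, mul_one, hN]

theorem mem_hermitianTwistors_of_orthogonal {lam : ℝ} {N A : Matrix ι ι ℂ}
    (hN : N ∈ hermitianTwistors lam) (hA : Aᵀ * A = 1) : A * N * Aᴴ ∈ hermitianTwistors lam := by
  have hA' : A * Aᵀ = 1 := mul_eq_one_comm.1 hA
  constructor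
  · rw [Matrix.conjTranspose_mul, Matrix.conjTranspose_mul, Matrix.conjTranspose_conjTranspose,
      hN.1, ← Matrix.mul_assoc]
  · have h1 : Aᴴᵀ * Aᴴ = 1 := by
      have h2 := congrArg Matrix.conjTranspose hA'
      rwa [Matrix.conjTranspose_mul, Matrix.conjTranspose_one] at h2
    calc (A * N * Aᴴ)ᵀ * (A * N * Aᴴ) = Aᴴᵀ * (Nᵀ * (Aᵀ * A) * N) * Aᴴ := by
          simp only [Matrix.transpose_mul, mul_assoc]
      _ = (lam : ℂ) • (Aᴴᵀ * Aᴴ) := by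
          rw [hA, mul_one, hN.2, mul_smul_comm, smul_mul_assoc, mul_one]
      _ = _ := by rw [h1]

attribute [local instance] Matrix.linftyOpNormedRing Matrix.linftyOpNormedAlgebra

/-- The symmetric space data are `θ(A) = Aᵀ` and `σ(A) = N Aᴴ N`, with `N` the Hermitian matrix of a
reference twistor. The hypothesis on `Nᵀ` is what makes `θ` and `σ` commute. -/
theorem isTwistorBundle_complexOrthogonal {m : ℕ} {M : Type*} [TopologicalSpace M]
    [ChartedSpace (EuclideanSpace ℝ (Fin m)) M] [IsManifold (𝓡 m) ∞ M]
    {N : Matrix ι ι ℂ} {c : ℝ} (hc : c * c = 1) (hN : N * N = 1) (hNH : Nᴴ = N)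
    (hNt : Nᵀ = (c : ℂ) • N) {H : Subgroup (complexOrthogonal ι)}
    (hH : ∀ a : complexOrthogonal ι, a ∈ H ↔ (a : GL ι ℂ).val * N = N * (a : GL ι ℂ).valᵀᴴ)
    {Q : ModelMetric m → EndModel m → Prop} (hQ : IsNaturalFamily Q)
    (g : PseudoRiemannianMetric m M) {Z : Set (EndTotal m M)}
    (hZ : ∀ z, z ∈ Z ↔ Q (g.model z.proj) z.snd) {p q : ℕ} (hg : g.HasSignature p q)
    (hPR : ∀ f : ModelMetric m, f.IsMetric →
      ∃ (P : EndModel m →ₗ[ℝ] Matrix ι ι ℂ) (R : Matrix ι ι ℂ →ₗ[ℝ] EndModel m),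
        (∀ S, Q f S → (∃ A : Matrix ι ι ℂ, Aᵀ * A = 1 ∧ P S = A * N * Aᴴ) ∧ R (P S) = S) ∧
        (∀ A : Matrix ι ι ℂ, Aᵀ * A = 1 → Q f (R (A * N * Aᴴ))) ∧ ∀ B, P (R B) = B)
    {lam : ℝ} {T : (∀ x : M, EndExt m x) → Prop}
    (hT : ∀ S, T S ↔ (IsSmoothEndSection S ∧ ∀ x, TotalSpace.mk' (EndModel m) x (S x) ∈ Z) ∧
      IsCourantInvolutive lam S) :
    IsTwistorBundle Z (entries : complexOrthogonal ι → _) H lam T := by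
  have h11 : (1 : Matrix ι ι ℂ) * 1 = 1 := one_mul 1
  let θ : AntiInvolution (Matrix ι ι ℂ) := AntiInvolution.ofLinear (formAdjoint 1)
    (formAdjoint_mul h11) (formAdjoint_formAdjoint h11 Matrix.transpose_one)
  let σ : AntiInvolution (Matrix ι ι ℂ) := AntiInvolution.ofLinear (hermitianAdjoint N)
    (hermitianAdjoint_mul hN) (hermitianAdjoint_hermitianAdjoint hN hNH)
  have hval : ∀ a : complexOrthogonal ι, (a : GL ι ℂ).valᵀ * (a : GL ι ℂ).val = 1 := fun a =>
    (mem_range_formGroupVal_one _).1 ⟨a, rfl⟩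
  obtain ⟨D⟩ := nonempty_orbitData_symmetricSpace (H := H) θ σ (isInducing_entries h11)
    (Matrix.ofLinearEquiv ℝ) (formGroupVal 1) (fun a => rfl)
    -- Transposition meets `N` twice, and the two factors `c` cancel because `c² = 1`.
    (mem_range_formGroupVal h11) (fun r => by
      change formAdjoint 1 (hermitianAdjoint N r) = hermitianAdjoint N (formAdjoint 1 r)
      simp only [formAdjoint_apply, hermitianAdjoint_apply, one_mul, mul_one,
        Matrix.transpose_mul, hNt, smul_mul_assoc, mul_smul_comm, smul_smul]
      rw [← Complex.ofReal_mul, hc, Complex.ofReal_one, one_smul, mul_assoc]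
      rfl)
    (fun a => (hH a).trans (mul_hermitianAdjoint_eq_one_iff hN (hval a)).symm)
  refine isTwistorBundle_of_model D hQ g hZ hg (fun f hf _ => ?_) hT
  obtain ⟨P, R, h1, h2, h3⟩ := hPR f hf
  have hNN : ∀ B : Matrix ι ι ℂ, B * N * N = B := fun B => by rw [mul_assoc, hN, mul_one]
  have horb : ∀ A : Matrix ι ι ℂ, A * hermitianAdjoint N A * N = A * N * Aᴴ := fun A => by
    rw [hermitianAdjoint_apply, ← mul_assoc, hNN, mul_assoc]
  -- The orbit of `1` consists of the matrices `A N Aᴴ N`; right multiplication by `N` passes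
  -- between it and the orbit of `N` under `A N Aᴴ`.
  refine ⟨(LinearMap.mulRight ℝ N).comp P, R.comp (LinearMap.mulRight ℝ N), fun S hS => ?_, ?_⟩
  · obtain ⟨⟨A, hA, hPS⟩, hR⟩ := h1 S hS
    obtain ⟨a, rfl⟩ := (mem_range_formGroupVal_one A).2 hA
    refine ⟨⟨a, ?_⟩, ?_⟩
    · change formGroupVal 1 a * hermitianAdjoint N (formGroupVal 1 a) = P S * N
      rw [hPS, ← horb, hNN]
    · change R (P S * N * N) = S
      rw [hNN, hR]
  · rintro _ ⟨a, rfl⟩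
    change Q f (R (formGroupVal 1 a * hermitianAdjoint N (formGroupVal 1 a) * N)) ∧
      P (R (formGroupVal 1 a * hermitianAdjoint N (formGroupVal 1 a) * N)) * N =
        formGroupVal 1 a * hermitianAdjoint N (formGroupVal 1 a)
    rw [h3, hNN, horb]
    exact ⟨h2 _ (hval a), rfl⟩

end ComplexOrthogonal

end

noncomputable section

/-! ### The subgroups `O(n, n')` and `SO*(2r)` of the complex orthogonal group -/

section RealForm

variable (n n' : ℕ)

theorem unitDiag_mul_self : (unitDiag n n').val * (unitDiag n n').val = complexSigns n n' := by
  change Matrix.diagonal _ * Matrix.diagonal _ = _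
  rw [Matrix.diagonal_mul_diagonal, complexSigns]
  congr 1
  funext i
  rcases i with i | i <;> simp [signs]

theorem unitDiag_transpose : (unitDiag n n').valᵀ = (unitDiag n n').val :=
  Matrix.diagonal_transpose _

theorem unitDiag_conjTranspose : (unitDiag n n').valᴴ = (unitDiag n n')⁻¹.val := by
  change (Matrix.diagonal _)ᴴ = Matrix.diagonal _
  rw [Matrix.diagonal_conjTranspose]
  congr 1
  funext i
  rcases i with i | i <;> simp

theorem unitDiag_inv_transpose : ((unitDiag n n')⁻¹).valᵀ = (unitDiag n n')⁻¹.val :=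
  Matrix.diagonal_transpose _

theorem unitDiag_inv_conjTranspose : ((unitDiag n n')⁻¹).valᴴ = (unitDiag n n').val := by
  rw [← unitDiag_conjTranspose, Matrix.conjTranspose_conjTranspose]

theorem complexSigns_mul_unitDiag :
    complexSigns n n' * (unitDiag n n')⁻¹.val = (unitDiag n n').val := by
  rw [← unitDiag_mul_self, mul_assoc, Units.mul_inv, mul_one]

theorem unitDiag_mul_complexSigns :
    (unitDiag n n')⁻¹.val * complexSigns n n' = (unitDiag n n').val := by
  rw [← unitDiag_mul_self, ← mul_assoc, Units.inv_mul, one_mul]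

theorem signMatrix_map : (signMatrix n n').map ((↑) : ℝ → ℂ) = complexSigns n n' := by
  rw [signMatrix_eq, complexSigns, Matrix.diagonal_map Complex.ofReal_zero]

/-- With `P = diag(1, i)` one has `P² = η` and the conjugate of `P` is `P⁻¹`. Therefore `B η = η B̄`
says precisely that `P B P⁻¹` is real, and orthogonality of `B` becomes invariance of `η`. -/
theorem mem_range_pseudoToComplex (a : complexOrthogonal (Fin n ⊕ Fin n')) :
    a ∈ (pseudoToComplex n n').range ↔
      (a : GL (Fin n ⊕ Fin n') ℂ).val * complexSigns n n' =
        complexSigns n n' * (a : GL (Fin n ⊕ Fin n') ℂ).valᵀᴴ := by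
  obtain ⟨P, hP⟩ : ∃ P, P = (unitDiag n n').val := ⟨_, rfl⟩
  obtain ⟨Q, hQ⟩ : ∃ Q, Q = (unitDiag n n')⁻¹.val := ⟨_, rfl⟩
  obtain ⟨η, hη⟩ : ∃ η, η = complexSigns n n' := ⟨_, rfl⟩
  have hPQ : P * Q = 1 := by rw [hP, hQ, Units.mul_inv]
  have hQP : Q * P = 1 := by rw [hP, hQ, Units.inv_mul]
  have hPt : Pᵀᴴ = Q := by rw [hP, hQ, unitDiag_transpose, unitDiag_conjTranspose]
  have hQt : Qᵀᴴ = P := by rw [hP, hQ, unitDiag_inv_transpose, unitDiag_inv_conjTranspose]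
  have hηQ : η * Q = P := by rw [hη, hQ, hP, complexSigns_mul_unitDiag]
  have hQη : Q * η = P := by rw [hη, hQ, hP, unitDiag_mul_complexSigns]
  have hηη : η * η = 1 := by rw [hη, complexSigns_mul_self]
  have hηP : η * P = Q := by rw [← hηQ, ← mul_assoc, hηη, one_mul]
  have hPη : P * η = Q := by rw [← hQη, mul_assoc, hηη, mul_one]
  rw [← hη]
  constructor
  · rintro ⟨A, rfl⟩
    obtain ⟨C, hC⟩ : ∃ C, C = ((A : GL (Fin n ⊕ Fin n') ℝ).val).map ((↑) : ℝ → ℂ) := ⟨_, rfl⟩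
    have h1 : (pseudoToComplex n n' A : GL (Fin n ⊕ Fin n') ℂ).val = Q * C * P := by
      rw [hC, hP, hQ]
      rfl
    have h2 : Cᵀᴴ = C := by
      rw [hC]
      ext i j
      simp
    rw [h1, Matrix.transpose_mul, Matrix.transpose_mul, Matrix.conjTranspose_mul,
      Matrix.conjTranspose_mul, h2, hPt, hQt, mul_assoc, hPη, ← mul_assoc η, ← mul_assoc η, hηP]
  · intro h
    obtain ⟨B, hB⟩ : ∃ B, B = (a : GL (Fin n ⊕ Fin n') ℂ).val := ⟨_, rfl⟩
    have hBB : Bᵀ * B = 1 := by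
      rw [hB]
      exact (mem_range_formGroupVal_one _).1 ⟨a, rfl⟩
    rw [← hB] at h
    obtain ⟨C, hC⟩ : ∃ C, C = (P * B * Q).map Complex.re := ⟨_, rfl⟩
    have h1 : (P * B * Q)ᵀᴴ = P * B * Q := by
      rw [Matrix.transpose_mul, Matrix.transpose_mul, Matrix.conjTranspose_mul,
        Matrix.conjTranspose_mul, hPt, hQt]
      calc Q * Bᵀᴴ * P = P * (η * Bᵀᴴ) * P := by rw [← mul_assoc P, hPη]
        _ = P * B * (η * P) := by rw [← h]; simp only [mul_assoc]
        _ = P * B * Q := by rw [hηP]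
    have h2 : C.map ((↑) : ℝ → ℂ) = P * B * Q := by
      rw [hC]
      ext i j
      exact Complex.conj_eq_iff_re.1 (congrFun (congrFun h1 i) j)
    have hPt' : Pᵀ = P := by rw [hP, unitDiag_transpose]
    have hQt' : Qᵀ = Q := by rw [hQ, unitDiag_inv_transpose]
    have h3 : Cᵀ * signMatrix n n' * C = signMatrix n n' := by
      have hinj : Function.Injective fun X : Matrix (Fin n ⊕ Fin n') (Fin n ⊕ Fin n') ℝ =>
          X.map ((↑) : ℝ → ℂ) := Matrix.map_injective Complex.ofReal_injective
      refine hinj ?_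
      have h4 : (Cᵀ * signMatrix n n' * C).map ((↑) : ℝ → ℂ) =
          (C.map ((↑) : ℝ → ℂ))ᵀ * (signMatrix n n').map ((↑) : ℝ → ℂ) * C.map ((↑) : ℝ → ℂ) := by
        rw [← Matrix.transpose_map]
        exact (Matrix.map_mul (f := Complex.ofRealHom)).trans
          (congrArg (· * _) (Matrix.map_mul (f := Complex.ofRealHom)))
      change (Cᵀ * signMatrix n n' * C).map ((↑) : ℝ → ℂ) = (signMatrix n n').map ((↑) : ℝ → ℂ)
      rw [h4, h2, signMatrix_map, ← hη, Matrix.transpose_mul, Matrix.transpose_mul, hPt', hQt']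
      calc Q * (Bᵀ * P) * η * (P * B * Q) = Q * Bᵀ * (P * η * P) * B * Q := by
            simp only [mul_assoc]
        _ = Q * (Bᵀ * B) * Q := by rw [hPη, hQP, mul_one]; simp only [mul_assoc]
        _ = η * P * Q := by rw [hBB, mul_one, hηP]
        _ = η := by rw [mul_assoc, hPQ, mul_one]
    obtain ⟨A, hA⟩ := (mem_range_formGroupVal (signMatrix_mul_self n n') C).2
      ((formAdjoint_mul_self_eq_one_iff (signMatrix_mul_self n n') C).2 h3)
    refine ⟨A, Subtype.ext (Units.ext ?_)⟩
    rw [← hB]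
    have h5 : (pseudoToComplex n n' A : GL (Fin n ⊕ Fin n') ℂ).val =
        Q * (formGroupVal (signMatrix n n') A).map ((↑) : ℝ → ℂ) * P := by
      rw [hP, hQ]
      rfl
    rw [h5, hA, h2]
    calc Q * (P * B * Q) * P = Q * P * B * (Q * P) := by simp only [mul_assoc]
      _ = B := by rw [hQP, one_mul, mul_one]

end RealForm

/-! ### `SO*(2r)` as the quaternionic matrices in `O(2r, ℂ)` -/

section Quaternion

variable {r : ℕ}

theorem quatToComplex_injective : Function.Injective
    (quatToComplex : Matrix (Fin r) (Fin r) ℍ[ℝ] → Matrix (Fin r ⊕ Fin r) (Fin r ⊕ Fin r) ℂ) := by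
  intro A B h
  ext i j
  all_goals
    have h1 := congrFun (congrFun h (Sum.inl i)) (Sum.inl j)
    have h2 := congrFun (congrFun h (Sum.inr i)) (Sum.inl j)
    simp [quatToComplex, Complex.ext_iff] at h1 h2
    simp [h1, h2]

theorem quatToComplex_skewForm : quatToComplex (skewForm r) = Matrix.fromBlocks 0 (-1) 1 0 := by
  have hs : ∀ i j : Fin r, skewForm r i j = if i = j then (⟨0, 0, 1, 0⟩ : ℍ[ℝ]) else 0 :=
    fun i j => Matrix.diagonal_apply ..
  ext i j
  rcases i with i | i <;> rcases j with j | j <;> by_cases hij : i = j <;>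
    simp [quatToComplex, hs, hij, Complex.ext_iff]

theorem quatToComplex_conjTranspose_mul (A : Matrix (Fin r) (Fin r) ℍ[ℝ]) :
    quatToComplex Aᴴ * Matrix.fromBlocks 0 (-1) 1 0 =
      Matrix.fromBlocks 0 (-1) 1 0 * (quatToComplex A)ᵀ := by
  simp only [quatToComplex, Matrix.fromBlocks_transpose, Matrix.fromBlocks_multiply,
    Matrix.fromBlocks_inj, Matrix.mul_zero, Matrix.zero_mul, Matrix.mul_one, Matrix.one_mul,
    Matrix.mul_neg, Matrix.neg_mul, zero_add, add_zero]
  refine ⟨?_, ?_, ?_, ?_⟩ <;> ext i j <;> simp [Complex.ext_iff]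

theorem skewForm_mul_self : skewForm r * skewForm r = -1 := by
  refine quatToComplex_injective ?_
  rw [quatToComplex_mul, quatToComplex_skewForm]
  have h : quatToComplex (-1 : Matrix (Fin r) (Fin r) ℍ[ℝ]) = -quatToComplex 1 := by
    ext i j
    rcases i with i | i <;> rcases j with j | j <;> by_cases hij : i = j <;>
      simp [quatToComplex, Matrix.one_apply, hij, Complex.ext_iff]
  rw [h, quatToComplex_one]
  simp [Matrix.fromBlocks_multiply, ← Matrix.fromBlocks_one, Matrix.fromBlocks_neg]

/-- The quaternions are not commutative; the claim is transported from complex matrices by the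
injective homomorphism `quatToComplex`. -/
theorem mul_eq_one_comm_quaternion {A B : Matrix (Fin r) (Fin r) ℍ[ℝ]} (h : A * B = 1) :
    B * A = 1 := by
  refine quatToComplex_injective ?_
  rw [quatToComplex_mul, quatToComplex_one, mul_eq_one_comm, ← quatToComplex_mul, h,
    quatToComplex_one]

theorem exists_soStar {A : Matrix (Fin r) (Fin r) ℍ[ℝ]}
    (hA : (quatToComplex A)ᵀ * quatToComplex A = 1) : ∃ a : soStar r, a.1.val = A := by
  have h : Aᴴ * skewForm r * A = skewForm r := by
    refine quatToComplex_injective ?_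
    rw [quatToComplex_mul, quatToComplex_mul, quatToComplex_skewForm,
      quatToComplex_conjTranspose_mul, mul_assoc, hA, mul_one]
  have h1 : -(skewForm r * Aᴴ * skewForm r) * A = 1 := by
    rw [Matrix.neg_mul, mul_assoc, mul_assoc, ← mul_assoc Aᴴ, h, skewForm_mul_self, neg_neg]
  exact ⟨⟨⟨A, _, mul_eq_one_comm_quaternion h1, h1⟩, h⟩, rfl⟩

/-- The scalar `i` cancels, and `B J = J B̄` becomes the pair of block relations `b = -c̄`, `d = ā`,
which is the shape of a quaternionic matrix. -/
theorem mul_hermitianJ_eq_iff (B : Matrix (Fin r ⊕ Fin r) (Fin r ⊕ Fin r) ℂ) :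
    B * hermitianJ (Fin r) = hermitianJ (Fin r) * Bᵀᴴ ↔ ∃ A, quatToComplex A = B := by
  obtain ⟨a, b, c, d, rfl⟩ : ∃ a b c d, B = Matrix.fromBlocks a b c d :=
    ⟨_, _, _, _, (Matrix.fromBlocks_toBlocks B).symm⟩
  have h1 : Matrix.fromBlocks a b c d * hermitianJ (Fin r) =
      hermitianJ (Fin r) * (Matrix.fromBlocks a b c d)ᵀᴴ ↔ b = -cᵀᴴ ∧ d = aᵀᴴ := by
    have hs : ∀ X Y : Matrix (Fin r) (Fin r) ℂ, Complex.I • X = Complex.I • Y ↔ X = Y :=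
      fun X Y => (smul_right_injective _ Complex.I_ne_zero).eq_iff
    have hn : ∀ X : Matrix (Fin r) (Fin r) ℂ, -(Complex.I • X) = Complex.I • -X :=
      fun X => (smul_neg _ _).symm
    simp only [hermitianJ, Matrix.fromBlocks_transpose, Matrix.fromBlocks_conjTranspose,
      Matrix.fromBlocks_multiply, Matrix.fromBlocks_inj, Matrix.mul_zero, Matrix.zero_mul,
      Matrix.mul_neg, Matrix.neg_mul, Matrix.mul_smul, Matrix.smul_mul, Matrix.mul_one,
      Matrix.one_mul, zero_add, add_zero, hn, hs]
    constructor
    · rintro ⟨h1, -, h3, -⟩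
      exact ⟨h1, h3⟩
    · rintro ⟨rfl, rfl⟩
      refine ⟨rfl, ?_, rfl, ?_⟩
      · ext i j
        simp
      · ext i j
        simp
  rw [h1]
  constructor
  · rintro ⟨rfl, rfl⟩
    obtain ⟨A, hA⟩ : ∃ A : Matrix (Fin r) (Fin r) ℍ[ℝ],
        ∀ i j, A i j = ⟨(a i j).re, (a i j).im, (c i j).re, -(c i j).im⟩ :=
      ⟨fun i j => _, fun i j => rfl⟩
    refine ⟨A, ?_⟩
    rw [quatToComplex, Matrix.fromBlocks_inj]
    refine ⟨?_, ?_, ?_, ?_⟩ <;> ext i j <;> simp [hA, Complex.ext_iff]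
  · rintro ⟨A, hA⟩
    rw [quatToComplex, Matrix.fromBlocks_inj] at hA
    obtain ⟨rfl, rfl, rfl, rfl⟩ := hA
    constructor <;> ext i j <;> simp [Complex.ext_iff]

theorem mem_range_soStarToComplex (a : complexOrthogonal (Fin r ⊕ Fin r)) :
    a ∈ (soStarToComplex r).range ↔
      (a : GL (Fin r ⊕ Fin r) ℂ).val * hermitianJ (Fin r) =
        hermitianJ (Fin r) * (a : GL (Fin r ⊕ Fin r) ℂ).valᵀᴴ := by
  rw [mul_hermitianJ_eq_iff]
  constructor
  · rintro ⟨A, rfl⟩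
    exact ⟨A.1.val, rfl⟩
  · rintro ⟨A, hA⟩
    have h1 := (mem_range_formGroupVal_one (a : GL (Fin r ⊕ Fin r) ℂ).val).1 ⟨a, rfl⟩
    rw [← hA] at h1
    obtain ⟨A, rfl⟩ := exists_soStar h1
    exact ⟨A, Subtype.ext (Units.ext hA)⟩

end Quaternion

end

noncomputable section

/-! ### The twistor bundles with typical fiber a quotient of the complex orthogonal group -/

section ComplexBundle

variable {m : ℕ}

theorem IsModelTwistor.exists_signature {f : ModelMetric m} (hf : f.IsMetric) {S : EndModel m}
    (hS : IsModelTwistor 1 1 f S) :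
    ∃ n ≤ m, HasSignature (modelSigForm f S) (2 * n) (2 * m - 2 * n) := by
  obtain ⟨ζ, P, R, hP, -, -, hsig⟩ := exists_complexCoordinates (ι := Fin m) 1 (one_mul 1) hf
    (Fintype.card_fin m)
  obtain ⟨hPS, hR⟩ := hP S hS
  obtain ⟨a, b, C, h1, h2, h3⟩ := hermitianTwistors.exists_real_frame hPS
  have hab := card_eq_of_complex_frame h1 h2
  rw [Fintype.card_fin] at hab
  have h := hasSignature_of_complex_frame ζ (hsig _) h1 h2 h3
  rw [hR] at h
  refine ⟨a, by omega, ?_⟩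
  rwa [show 2 * m - 2 * a = 2 * b by omega]

/-- A real frame `C` has `Cᵀ C = η` instead of `1`. Multiplication by `D = diag(1, i)` makes it
orthogonal, and `D η Dᴴ = η` leaves the normal form of the Hermitian matrix unchanged. -/
theorem exists_complexCoordinates_sig {n n' : ℕ} (hn : n + n' = m) {f : ModelMetric m}
    (hf : f.IsMetric) : ∃ (P : EndModel m →ₗ[ℝ] Matrix (Fin n ⊕ Fin n') (Fin n ⊕ Fin n') ℂ)
      (R : Matrix (Fin n ⊕ Fin n') (Fin n ⊕ Fin n') ℂ →ₗ[ℝ] EndModel m),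
        (∀ S, (IsModelTwistor 1 1 f S ∧
            HasSignature (modelSigForm f S) (2 * n) (2 * m - 2 * n)) →
          (∃ A, Aᵀ * A = 1 ∧ P S = A * complexSigns n n' * Aᴴ) ∧ R (P S) = S) ∧
        (∀ A, Aᵀ * A = 1 → IsModelTwistor 1 1 f (R (A * complexSigns n n' * Aᴴ)) ∧
          HasSignature (modelSigForm f (R (A * complexSigns n n' * Aᴴ))) (2 * n)
            (2 * m - 2 * n)) ∧ ∀ B, P (R B) = B := by
  obtain ⟨ζ, P, R, hP, hR, hPR, hsig⟩ := exists_complexCoordinates (ι := Fin n ⊕ Fin n') 1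
    (one_mul 1) hf (by simpa using hn)
  have hm : 2 * m - 2 * n = 2 * n' := by omega
  rw [hm]
  obtain ⟨D, hD⟩ : ∃ D, D = (unitDiag n n').val := ⟨_, rfl⟩
  obtain ⟨E, hE⟩ : ∃ E, E = (unitDiag n n')⁻¹.val := ⟨_, rfl⟩
  obtain ⟨η, hη⟩ : ∃ η, η = complexSigns n n' := ⟨_, rfl⟩
  have hDE : D * E = 1 := by rw [hD, hE, Units.mul_inv]
  have hED : E * D = 1 := by rw [hD, hE, Units.inv_mul]
  have hDt : Dᵀ = D := by rw [hD, unitDiag_transpose]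
  have hEt : Eᵀ = E := by rw [hE, unitDiag_inv_transpose]
  have hDH : Dᴴ = E := by rw [hD, hE, unitDiag_conjTranspose]
  have hEH : Eᴴ = D := by rw [hD, hE, unitDiag_inv_conjTranspose]
  have hηE : η * E = D := by rw [hη, hE, hD, complexSigns_mul_unitDiag]
  have hEη : E * η = D := by rw [hη, hE, hD, unitDiag_mul_complexSigns]
  have hηη : η * η = 1 := by rw [hη, complexSigns_mul_self]
  have hηD : η * D = E := by rw [← hηE, ← mul_assoc, hηη, one_mul]
  have hDη : D * η = E := by rw [← hEη, mul_assoc, hηη, mul_one]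
  have hEE : E * E = η := by
    nth_rw 1 [← hηD]
    rw [mul_assoc, hDE, mul_one]
  refine ⟨P, R, fun S hS => ⟨?_, (hP S hS.1).2⟩, fun A hA => ⟨hR _ ?_, ?_⟩, hPR⟩
  · obtain ⟨hPS, hRS⟩ := hP S hS.1
    obtain ⟨a, b, C, h1, h2, h3⟩ := hermitianTwistors.exists_real_frame hPS
    have h := hasSignature_of_complex_frame ζ (hsig _) h1 h2 h3
    rw [hRS] at h
    -- The frame computes the signature as `(2a, 2b)`, so the prescribed signature determines the
    -- size of both blocks.
    obtain ⟨rfl, rfl⟩ : a = n ∧ b = n' := by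
      have h4 := h.1.symm.trans hS.2.1
      have h5 := h.2.symm.trans hS.2.2
      omega
    rw [← hη] at h1 h3 ⊢
    refine ⟨C * D, ?_, ?_⟩
    · calc (C * D)ᵀ * (C * D) = D * (Cᵀ * C) * D := by
            rw [Matrix.transpose_mul, hDt]
            simp only [mul_assoc]
        _ = 1 := by rw [h1, hDη, hED]
    · rw [h3, Matrix.conjTranspose_mul, hDH]
      calc C * η * Cᴴ = C * (D * η * E) * Cᴴ := by rw [hDη, hEE]
        _ = C * D * η * (E * Cᴴ) := by simp only [mul_assoc]
  · refine mem_hermitianTwistors_of_orthogonal ⟨complexSigns_conjTranspose n n', ?_⟩ hA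
    rw [complexSigns_transpose, complexSigns_mul_self, Complex.ofReal_one, one_smul]
  · have hA' : A * Aᵀ = 1 := mul_eq_one_comm.1 hA
    refine hasSignature_of_complex_frame ζ (hsig _) (C := A * E) ?_ ?_ ?_
    · rw [← hη, Matrix.transpose_mul, hEt]
      calc E * Aᵀ * (A * E) = E * (Aᵀ * A) * E := by simp only [mul_assoc]
        _ = η := by rw [hA, mul_one, hEE]
    · rw [← hη, Matrix.transpose_mul, hEt]
      calc A * E * η * (E * Aᵀ) = A * (E * η * E) * Aᵀ := by simp only [mul_assoc]
        _ = 1 := by rw [hEη, hDE, mul_one, hA']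
    · rw [← hη, Matrix.conjTranspose_mul, hEH]
      calc A * η * Aᴴ = A * (E * η * D) * Aᴴ := by rw [mul_assoc E, hηD, hEE]
        _ = A * E * η * (D * Aᴴ) := by simp only [mul_assoc]

theorem IsModelTwistor.even_dim {f : ModelMetric m} (hf : f.IsMetric) {S : EndModel m}
    (hS : IsModelTwistor (-1) (-1) f S) : Even m := by
  obtain ⟨ζ, P, R, hP, -⟩ := exists_complexCoordinates (ι := Fin m) (-1)
    (show (-1 : ℝ) * (-1) = 1 by norm_num) hf
    (Fintype.card_fin m)
  obtain ⟨k, -, hk, -⟩ := hermitianTwistors.exists_quaternionic_frame (hP S hS).1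
  rw [Fintype.card_fin] at hk
  exact ⟨k, by omega⟩

theorem hermitianJ_mem_hermitianTwistors (r : ℕ) : hermitianJ (Fin r) ∈ hermitianTwistors (-1) := by
  refine ⟨hermitianJ_conjTranspose _, ?_⟩
  rw [hermitianJ_transpose, smul_mul_assoc, hermitianJ_mul_self]

theorem exists_complexCoordinates_quaternionic {r : ℕ} (hr : m = 2 * r) {f : ModelMetric m}
    (hf : f.IsMetric) : ∃ (P : EndModel m →ₗ[ℝ] Matrix (Fin r ⊕ Fin r) (Fin r ⊕ Fin r) ℂ)
      (R : Matrix (Fin r ⊕ Fin r) (Fin r ⊕ Fin r) ℂ →ₗ[ℝ] EndModel m),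
        (∀ S, IsModelTwistor (-1) (-1) f S →
          (∃ A, Aᵀ * A = 1 ∧ P S = A * hermitianJ (Fin r) * Aᴴ) ∧ R (P S) = S) ∧
        (∀ A, Aᵀ * A = 1 → IsModelTwistor (-1) (-1) f (R (A * hermitianJ (Fin r) * Aᴴ))) ∧
        ∀ B, P (R B) = B := by
  obtain ⟨ζ, P, R, hP, hR, hPR, -⟩ := exists_complexCoordinates (ι := Fin r ⊕ Fin r) (-1)
    (show (-1 : ℝ) * (-1) = 1 by norm_num) hf (by rw [Fintype.card_sum, Fintype.card_fin]; omega)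
  refine ⟨P, R, fun S hS => ⟨?_, (hP S hS).2⟩, fun A hA => hR _
    (mem_hermitianTwistors_of_orthogonal (hermitianJ_mem_hermitianTwistors r) hA), hPR⟩
  obtain ⟨k, A, hk, hA, hMA⟩ := hermitianTwistors.exists_quaternionic_frame (hP S hS).1
  obtain rfl : r = k := by
    rw [Fintype.card_sum, Fintype.card_fin] at hk
    omega
  refine ⟨A, hA, ?_⟩
  have h1 : Aᵀᴴ * Aᴴ = 1 := by
    rw [← Matrix.conjTranspose_mul, mul_eq_one_comm.1 hA, Matrix.conjTranspose_one]
  rw [← hMA, mul_assoc, h1, mul_one]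

end ComplexBundle

/-! ### The four families of twistor bundles -/

theorem mainTheorem1 {m : ℕ} {M : Type*} [TopologicalSpace M] [T2Space M]
    [SecondCountableTopology M] [ChartedSpace (EuclideanSpace ℝ (Fin m)) M]
    [IsManifold (𝓡 m) ∞ M] (g : PseudoRiemannianMetric m M) (p q : ℕ)
    (hg : g.HasSignature p q) :
    -- `(1, 1)` with `sig = n`: `O(m, ℂ) / O(n, m - n)`
    (∀ z ∈ twistorSpace g 1 1, ∃ n ≤ m, z ∈ twistorSpaceSig g n) ∧
    (∀ n n' : ℕ, n + n' = m →
      IsTwistorBundle (twistorSpaceSig g n)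
        (entries : complexOrthogonal (Fin n ⊕ Fin n') → _) (pseudoToComplex n n').range
        1 (IsIntegrableStructureSig g n)) ∧
    -- `(1, -1)`: `(O(p, q) × O(p, q)) / O(p, q)`
    IsTwistorBundle (twistorSpace g 1 (-1))
      (entriesPair : pseudoOrthogonal p q × pseudoOrthogonal p q → _) (diagonalHom p q).range
      1 (IsIntegrableStructure g 1 (-1)) ∧
    -- `(-1, 1)`: `g` is split, and `(O(p, p) × O(p, p)) / O(p, p)`
    ((twistorSpace g (-1) 1).Nonempty → p = q) ∧
    (p = q →
      IsTwistorBundle (twistorSpace g (-1) 1)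
        (entriesPair : pseudoOrthogonal p p × pseudoOrthogonal p p → _) (diagonalHom p p).range
        (-1) (IsIntegrableStructure g (-1) 1)) ∧
    -- `(-1, -1)`: `m` is even, and `O(m, ℂ) / SO*(m)`
    ((twistorSpace g (-1) (-1)).Nonempty → Even m) ∧
    (∀ r : ℕ, m = 2 * r →
      IsTwistorBundle (twistorSpace g (-1) (-1))
        (entries : complexOrthogonal (Fin r ⊕ Fin r) → _) (soStarToComplex r).range
        (-1) (IsIntegrableStructure g (-1) (-1))) := by
  refine ⟨fun z hz => ?_, fun n n' hn => ?_, ?_, ?_, ?_, ?_, fun r hr => ?_⟩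
  · have h := (mem_twistorSpace_iff g 1 1 z).1 hz
    obtain ⟨n, hn, hsig⟩ := h.exists_signature (g.isMetric_model _)
    exact ⟨n, hn, (mem_twistorSpaceSig_iff g n z).2 ⟨h, hsig⟩⟩
  · exact isTwistorBundle_complexOrthogonal (one_mul 1) (complexSigns_mul_self n n')
      (complexSigns_conjTranspose n n')
      (by rw [complexSigns_transpose, Complex.ofReal_one, one_smul])
      (mem_range_pseudoToComplex n n')
      (isNaturalFamily_isModelTwistor_sig (2 * n) (2 * m - 2 * n)) g (mem_twistorSpaceSig_iff g n)
      hg (fun f hf => exists_complexCoordinates_sig hn hf) (isIntegrableStructureSig_iff g n)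
  -- For `lam = 1` the blocks are already isometries, so the twist is `s = 1`.
  · exact isTwistorBundle_pseudoOrthogonal g (one_mul 1) (by norm_num) (one_mul 1)
      Matrix.transpose_one (by rw [mul_one, one_mul, one_smul]) hg
  · rintro ⟨z, hz⟩
    exact ((mem_twistorSpace_iff g (-1) 1 z).1 hz).signature_eq (g.isMetric_model _)
      (g.hasSig_model hg _)
  · rintro rfl
    -- For `lam = -1` the interchange of the two summands is an anti-isometry of the split form.
    exact isTwistorBundle_pseudoOrthogonal g (by norm_num) (by norm_num) swapMatrix_mul_self
      swapMatrix_transpose signMatrix_mul_swapMatrix hg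
  · rintro ⟨z, hz⟩
    exact ((mem_twistorSpace_iff g (-1) (-1) z).1 hz).even_dim (g.isMetric_model _)
  -- The reference matrix `i J` is Hermitian with square `1` and antisymmetric, hence `c = -1`.
  · exact isTwistorBundle_complexOrthogonal (c := -1) (by norm_num) (hermitianJ_mul_self _)
      (hermitianJ_conjTranspose _) (hermitianJ_transpose _) mem_range_soStarToComplex
      (isNaturalFamily_isModelTwistor (-1) (-1)) g (mem_twistorSpace_iff g (-1) (-1)) hg
      (fun f hf => exists_complexCoordinates_quaternionic hr hf)
      (isIntegrableStructure_iff g (-1) (-1))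

end
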